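/- Notation. For $A,B\subseteq\mathbb Q$ let $A+B=\{x+y: x\in A,\ y\in B\}$; let $\mathbb Q^2$ be the set of all rational squares (including $0$), $\mathbb Z_{(l)}$ the localization of $\mathbb Z$ at the prime $l$, $v_l$ the $l$-adic valuation, and $J(R)$ the Jacobson radical of a ring $R$. For $a,b\in\mathbb Q^\times$ put $$S_{a,b}=\{2x_1 : x_1,x_2,x_3,x_4\in\mathbb Q,\ x_1^2-ax_2^2-bx_3^2+abx_4^2=1\},\qquad T_{a,b}=S_{a,b}+S_{a,b},$$ $T_{a,b}^\times=\{u\in T_{a,b}: uv=1\text{ for some }v\in T_{a,b}\}$, and let $J_{a,b}$ be the set of all $x\in\mathbb Q$ for which there are $y_1,y_2\in\mathbb Q$ with $$y_1,\,x-y_1\in a\,\mathbb Q^2\,T_{a,b}^\times\cap(1-\mathbb Q^2\,T_{a,b}^\times),\qquad y_2,\,x-y_2\in b\,\mathbb Q^2\,T_{a,b}^\times\cap(1-\mathbb Q^2\,T_{a,b}^\times).$$ For $p,q\in\mathbb Q^\times$ put $R_q^{[3]}=T_{-q,-q}+T_{2q,-q}$ and $R_{p,q}^{[1]}=T_{2pq,q}+T_{-2pq,q}$.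 For $k\in\{1,3\}$ let $\Phi_k$ be the set of $p\in\mathbb Q^\times$ such that $p\in k+8\mathbb Z_{(2)}$ and every prime $l$ with $v_l(p)$ odd satisfies $l\equiv 1$ or $l\equiv k\pmod 8$. Let $$\Psi=\{(p,q)\in\Phi_1\times\Phi_3 : p\in 2\cdot(\mathbb Q^\times)^2\cdot(1+J(R_q^{[3]}))\},$$ where, since $R_q^{[3]}$ is a subring of $\mathbb Q$ for $q\in\Phi_3$, $J(R_q^{[3]})$ is its Jacobson radical. A set $D\subseteq\mathbb Q^k$ is diophantine in $\mathbb Q$ if for some $n$ there is a polynomial $f\in\mathbb Z[t_1,\dots,t_k,x_1,\dots,x_n]$ such that $t\in D$ if and only if $f(t,x)=0$ for some $x\in\mathbb Q^n$. Proposition. For every $(p,q)\in\Psi$, the set $R_{p,q}^{[1]}$ is a subring of $\mathbb Q$, $R_{p,q}^{[1]}\neq\mathbb Q$, and $$J(R_{p,q}^{[1]})=J_{2pq,q}+J_{-2pq,q};$$ in particular $J(R_{p,q}^{[1]})$ is diophantine in $\mathbb Q$. Moreover it is so uniformly in $(p,q)$: there is a diophantine set $D\subseteq\mathbb Q^3$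 such that for all $(p,q)\in\Psi$ and all $t\in\mathbb Q$, $t\in J(R_{p,q}^{[1]})$ if and only if $(t,p,q)\in D$. -/

import Mathlib

open scoped Pointwise

namespace RatDioph

/-- Traces of norm-one elements of the quaternion algebra `(a, b)` over `ℚ`. -/
def S (a b : ℚ) : Set ℚ :=
  {t | ∃ x₁ x₂ x₃ x₄ : ℚ,
    x₁ ^ 2 - a * x₂ ^ 2 - b * x₃ ^ 2 + a * b * x₄ ^ 2 = 1 ∧ t = 2 * x₁}

/-- `T_{a,b} = S_{a,b} + S_{a,b}` (elementwise sums). -/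
def T (a b : ℚ) : Set ℚ := S a b + S a b

/-- The invertible elements of `T_{a,b}`; this makes sense also when `T_{a,b}` is not a ring. -/
def TUnits (a b : ℚ) : Set ℚ := {u | u ∈ T a b ∧ ∃ v ∈ T a b, u * v = 1}

/-- `c · ℚ² · T_{a,b}^×`, where `ℚ²` is the set of all rational squares, including `0`. -/
def sqClass (a b c : ℚ) : Set ℚ := {x | ∃ w : ℚ, ∃ u ∈ TUnits a b, x = c * w ^ 2 * u}

/-- `c · ℚ² · T_{a,b}^× ∩ (1 - ℚ² · T_{a,b}^×)`. -/
def K (a b c : ℚ) : Set ℚ := {y | y ∈ sqClass a b c ∧ ∃ z ∈ sqClass a b 1, y = 1 - z}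

/-- The set `J_{a,b}`. -/
def J (a b : ℚ) : Set ℚ :=
  {x | ∃ y₁ y₂ : ℚ, (y₁ ∈ K a b a ∧ x - y₁ ∈ K a b a) ∧ (y₂ ∈ K a b b ∧ x - y₂ ∈ K a b b)}

/-- `R_p^{[3]} = T_{-p,-p} + T_{2p,-p}`. -/
def R3 (p : ℚ) : Set ℚ := T (-p) (-p) + T (2 * p) (-p)

/-- `R_{p,q}^{[1]} = T_{2pq,q} + T_{-2pq,q}`. -/
def R1 (p q : ℚ) : Set ℚ := T (2 * p * q) q + T (-2 * p * q) q

/-- The Jacobson radical, as a set of rationals, of the subring of `ℚ` generated by `R`.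
If `R` is (the underlying set of) a subring, then this is the Jacobson radical of `R` itself. -/
def jacobsonRadical (R : Set ℚ) : Set ℚ :=
  (fun x : Subring.closure R => (x : ℚ)) '' (Ring.jacobson (Subring.closure R) : Set _)

/-- The local ring `ℤ_(l)`, for `l` prime: rationals whose reduced denominator is prime to `l`. -/
def ZLoc (l : ℕ) : Set ℚ := {x | ¬ l ∣ x.den}

/-- `p ≡₂ k mod 8`, that is `p ∈ k + 8 ℤ_(2)`. -/
def CongTwo (p : ℚ) (k : ℕ) : Prop := ∃ z ∈ ZLoc 2, p = k + 8 * z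

/-- The primes at which `p` has odd valuation. -/
def oddPrimes (p : ℚ) : Set ℕ := {l | l.Prime ∧ Odd (padicValRat l p)}

/-- `Φ_k`: nonzero rationals `p ≡₂ k mod 8` such that every prime at which `p` has odd valuation
is congruent to `1` or `k` modulo `8`. -/
def Φ (k : ℕ) : Set ℚ :=
  {p | p ≠ 0 ∧ CongTwo p k ∧ ∀ l ∈ oddPrimes p, l ≡ 1 [MOD 8] ∨ l ≡ k [MOD 8]}

/-- `Ψ`: pairs `(p, q) ∈ Φ₁ × Φ₃` with `p ∈ 2 · (ℚ^×)² · (1 + J(R_q^{[3]}))`. -/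
def Ψ : Set (ℚ × ℚ) :=
  {x | x.1 ∈ Φ 1 ∧ x.2 ∈ Φ 3 ∧
    ∃ w : ℚ, w ≠ 0 ∧ ∃ j ∈ jacobsonRadical (R3 x.2), x.1 = 2 * w ^ 2 * (1 + j)}

/-- `D ⊆ ℚ^k` is diophantine in `ℚ`: it is the projection of the set of rational zeros of a
polynomial with integer coefficients. -/
def IsDiophantine {k : ℕ} (D : Set (Fin k → ℚ)) : Prop :=
  ∃ (n : ℕ) (f : MvPolynomial (Fin k ⊕ Fin n) ℤ),
    ∀ t : Fin k → ℚ, t ∈ D ↔ ∃ x : Fin n → ℚ, MvPolynomial.aeval (Sum.elim t x) f = 0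

theorem jacobsonRadical_coe (A : Subring ℚ) :
    jacobsonRadical (A : Set ℚ) = (fun x : A => (x : ℚ)) '' (Ring.jacobson A : Set A) := by
  unfold jacobsonRadical
  rw [Subring.closure_eq]

end RatDioph

namespace RatDioph

open scoped NumberTheorySymbols

/-! Up to squares, p and q are positive squarefree integers P ≡ 1 and Q ≡ 3 mod 8, so T_{2pq,q} and
T_{-2pq,q} belong to the quaternion algebras (-2P, Q) and (2P, Q), both split over ℝ because Q > 0.
The central fact is that, for these algebras, T is the semilocal ring of rationals integral at all
ramified primes (`T_neg_two_mul`, `T_two_mul`).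

That T is contained in this ring holds because the norm form is anisotropic at a ramified prime
(`not_dvd_den_of_norm_eq_one`, `even_of_two_adic_form`). Conversely, a rational with admissible
denominator is split as s + s' so that X² - sX + 1 and X² - s'X + 1 have nonsquare discriminant at
every odd ramified prime, with a congruence modulo 128 taking care of 2 (`exists_global_split`).
Then s is the trace of a norm-one element as soon as s² - 4 is, up to squares, a value of ⟨c, q,
-cq⟩. `exists_repr_of_local` proves this by producing an integer f that is a value of both ⟨q, -cq⟩
and ⟨d, -c⟩: Dirichlet's theorem supplies f with prescribed symbols at the cost of one extra prime,
the product formula `prod_hilb` fixes the symbol there, and Legendre's theorem solves the two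
conics.

The sum of two such rings is the semilocal ring of the common ramified primes (`adicBall_add`). The
odd symbols of (Q, 2P) multiply to -1, so some odd l ramifies in (2P, Q). The condition linking p to
the radical of R_q^{[3]} rules out l ≡ 3 mod 8, hence l ≡ 1 mod 8, -1 is a square modulo l, and l
ramifies in (-2P, Q) too. Thus R_{p,q}^{[1]} is a proper semilocal ring, and its radical consists of
the elements of positive valuation at each of its primes. Parity of valuations shows that J_{a,b} is
the analogous set for T_{a,b} (`J_eq_adicBall`), and these sets add up in the same way. All
conditions defining J_{a,b} are existential and polynomial in the parameters, which gives the
uniform diophantine definition. -/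

/-! ### Hilbert symbols at odd primes -/

/-- The cofactor of the largest power of `l` dividing `n`. -/
def unitPart (l : ℕ) (n : ℤ) : ℤ := n / (l : ℤ) ^ padicValInt l n

/-- The quadratic character modulo `l` of the cofactor of the largest power of `l` dividing `n`. -/
def chi (l : ℕ) (n : ℤ) : ℤ := jacobiSym (unitPart l n) l

/-- The Hilbert symbol of two nonzero integers at an odd prime `l`. -/
def hilb (l : ℕ) (m n : ℤ) : ℤ :=
  chi l (-1) ^ (padicValInt l m * padicValInt l n) * chi l m ^ padicValInt l n *
    chi l n ^ padicValInt l m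

theorem pow_mul_unitPart (l : ℕ) (n : ℤ) :
    (l : ℤ) ^ padicValInt l n * unitPart l n = n :=
  Int.mul_ediv_cancel' (padicValInt_dvd n)

theorem not_dvd_unitPart {l : ℕ} (hl : l.Prime) {n : ℤ} (hn : n ≠ 0) :
    ¬ (l : ℤ) ∣ unitPart l n := by
  have := Fact.mk hl
  rintro ⟨k, hk⟩
  have h := pow_mul_unitPart l n
  rw [hk, ← mul_assoc, ← pow_succ] at h
  have := (padicValInt_dvd_iff (p := l) (padicValInt l n + 1) n).1 ⟨k, h.symm⟩
  omega

theorem padicValInt_pow_mul {l : ℕ} (hl : l.Prime) (k : ℕ) {u : ℤ} (hu : ¬ (l : ℤ) ∣ u) :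
    padicValInt l ((l : ℤ) ^ k * u) = k := by
  have := Fact.mk hl
  have hl0 : (l : ℤ) ≠ 0 := by exact_mod_cast hl.ne_zero
  have hu0 : u ≠ 0 := by rintro rfl; exact hu (dvd_zero _)
  rw [padicValInt.mul (pow_ne_zero _ hl0) hu0, padicValInt.eq_zero_of_not_dvd hu]
  have : padicValInt l ((l : ℤ) ^ k) = k := by
    rw [← Nat.cast_pow, padicValInt.of_nat, padicValNat.prime_pow]
  omega

theorem unitPart_pow_mul {l : ℕ} (hl : l.Prime) (k : ℕ) {u : ℤ} (hu : ¬ (l : ℤ) ∣ u) :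
    unitPart l ((l : ℤ) ^ k * u) = u := by
  have hl0 : (l : ℤ) ≠ 0 := by exact_mod_cast hl.ne_zero
  rw [unitPart, padicValInt_pow_mul hl k hu, Int.mul_ediv_cancel_left _ (pow_ne_zero _ hl0)]

theorem unitPart_mul {l : ℕ} (hl : l.Prime) {m n : ℤ} (hm : m ≠ 0) (hn : n ≠ 0) :
    unitPart l (m * n) = unitPart l m * unitPart l n := by
  have h : m * n = (l : ℤ) ^ (padicValInt l m + padicValInt l n) *
      (unitPart l m * unitPart l n) := by
    conv_lhs => rw [← pow_mul_unitPart l m, ← pow_mul_unitPart l n]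
    ring
  conv_lhs => rw [h]
  refine unitPart_pow_mul hl _ fun hd => ?_
  rcases (Nat.prime_iff_prime_int.1 hl).dvd_or_dvd hd with h | h
  · exact not_dvd_unitPart hl hm h
  · exact not_dvd_unitPart hl hn h

theorem jacobiSym_eq_one_or {l : ℕ} (hl : l.Prime) {n : ℤ} (hn : ¬ (l : ℤ) ∣ n) :
    jacobiSym n l = 1 ∨ jacobiSym n l = -1 := by
  refine jacobiSym.eq_one_or_neg_one ?_
  rw [Int.gcd_comm]
  exact Int.isCoprime_iff_gcd_eq_one.1
    ((Nat.prime_iff_prime_int.1 hl).coprime_iff_not_dvd.2 hn)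

theorem chi_eq_one_or {l : ℕ} (hl : l.Prime) {n : ℤ} (hn : n ≠ 0) :
    chi l n = 1 ∨ chi l n = -1 :=
  jacobiSym_eq_one_or hl (not_dvd_unitPart hl hn)

theorem chi_mul {l : ℕ} (hl : l.Prime) {m n : ℤ} (hm : m ≠ 0) (hn : n ≠ 0) :
    chi l (m * n) = chi l m * chi l n := by
  rw [chi, unitPart_mul hl hm hn, jacobiSym.mul_left]; rfl

theorem chi_mul_self {l : ℕ} (hl : l.Prime) {n : ℤ} (hn : n ≠ 0) : chi l n * chi l n = 1 := by
  rcases chi_eq_one_or hl hn with h | h <;> rw [h] <;> norm_num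

theorem chi_of_not_dvd {l : ℕ} {n : ℤ} (hn : ¬ (l : ℤ) ∣ n) : chi l n = jacobiSym n l := by
  rw [chi, unitPart, padicValInt.eq_zero_of_not_dvd hn, pow_zero, Int.ediv_one]

theorem chi_pow_mul {l : ℕ} (hl : l.Prime) (k : ℕ) {u : ℤ} (hu : ¬ (l : ℤ) ∣ u) :
    chi l ((l : ℤ) ^ k * u) = jacobiSym u l := by
  rw [chi, unitPart_pow_mul hl k hu]

theorem jacobiSym_congr {l : ℕ} {m n : ℤ} (h : (l : ℤ) ∣ m - n) :
    jacobiSym m l = jacobiSym n l :=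
  jacobiSym.mod_left' (Int.emod_eq_emod_iff_emod_sub_eq_zero.2 (Int.emod_eq_zero_of_dvd h))

theorem hilb_comm (l : ℕ) (m n : ℤ) : hilb l m n = hilb l n m := by
  unfold hilb; rw [mul_comm (padicValInt l m)]; ring

theorem hilb_mul_right {l : ℕ} (hl : l.Prime) {a m n : ℤ} (hm : m ≠ 0) (hn : n ≠ 0) :
    hilb l a (m * n) = hilb l a m * hilb l a n := by
  have := Fact.mk hl
  unfold hilb
  rw [padicValInt.mul hm hn, chi_mul hl hm hn, mul_add, pow_add, pow_add, mul_pow]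
  ring

theorem hilb_mul_left {l : ℕ} (hl : l.Prime) {a m n : ℤ} (hm : m ≠ 0) (hn : n ≠ 0) :
    hilb l (m * n) a = hilb l m a * hilb l n a := by
  rw [hilb_comm, hilb_mul_right hl hm hn, hilb_comm l a, hilb_comm l a]

theorem hilb_eq_one_or {l : ℕ} (hl : l.Prime) {m n : ℤ} (hm : m ≠ 0) (hn : n ≠ 0) :
    hilb l m n = 1 ∨ hilb l m n = -1 := by
  have e : ∀ x : ℤ, (x = 1 ∨ x = -1) ↔ IsUnit x := fun x => Int.isUnit_iff.symm
  have h1 := chi_eq_one_or hl (n := -1) (by norm_num)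
  have h2 := chi_eq_one_or hl hm
  have h3 := chi_eq_one_or hl hn
  rw [e] at *
  exact ((h1.pow _).mul (h2.pow _)).mul (h3.pow _)

theorem hilb_mul_self {l : ℕ} (hl : l.Prime) {m n : ℤ} (hm : m ≠ 0) (hn : n ≠ 0) :
    hilb l m n * hilb l m n = 1 := by
  rcases hilb_eq_one_or hl hm hn with h | h <;> rw [h] <;> norm_num

theorem hilb_mul_sq_right {l : ℕ} (hl : l.Prime) {a n k : ℤ} (ha : a ≠ 0) (hn : n ≠ 0)
    (hk : k ≠ 0) : hilb l a (n * k ^ 2) = hilb l a n := by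
  rw [sq, hilb_mul_right hl hn (mul_ne_zero hk hk), hilb_mul_right hl hk hk,
    hilb_mul_self hl ha hk, mul_one]

theorem hilb_of_not_dvd_left {l : ℕ} {m n : ℤ} (hm : ¬ (l : ℤ) ∣ m) :
    hilb l m n = jacobiSym m l ^ padicValInt l n := by
  rw [hilb, padicValInt.eq_zero_of_not_dvd hm, chi_of_not_dvd hm]; simp

theorem hilb_of_not_dvd {l : ℕ} {m n : ℤ} (hm : ¬ (l : ℤ) ∣ m) (hn : ¬ (l : ℤ) ∣ n) :
    hilb l m n = 1 := by
  rw [hilb_of_not_dvd_left hm, padicValInt.eq_zero_of_not_dvd hn, pow_zero]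

theorem chi_neg_one_mul_self {l : ℕ} (hl : l.Prime) : chi l (-1) * chi l (-1) = 1 :=
  chi_mul_self hl (by norm_num)

theorem pow_of_mul_self_eq_one {x : ℤ} (h : x * x = 1) (n : ℕ) : x ^ n = x ^ (n % 2) := by
  conv_lhs => rw [← Nat.div_add_mod n 2, pow_add, pow_mul, sq, h, one_pow, one_mul]

theorem pow_two_mul_of_mul_self_eq_one {x : ℤ} (h : x * x = 1) (n : ℕ) : x ^ (2 * n) = 1 := by
  rw [pow_mul, sq, h, one_pow]

/-- The sign χ(-1) occurs once with exponent v² and once with exponent v, and v² ≡ v mod 2; χ(a)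
occurs twice. -/
theorem hilb_self_neg {l : ℕ} (hl : l.Prime) {a : ℤ} (ha : a ≠ 0) : hilb l a (-a) = 1 := by
  have hv : padicValInt l (-a) = padicValInt l a := by simp [padicValInt]
  have hc : chi l (-a) = chi l (-1) * chi l a := by
    rw [← chi_mul hl (by norm_num) ha, neg_one_mul]
  rw [hilb, hv, hc, mul_pow]
  have h1 : (chi l (-1) ^ (padicValInt l a * padicValInt l a)) =
      chi l (-1) ^ padicValInt l a := by
    rw [pow_of_mul_self_eq_one (chi_neg_one_mul_self hl),
      pow_of_mul_self_eq_one (chi_neg_one_mul_self hl) (padicValInt l a)]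
    congr 1
    rcases Nat.mod_two_eq_zero_or_one (padicValInt l a) with h | h <;> simp [Nat.mul_mod, h]
  rw [h1]
  have h2 : (chi l (-1) * chi l (-1)) ^ padicValInt l a = 1 := by
    rw [chi_neg_one_mul_self hl, one_pow]
  have h3 : (chi l a * chi l a) ^ padicValInt l a = 1 := by
    rw [chi_mul_self hl ha, one_pow]
  calc _ = (chi l (-1) * chi l (-1)) ^ padicValInt l a *
      (chi l a * chi l a) ^ padicValInt l a := by rw [mul_pow, mul_pow]; ring
    _ = 1 := by rw [h2, h3, one_mul]

theorem jacobiSym_sq {l : ℕ} (hl : l.Prime) {n : ℤ} (hn : ¬ (l : ℤ) ∣ n) :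
    jacobiSym (n ^ 2) l = 1 := by
  rw [jacobiSym.pow_left]
  rcases jacobiSym_eq_one_or hl hn with h | h <;> rw [h] <;> norm_num

theorem jacobiSym_eq_one_of_dvd_sq_sub {l : ℕ} (hl : l.Prime) {n a : ℤ} (ha : ¬ (l : ℤ) ∣ a)
    (h : (l : ℤ) ∣ n ^ 2 - a) : jacobiSym a l = 1 := by
  rw [← jacobiSym_congr h]
  refine jacobiSym_sq hl fun hd => ha ?_
  have := dvd_sub (dvd_pow hd two_ne_zero) h
  simpa using this

theorem exists_dvd_sq_sub {l : ℕ} (hl : l.Prime) {a : ℤ} (ha : jacobiSym a l = 1) :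
    ∃ n : ℤ, (l : ℤ) ∣ n ^ 2 - a := by
  have := Fact.mk hl
  obtain ⟨x, hx⟩ := ZMod.isSquare_of_jacobiSym_eq_one ha
  refine ⟨(x.val : ℤ), ?_⟩
  rw [← ZMod.intCast_zmod_eq_zero_iff_dvd]
  push_cast
  rw [ZMod.natCast_zmod_val, hx]; ring

/-- The symbol of `a` and a norm `t ^ 2 - a` is trivial. -/
theorem hilb_sq_sub {l : ℕ} (hl : l.Prime) {a t : ℤ} (ha : a ≠ 0) (hn : t ^ 2 - a ≠ 0) :
    hilb l a (t ^ 2 - a) = 1 := by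
  have hl' := Nat.prime_iff_prime_int.1 hl
  by_cases ht : t = 0
  · subst ht
    simpa using hilb_self_neg hl ha
  obtain ⟨α, hα⟩ : ∃ α, padicValInt l a = α := ⟨_, rfl⟩
  obtain ⟨τ, hτ⟩ : ∃ τ, padicValInt l t = τ := ⟨_, rfl⟩
  obtain ⟨a', ha'⟩ : ∃ a', unitPart l a = a' := ⟨_, rfl⟩
  obtain ⟨t', ht'⟩ : ∃ t', unitPart l t = t' := ⟨_, rfl⟩
  have hda := not_dvd_unitPart hl ha
  have hdt := not_dvd_unitPart hl ht
  have ea := pow_mul_unitPart l a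
  have et := pow_mul_unitPart l t
  rw [ha'] at hda ea
  rw [ht'] at hdt et
  rw [hα] at ea
  rw [hτ] at et
  have hdt2 : ¬ (l : ℤ) ∣ t' ^ 2 := fun h => hdt (hl'.dvd_of_dvd_pow h)
  have hchia : chi l a = jacobiSym a' l := by rw [chi, ha']
  have hsq := chi_mul_self hl ha
  have one_of_even : ∀ n : ℤ, n ≠ 0 → Even (padicValInt l n) → (Even α ∨ chi l n = 1) →
      hilb l a n = 1 := by
    rintro n hn ⟨j, hj⟩ h
    have h1 : chi l n ^ α = 1 := by
      rcases h with ⟨k, hk⟩ | h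
      · rw [hk, ← two_mul, pow_mul, sq, chi_mul_self hl hn, one_pow]
      · rw [h, one_pow]
    rw [hilb, hα, h1, hj, ← two_mul, mul_left_comm,
      pow_two_mul_of_mul_self_eq_one (chi_neg_one_mul_self hl),
      pow_two_mul_of_mul_self_eq_one hsq]
    simp
  -- The term of smaller valuation decides the class of t² - a: it is that of t² if 2τ < α and that
  -- of -a if 2τ > α. When 2τ = α, either the unit part of a is a square, or no cancellation occurs
  -- and both valuations are even.
  rcases lt_trichotomy (2 * τ) α with h | h | h
  · obtain ⟨k, rfl⟩ := Nat.exists_eq_add_of_lt h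
    have e : t ^ 2 - a = (l : ℤ) ^ (2 * τ) * (t' ^ 2 - (l : ℤ) ^ (k + 1) * a') := by
      rw [← ea, ← et]; ring
    have hd : (l : ℤ) ∣ t' ^ 2 - (t' ^ 2 - (l : ℤ) ^ (k + 1) * a') :=
      ⟨(l : ℤ) ^ k * a', by ring⟩
    have hu : ¬ (l : ℤ) ∣ t' ^ 2 - (l : ℤ) ^ (k + 1) * a' := fun h =>
      hdt2 (by simpa using dvd_add hd h)
    apply one_of_even _ hn
    · rw [e, padicValInt_pow_mul hl _ hu]; simp
    · right
      rw [e, chi_pow_mul hl _ hu, ← jacobiSym_congr hd, jacobiSym_sq hl hdt]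
  · by_cases hc : jacobiSym a' l = 1
    · rw [hilb, hchia, hc, hα, ← h]
      rw [mul_assoc 2, pow_two_mul_of_mul_self_eq_one (chi_neg_one_mul_self hl),
        pow_two_mul_of_mul_self_eq_one (chi_mul_self hl hn)]
      simp
    · have e : t ^ 2 - a = (l : ℤ) ^ (2 * τ) * (t' ^ 2 - a') := by
        rw [← ea, ← et, h]; rw [← h]; ring
      have hu : ¬ (l : ℤ) ∣ t' ^ 2 - a' := fun hd =>
        hc (jacobiSym_eq_one_of_dvd_sq_sub hl hda hd)
      apply one_of_even _ hn
      · rw [e, padicValInt_pow_mul hl _ hu]; simp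
      · left; rw [← h]; simp
  · obtain ⟨k, hk⟩ := Nat.exists_eq_add_of_lt h
    have e : t ^ 2 - a = (l : ℤ) ^ α * ((l : ℤ) ^ (k + 1) * t' ^ 2 - a') := by
      rw [← ea, ← et, mul_pow, ← pow_mul, mul_comm τ, hk]; ring
    have e2 : -a = (l : ℤ) ^ α * (-a') := by rw [← ea]; ring
    have hd : (l : ℤ) ∣ ((l : ℤ) ^ (k + 1) * t' ^ 2 - a') - (-a') :=
      ⟨(l : ℤ) ^ k * t' ^ 2, by ring⟩
    have hu' : ¬ (l : ℤ) ∣ -a' := by rwa [dvd_neg]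
    have hu : ¬ (l : ℤ) ∣ (l : ℤ) ^ (k + 1) * t' ^ 2 - a' := fun h =>
      hu' (by simpa using dvd_sub h hd)
    rw [← hilb_self_neg hl ha, hilb, hilb]
    have hv : padicValInt l (t ^ 2 - a) = padicValInt l (-a) := by
      rw [e, e2, padicValInt_pow_mul hl _ hu, padicValInt_pow_mul hl _ hu']
    have hx : chi l (t ^ 2 - a) = chi l (-a) := by
      rw [e, e2, chi_pow_mul hl _ hu, chi_pow_mul hl _ hu', jacobiSym_congr hd]
    rw [hv, hx]

/-! ### Legendre's theorem by descent -/

theorem exists_dvd_sq_sub_of_squarefree (a : ℤ) (n : ℕ) (hn : Squarefree n)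
    (h : ∀ l : ℕ, l.Prime → l ∣ n → ∃ t : ℤ, (l : ℤ) ∣ t ^ 2 - a) :
    ∃ t : ℤ, (n : ℤ) ∣ t ^ 2 - a := by
  induction n using induction_on_primes with
  | zero => exact absurd hn not_squarefree_zero
  | one => exact ⟨0, by simp⟩
  | prime_mul p n hp ih =>
    have hc := Nat.coprime_of_squarefree_mul hn
    obtain ⟨t, k, hk⟩ := ih (hn.squarefree_of_dvd (dvd_mul_left n p))
      fun l hl hln => h l hl (hln.mul_left p)
    obtain ⟨s, j, hj⟩ := h p hp (dvd_mul_right p n)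
    obtain ⟨u, v, huv⟩ := Nat.isCoprime_iff_coprime.2 hc
    refine ⟨t * (u * p) + s * (v * n), ?_⟩
    rw [Nat.cast_mul]
    have hc' : IsCoprime (p : ℤ) (n : ℤ) := ⟨u, v, huv⟩
    refine hc'.mul_dvd ?_ ?_
    · have : (t * (u * p) + s * (v * n)) = s + p * (u * (t - s)) := by linear_combination s * huv
      rw [this]
      exact ⟨j + 2 * s * (u * (t - s)) + p * (u * (t - s)) ^ 2, by linear_combination hj⟩
    · have : (t * (u * p) + s * (v * n)) = t + n * (v * (s - t)) := by linear_combination t * huv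
      rw [this]
      exact ⟨k + 2 * t * (v * (s - t)) + n * (v * (s - t)) ^ 2, by linear_combination hk⟩

theorem exists_sq_mul_squarefree_int {n : ℤ} (hn : n ≠ 0) :
    ∃ m k : ℤ, n = m * k ^ 2 ∧ Squarefree m ∧ m ≠ 0 ∧ k ≠ 0 := by
  obtain ⟨a, b, h, ha⟩ := Nat.sq_mul_squarefree n.natAbs
  have e : n = (n.sign * a) * (b : ℤ) ^ 2 := by
    conv_lhs => rw [← Int.sign_mul_natAbs n, ← h]
    push_cast; ring
  have h0 : (n.sign * a : ℤ) * (b : ℤ) ^ 2 ≠ 0 := e ▸ hn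
  refine ⟨n.sign * a, b, e, ?_, left_ne_zero_of_mul h0,
    fun hb => right_ne_zero_of_mul h0 (by rw [hb]; norm_num)⟩
  rw [← Int.squarefree_natAbs]
  simpa [Int.natAbs_mul, Int.natAbs_sign_of_ne_zero hn] using ha

/-- At an odd prime l dividing b but not a, the symbol is the Legendre symbol of a, because b has
valuation 1. Modulo 2 everything is a square, so the descent never needs a condition at 2. -/
theorem exists_dvd_sq_sub_of_hilb {a b : ℤ} (hb : Squarefree b)
    (h : ∀ l : ℕ, l.Prime → l ≠ 2 → hilb l a b = 1) : ∃ t : ℤ, b ∣ t ^ 2 - a := by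
  have := exists_dvd_sq_sub_of_squarefree a b.natAbs (Int.squarefree_natAbs.2 hb) ?_
  · simpa only [Int.natAbs_dvd, Int.dvd_natAbs] using this
  intro l hl hlb
  have hl' := Nat.prime_iff_prime_int.1 hl
  by_cases hla : (l : ℤ) ∣ a
  · exact ⟨0, by simpa using hla⟩
  by_cases h2 : l = 2
  · subst h2
    exact ⟨1, by push_cast at hla ⊢; omega⟩
  have h1 := h l hl h2
  rw [hilb_of_not_dvd_left hla] at h1
  have hdb : (l : ℤ) ∣ b := Int.natCast_dvd.2 hlb
  obtain ⟨c, hc⟩ := hdb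
  have hdc : ¬ (l : ℤ) ∣ c := by
    rintro ⟨d, rfl⟩
    have := hb l ⟨d, by rw [hc]; ring⟩
    exact hl'.not_isUnit this
  have hv : padicValInt l b = 1 := by
    rw [hc, ← pow_one (l : ℤ), padicValInt_pow_mul hl 1 hdc]
  rw [hv, pow_one] at h1
  exact exists_dvd_sq_sub hl h1

theorem exists_four_mul_sq_le {b : ℤ} (hb : b ≠ 0) (t : ℤ) :
    ∃ s : ℤ, b ∣ t - s ∧ 4 * s ^ 2 ≤ b ^ 2 := by
  refine ⟨t.bmod b.natAbs, ?_, ?_⟩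
  · have := Int.dvd_self_sub_bmod (x := t) (m := b.natAbs)
    exact Int.natAbs_dvd.1 this
  · have h0 : 0 < b.natAbs := Int.natAbs_pos.2 hb
    have h1 := Int.le_bmod (x := t) h0
    have h2 := Int.bmod_lt (x := t) h0
    rw [← Int.natAbs_sq b]
    set B : ℤ := ((b.natAbs : ℕ) : ℤ)
    have : |2 * t.bmod b.natAbs| ≤ |B| := by
      rw [abs_le, abs_of_nonneg (by omega : (0 : ℤ) ≤ B)]
      constructor <;> omega
    have := sq_le_sq.2 this
    linarith

/-- Legendre's theorem for squarefree coefficients. -/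
theorem legendre_squarefree (N : ℕ) : ∀ a b : ℤ, a.natAbs + b.natAbs ≤ N →
    Squarefree a → Squarefree b → a ≠ 0 → b ≠ 0 → (0 < a ∨ 0 < b) →
    (∀ l : ℕ, l.Prime → l ≠ 2 → hilb l a b = 1) →
    ∃ x y z : ℤ, x ^ 2 = a * y ^ 2 + b * z ^ 2 ∧ (y ≠ 0 ∨ z ≠ 0) := by
  induction N with
  | zero =>
    intro a b h _ _ ha
    omega
  | succ N ih =>
    intro a b h hsa hsb ha hb hpos hh
    wlog hab : a.natAbs ≤ b.natAbs generalizing a b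
    · obtain ⟨x, y, z, e, h0⟩ := this b a (by omega) hsb hsa hb ha hpos.symm
        (fun l hl h2 => by rw [hilb_comm]; exact hh l hl h2) (by omega)
      exact ⟨x, z, y, by rw [e]; ring, h0.symm⟩
    by_cases hb1 : b.natAbs = 1
    · have ha1 : a.natAbs = 1 := by omega
      rcases hpos with h | h
      · have : a = 1 := by omega
        exact ⟨1, 1, 0, by rw [this]; ring, by simp⟩
      · have : b = 1 := by omega
        exact ⟨1, 0, 1, by rw [this]; ring, by simp⟩
    obtain ⟨t₀, ht₀⟩ := exists_dvd_sq_sub_of_hilb hsb hh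
    obtain ⟨t, htt, ht⟩ := exists_four_mul_sq_le hb t₀
    obtain ⟨b', hb'⟩ : b ∣ t ^ 2 - a := by
      have : t ^ 2 - a = (t₀ ^ 2 - a) - (t₀ - t) * (t₀ + t) := by ring
      rw [this]
      exact dvd_sub ht₀ (htt.mul_right _)
    by_cases hb0 : b' = 0
    · exact ⟨t, 1, 0, by rw [hb0] at hb'; linear_combination hb', by simp⟩
    have hta : t ^ 2 - a ≠ 0 := hb' ▸ mul_ne_zero hb hb0
    obtain ⟨m, k, hmk, hsm, hm0, hk0⟩ := exists_sq_mul_squarefree_int hb0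
    -- From 4t² ≤ b² and |a| ≤ |b| one gets |b'| ≤ |b|/4 + 1, which is less than |b| once |b| ≥ 2.
    have hlt : m.natAbs < b.natAbs := by
      have h1 : |b| * |b'| ≤ t ^ 2 + |a| := by
        rw [← abs_mul, ← hb']
        calc |t ^ 2 - a| ≤ |t ^ 2| + |a| := abs_sub _ _
          _ = _ := by rw [abs_of_nonneg (sq_nonneg t)]
      have h2 : |m| ≤ |b'| := by
        rw [hmk, abs_mul]
        exact le_mul_of_one_le_right (abs_nonneg _) (Int.one_le_abs (pow_ne_zero 2 hk0))
      have h3 : |a| ≤ |b| := by rw [Int.abs_eq_natAbs, Int.abs_eq_natAbs]; exact_mod_cast hab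
      have h4 : 2 ≤ |b| := by rw [Int.abs_eq_natAbs]; omega
      have h5 : |m| < |b| := by
        by_contra hcon
        have h6 : |b| * |b| ≤ |b| * |b'| := by
          apply mul_le_mul_of_nonneg_left _ (abs_nonneg _); linarith
        rw [← sq_abs b] at ht
        nlinarith
      rw [Int.abs_eq_natAbs, Int.abs_eq_natAbs] at h5
      exact_mod_cast h5
    have hpos' : 0 < a ∨ 0 < m := by
      rcases lt_or_gt_of_ne ha with h | h
      · right
        have hb2 : 0 < b := by omega
        have : 0 < b * b' := by rw [← hb']; nlinarith [sq_nonneg t]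
        have : 0 < b' := (mul_pos_iff_of_pos_left hb2).1 this
        rw [hmk] at this
        exact (pos_iff_pos_of_mul_pos this).2 (by positivity)
      · exact Or.inl h
    obtain ⟨x, y, z, e, h0⟩ := ih a m (by omega) hsa hsm ha hm0 hpos' fun l hl h2 => by
      rw [← hilb_mul_sq_right hl ha hm0 hk0, ← hmk]
      have h3 := hilb_sq_sub hl ha hta
      rwa [hb', hilb_mul_right hl hb hb0, hh l hl h2, one_mul] at h3
    by_cases hz : z = 0
    · exact ⟨x, y, 0, by rw [e, hz]; ring, Or.inl (by simpa [hz] using h0)⟩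
    -- Multiplicativity of the norm from ℚ(√a), applied to (x + y√a)(t + √a): the product of the
    -- norms mz² and bmk² is b(mkz)².
    · refine ⟨x * t + a * y, x + t * y, m * k * z, ?_, Or.inr ?_⟩
      · rw [hmk] at hb'
        linear_combination (t ^ 2 - a) * e + m * z ^ 2 * hb'
      · exact mul_ne_zero (mul_ne_zero hm0 hk0) hz

/-- Legendre's theorem: the condition at the prime `2` is not needed. -/
theorem legendre {a b : ℤ} (ha : a ≠ 0) (hb : b ≠ 0) (hpos : 0 < a ∨ 0 < b)
    (h : ∀ l : ℕ, l.Prime → l ≠ 2 → hilb l a b = 1) :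
    ∃ x y z : ℤ, x ^ 2 = a * y ^ 2 + b * z ^ 2 ∧ (y ≠ 0 ∨ z ≠ 0) := by
  obtain ⟨m, k, rfl, hsm, hm0, hk0⟩ := exists_sq_mul_squarefree_int ha
  obtain ⟨n, j, rfl, hsn, hn0, hj0⟩ := exists_sq_mul_squarefree_int hb
  have hp : ∀ {m k : ℤ}, k ≠ 0 → 0 < m * k ^ 2 → 0 < m := fun hk h =>
    (pos_iff_pos_of_mul_pos h).2 (by positivity)
  obtain ⟨x, y, z, e, h0⟩ := legendre_squarefree _ m n le_rfl hsm hsn hm0 hn0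
    (hpos.imp (hp hk0) (hp hj0)) fun l hl h2 => by
      rw [← h l hl h2, hilb_mul_sq_right hl ha hn0 hj0, hilb_comm, hilb_comm l (m * k ^ 2),
        hilb_mul_sq_right hl hn0 hm0 hk0]
  refine ⟨x * k * j, y * j, z * k, by linear_combination (k * j) ^ 2 * e, ?_⟩
  exact h0.imp (mul_ne_zero · hj0) (mul_ne_zero · hk0)

/-! ### The product formula from quadratic reciprocity -/

/-- P may exceed the set of primes of f, since extra primes contribute exponent 0; this allows all
later products to run over one common set. -/
theorem jacobiSym_eq_prod {P : Finset ℕ} (hP : ∀ l ∈ P, l.Prime) (a : ℤ) (f : ℕ) (hf : f ≠ 0)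
    (hfP : ∀ l : ℕ, l.Prime → l ∣ f → l ∈ P) :
    jacobiSym a f = ∏ l ∈ P, jacobiSym a l ^ padicValNat l f := by
  induction f using induction_on_primes with
  | zero => exact absurd rfl hf
  | one => simp
  | prime_mul k n hk ih =>
    have hn : n ≠ 0 := right_ne_zero_of_mul hf
    have := NeZero.mk hn
    have := NeZero.mk hk.ne_zero
    rw [jacobiSym.mul_right, ih hn fun l hl h => hfP l hl (h.mul_left k)]
    have hkP : k ∈ P := hfP k hk (dvd_mul_right k n)
    have h1 : ∀ l ∈ P, jacobiSym a l ^ padicValNat l (k * n) =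
        (if l = k then jacobiSym a k else 1) * jacobiSym a l ^ padicValNat l n := by
      intro l hl
      have := Fact.mk (hP l hl)
      have := Fact.mk hk
      rw [padicValNat.mul hk.ne_zero hn, pow_add]
      split_ifs with h
      · rw [h, padicValNat_self, pow_one]
      · rw [padicValNat_primes h, pow_zero]
    rw [Finset.prod_congr rfl h1, Finset.prod_mul_distrib, Finset.prod_ite_eq' P k, if_pos hkP]

theorem hilb_nat_of_not_dvd_right {l : ℕ} (f : ℕ) {m : ℤ} (hm : ¬ (l : ℤ) ∣ m) :
    hilb l f m = jacobiSym m l ^ padicValNat l f := by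
  rw [hilb_comm, hilb_of_not_dvd_left hm, padicValInt.of_nat]

theorem prod_hilb_of_not_dvd {P : Finset ℕ} (hP : ∀ l ∈ P, l.Prime) {f : ℕ} (hf : f ≠ 0)
    (hfP : ∀ l : ℕ, l.Prime → l ∣ f → l ∈ P) {m : ℤ} (hm : ∀ l ∈ P, ¬ (l : ℤ) ∣ m) :
    ∏ l ∈ P, hilb l f m = jacobiSym m f := by
  rw [jacobiSym_eq_prod hP m f hf hfP]
  exact Finset.prod_congr rfl fun l hl => hilb_nat_of_not_dvd_right f (hm l hl)

theorem not_dvd_two {l : ℕ} (hl : l.Prime) (h2 : l ≠ 2) : ¬ (l : ℤ) ∣ 2 := by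
  intro h
  exact h2 ((Nat.prime_dvd_prime_iff_eq hl Nat.prime_two).1 (by exact_mod_cast h))

/-- Write f = k^v f'. The primes other than k contribute the Jacobi symbol (k/f'), the prime k
contributes χ₄(k)^v (f'/k), and reciprocity cancels the two. -/
theorem prod_hilb_prime {P : Finset ℕ} (hP : ∀ l ∈ P, l.Prime) {f : ℕ}
    (hf : f % 4 = 1) (hfP : ∀ l : ℕ, l.Prime → l ∣ f → l ∈ P) {k : ℕ} (hk : k.Prime)
    (hk2 : k ≠ 2) (hkP : k ∈ P) : ∏ l ∈ P, hilb l f k = 1 := by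
  have hkf := Fact.mk hk
  have hf0 : f ≠ 0 := by omega
  obtain ⟨v, f', hkf', hvf⟩ := Nat.exists_eq_pow_mul_and_not_dvd hf0 k hk.ne_one
  have hkf'Z : ¬ (k : ℤ) ∣ f' := by exact_mod_cast hkf'
  have hvfZ : (f : ℤ) = (k : ℤ) ^ v * f' := by exact_mod_cast hvf
  have hf'0 : f' ≠ 0 := by rintro rfl; simp at hkf'
  rw [← Finset.mul_prod_erase P _ hkP]
  have h1 : ∏ l ∈ P.erase k, hilb l f k = jacobiSym k f' := by
    rw [jacobiSym_eq_prod (P := P.erase k) (fun l hl => hP l (Finset.mem_of_mem_erase hl)) _ _ hf'0]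
    · refine Finset.prod_congr rfl fun l hl => ?_
      have hlk := Finset.ne_of_mem_erase hl
      have hlp := hP l (Finset.mem_of_mem_erase hl)
      have := Fact.mk hlp
      rw [hilb_nat_of_not_dvd_right, hvf, padicValNat.mul (pow_ne_zero _ hk.ne_zero) hf'0,
        padicValNat_prime_prime_pow _ hlk, zero_add]
      intro h
      exact hlk ((Nat.prime_dvd_prime_iff_eq hlp hk).1 (by exact_mod_cast h))
    · intro l hl hlf
      refine Finset.mem_erase.2 ⟨?_, hfP l hl (hvf ▸ hlf.mul_left _)⟩
      rintro rfl
      exact hkf' hlf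
  have hk1 : ¬ (k : ℤ) ∣ 1 := by exact_mod_cast hk.not_dvd_one
  have hkodd : Odd k := hk.odd_of_ne_two hk2
  have h2 : hilb k f k = ZMod.χ₄ k ^ v * jacobiSym f' k := by
    have e1 : chi k f = jacobiSym f' k := by rw [hvfZ, chi_pow_mul hk _ hkf'Z]
    have e2 : padicValInt k f = v := by rw [hvfZ, padicValInt_pow_mul hk _ hkf'Z]
    have e3 : chi k k = 1 := by
      have := chi_pow_mul hk 1 hk1
      simpa using this
    have e4 : chi k (-1) = ZMod.χ₄ k := by
      rw [chi_of_not_dvd (by rwa [dvd_neg]), jacobiSym.at_neg_one hkodd]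
    rw [hilb, e1, e2, e3, e4, padicValInt_self]
    simp
  rw [h1, h2]
  have hfodd : Odd f' := by
    have : Odd f := Nat.odd_iff.2 (by omega)
    rw [hvf] at this
    exact (Nat.odd_mul.1 this).2
  have hcop : jacobiSym f' k = 1 ∨ jacobiSym f' k = -1 := jacobiSym_eq_one_or hk hkf'Z
  rcases Nat.odd_mod_four_iff.1 (Nat.odd_iff.1 hkodd) with h | h
  · rw [ZMod.χ₄_nat_one_mod_four h, jacobiSym.quadratic_reciprocity_one_mod_four h hfodd, one_pow]
    rcases hcop with h | h <;> rw [h] <;> norm_num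
  · rw [ZMod.χ₄_nat_three_mod_four h]
    -- As f ≡ 1 mod 4, the parity of v determines f' mod 4, so the reciprocity sign matches the
    -- factor (-1)^v.
    have hmod : (3 ^ v * f') % 4 = 1 := by
      have : k ^ v * f' ≡ 3 ^ v * f' [MOD 4] := ((show k ≡ 3 [MOD 4] from h).pow v).mul_right f'
      rw [← hvf] at this
      rw [← this]; exact hf
    rcases Nat.even_or_odd v with hv | hv
    · have : f' % 4 = 1 := by
        obtain ⟨j, rfl⟩ := hv
        have h9 : (3 ^ (j + j)) % 4 = 1 := by
          rw [← two_mul, pow_mul, Nat.pow_mod]; simp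
        rw [Nat.mul_mod, h9] at hmod
        omega
      rw [hv.neg_one_pow, jacobiSym.quadratic_reciprocity_one_mod_four' hkodd this]
      rcases hcop with h | h <;> rw [h] <;> norm_num
    · have : f' % 4 = 3 := by
        obtain ⟨j, rfl⟩ := hv
        have h9 : (3 ^ (2 * j + 1)) % 4 = 3 := by
          rw [pow_succ, pow_mul, Nat.mul_mod, Nat.pow_mod]; simp
        rw [Nat.mul_mod, h9] at hmod
        omega
      rw [hv.neg_one_pow, jacobiSym.quadratic_reciprocity_three_mod_four h this]
      rcases hcop with h | h <;> rw [h] <;> norm_num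

theorem prod_hilb_two {P : Finset ℕ} (hP : ∀ l ∈ P, l.Prime ∧ l ≠ 2) {f : ℕ} (hf : Odd f)
    (hfP : ∀ l : ℕ, l.Prime → l ∣ f → l ∈ P) : ∏ l ∈ P, hilb l f 2 = ZMod.χ₈ f := by
  rw [prod_hilb_of_not_dvd (fun l hl => (hP l hl).1) hf.pos.ne' hfP
    fun l hl => not_dvd_two (hP l hl).1 (hP l hl).2, jacobiSym.at_two hf]

theorem prod_hilb_neg_one {P : Finset ℕ} (hP : ∀ l ∈ P, l.Prime ∧ l ≠ 2) {f : ℕ} (hf : Odd f)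
    (hfP : ∀ l : ℕ, l.Prime → l ∣ f → l ∈ P) : ∏ l ∈ P, hilb l f (-1) = ZMod.χ₄ f := by
  rw [prod_hilb_of_not_dvd (fun l hl => (hP l hl).1) hf.pos.ne' hfP
    fun l hl h => (hP l hl).1.not_dvd_one (by exact_mod_cast (dvd_neg.1 h)),
    jacobiSym.at_neg_one hf]

theorem prod_hilb_nat {P : Finset ℕ} (hP : ∀ l ∈ P, l.Prime ∧ l ≠ 2) {f : ℕ}
    (hf : f % 4 = 1) (hfP : ∀ l : ℕ, l.Prime → l ∣ f → l ∈ P) (m : ℕ) (hm : m ≠ 0)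
    (hmP : ∀ l : ℕ, l.Prime → l ≠ 2 → l ∣ m → l ∈ P) :
    ∏ l ∈ P, hilb l f m = ZMod.χ₈ f ^ padicValNat 2 m := by
  have hodd : Odd f := Nat.odd_iff.2 (by omega)
  have h2 := Fact.mk Nat.prime_two
  induction m using induction_on_primes with
  | zero => exact absurd rfl hm
  | one =>
    rw [prod_hilb_of_not_dvd (fun l hl => (hP l hl).1) hodd.pos.ne' hfP]
    · simp
    · exact fun l hl h => (hP l hl).1.not_dvd_one (by exact_mod_cast h)
  | prime_mul k n hk ih =>
    have hn : n ≠ 0 := right_ne_zero_of_mul hm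
    have e : ∀ l ∈ P, hilb l f ((k * n : ℕ) : ℤ) = hilb l f k * hilb l f n := fun l hl => by
      rw [Nat.cast_mul, hilb_mul_right (hP l hl).1 (by exact_mod_cast hk.ne_zero)
        (by exact_mod_cast hn)]
    rw [Finset.prod_congr rfl e, Finset.prod_mul_distrib,
      ih hn (fun l hl hl2 h => hmP l hl hl2 (h.mul_left k)), padicValNat.mul hk.ne_zero hn, pow_add]
    congr 1
    by_cases hk2 : k = 2
    · subst hk2
      rw [padicValNat_self, pow_one]
      exact_mod_cast prod_hilb_two hP hodd hfP
    · have := Fact.mk hk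
      rw [padicValNat_primes (Ne.symm hk2), pow_zero]
      exact prod_hilb_prime (fun l hl => (hP l hl).1) hf hfP hk hk2
        (hmP k hk hk2 (dvd_mul_right k n))

/-- The product formula, when one argument is positive and congruent to `1` modulo `4`. -/
theorem prod_hilb {P : Finset ℕ} (hP : ∀ l ∈ P, l.Prime ∧ l ≠ 2) {f : ℕ}
    (hf : f % 4 = 1) (hfP : ∀ l : ℕ, l.Prime → l ∣ f → l ∈ P) {m : ℤ} (hm : m ≠ 0)
    (hmP : ∀ l : ℕ, l.Prime → l ≠ 2 → (l : ℤ) ∣ m → l ∈ P) :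
    ∏ l ∈ P, hilb l f m = ZMod.χ₈ f ^ padicValInt 2 m := by
  have hodd : Odd f := Nat.odd_iff.2 (by omega)
  have hn := prod_hilb_nat hP hf hfP m.natAbs (Int.natAbs_ne_zero.2 hm)
    fun l hl h2 h => hmP l hl h2 (Int.natCast_dvd.2 h)
  have hv : padicValInt 2 m = padicValNat 2 m.natAbs := rfl
  rw [hv, ← hn]
  rcases Int.natAbs_eq m with h | h
  · conv_lhs => rw [h]
  · conv_lhs => rw [h]
    have e : ∀ l ∈ P, hilb l f (-(m.natAbs : ℤ)) = hilb l f (-1) * hilb l f m.natAbs :=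
      fun l hl => by
        rw [← neg_one_mul, hilb_mul_right (hP l hl).1 (by norm_num) (by simpa using hm)]
    rw [Finset.prod_congr rfl e, Finset.prod_mul_distrib, prod_hilb_neg_one hP hodd hfP,
      ZMod.χ₄_nat_one_mod_four hf, one_mul]

/-! ### Integers with prescribed local behaviour -/

theorem exists_int_crt (P : Finset ℕ) (hP : ∀ l ∈ P, l.Prime) (n : ℕ → ℕ) (a : ℕ → ℤ) :
    ∃ A : ℤ, ∀ l ∈ P, (l : ℤ) ^ n l ∣ A - a l := by
  induction P using Finset.induction_on with
  | empty => exact ⟨0, by simp⟩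
  | insert l P hl ih =>
    obtain ⟨A, hA⟩ := ih fun k hk => hP k (Finset.mem_insert_of_mem hk)
    have hlp := hP l (Finset.mem_insert_self l P)
    have hcop : IsCoprime ((l : ℤ) ^ n l) (∏ k ∈ P, (k : ℤ) ^ n k) := by
      refine IsCoprime.prod_right fun k hk => IsCoprime.pow (Nat.isCoprime_iff_coprime.2 ?_)
      refine (Nat.coprime_primes hlp (hP k (Finset.mem_insert_of_mem hk))).2 ?_
      rintro rfl; exact hl hk
    obtain ⟨u, v, huv⟩ := hcop
    refine ⟨A * (u * (l : ℤ) ^ n l) + a l * (v * ∏ k ∈ P, (k : ℤ) ^ n k), fun k hk => ?_⟩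
    rcases Finset.mem_insert.1 hk with rfl | hk
    · exact ⟨u * (A - a k), by linear_combination a k * huv⟩
    · obtain ⟨m, hm⟩ := Finset.dvd_prod_of_mem (fun k : ℕ => (k : ℤ) ^ n k) hk
      obtain ⟨j, hj⟩ := hA k hk
      refine ⟨j + v * m * (a l - A), ?_⟩
      linear_combination hj + A * huv + v * (a l - A) * hm

theorem exists_dvd_mul_sub_one {l : ℕ} (hl : l.Prime) {g : ℤ} (hg : ¬ (l : ℤ) ∣ g) :
    ∃ i : ℤ, (l : ℤ) ∣ g * i - 1 := by
  obtain ⟨u, v, h⟩ := (Nat.prime_iff_prime_int.1 hl).coprime_iff_not_dvd.2 hg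
  exact ⟨v, -u, by linear_combination h⟩

theorem exists_jacobiSym_eq {l : ℕ} (hl : l.Prime) (h2 : l ≠ 2) {ε : ℤ} (hε : ε = 1 ∨ ε = -1) :
    ∃ u : ℤ, ¬ (l : ℤ) ∣ u ∧ jacobiSym u l = ε := by
  have := Fact.mk hl
  rcases hε with rfl | rfl
  · exact ⟨1, fun h => hl.not_dvd_one (by exact_mod_cast h), by simp⟩
  · obtain ⟨a, ha⟩ := FiniteField.exists_nonsquare (F := ZMod l) (by rwa [ZMod.ringChar_zmod_n])
    have hJ : jacobiSym (a.val : ℤ) l = -1 :=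
      ZMod.nonsquare_iff_jacobiSym_eq_neg_one.2 (by simpa using ha)
    refine ⟨a.val, fun h => ha ?_, hJ⟩
    have : a = 0 := by
      rw [← ZMod.natCast_zmod_val a]
      exact_mod_cast (ZMod.intCast_zmod_eq_zero_iff_dvd (a.val : ℤ) l).2 h
    rw [this]; exact IsSquare.zero

/-- An integer with prescribed valuations and characters at given odd primes, prescribed
modulo `8`, and with a single further prime factor. -/
theorem exists_prescribed {P : Finset ℕ} (hP : ∀ l ∈ P, l.Prime ∧ l ≠ 2) (e : ℕ → ℕ)
    (ε : ℕ → ℤ) (hε : ∀ l ∈ P, ε l = 1 ∨ ε l = -1) {d : ℕ} (hd : Odd d) :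
    ∃ f r : ℕ, r.Prime ∧ r ≠ 2 ∧ r ∉ P ∧ f ≠ 0 ∧ (∀ l : ℕ, l.Prime → l ∣ f → l ∈ insert r P) ∧
      f % 8 = d % 8 ∧ ∀ l ∈ P, padicValInt l f = e l ∧ chi l f = ε l := by
  obtain ⟨f₀, hf₀⟩ : ∃ f₀ : ℕ, f₀ = ∏ l ∈ P, l ^ e l := ⟨_, rfl⟩
  have hf₀P : ∀ l : ℕ, l.Prime → l ∣ f₀ → l ∈ P := by
    intro l hl h
    rw [hf₀] at h
    obtain ⟨k, hk, hlk⟩ := (Nat.prime_iff.1 hl).exists_mem_finset_dvd h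
    have := (Nat.prime_dvd_prime_iff_eq hl (hP k hk).1).1 (hl.dvd_of_dvd_pow hlk)
    rwa [this]
  have h2P : 2 ∉ P := fun h => (hP 2 h).2 rfl
  have hf₀0 : f₀ ≠ 0 := by
    rw [hf₀]; exact Finset.prod_ne_zero_iff.2 fun l hl => pow_ne_zero _ (hP l hl).1.ne_zero
  have hf₀2 : ¬ 2 ∣ f₀ := fun h => h2P (hf₀P 2 Nat.prime_two h)
  have key : ∀ l ∈ P, ∃ g i u : ℤ, (f₀ : ℤ) = (l : ℤ) ^ e l * g ∧ ¬ (l : ℤ) ∣ g ∧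
      (l : ℤ) ∣ g * i - 1 ∧ ¬ (l : ℤ) ∣ u ∧ jacobiSym u l = ε l := by
    intro l hl
    obtain ⟨u, hu, hJ⟩ := exists_jacobiSym_eq (hP l hl).1 (hP l hl).2 (hε l hl)
    have hg : ¬ (l : ℤ) ∣ ((∏ k ∈ P.erase l, k ^ e k : ℕ) : ℤ) := by
      rw [Int.natCast_dvd_natCast]
      intro h
      obtain ⟨k, hk, hlk⟩ := (Nat.prime_iff.1 (hP l hl).1).exists_mem_finset_dvd h
      have := (Nat.prime_dvd_prime_iff_eq (hP l hl).1 (hP k (Finset.mem_of_mem_erase hk)).1).1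
        ((hP l hl).1.dvd_of_dvd_pow hlk)
      exact Finset.ne_of_mem_erase hk this.symm
    obtain ⟨i, hi⟩ := exists_dvd_mul_sub_one (hP l hl).1 hg
    refine ⟨_, i, u, ?_, hg, hi, hu, hJ⟩
    rw [hf₀, ← Finset.mul_prod_erase P _ hl]
    push_cast; ring
  choose! g i u hfg hg hi hu hJ using key
  -- The moduli are 8 at 2 and l elsewhere. For a prime r ≡ A the product f₀r then has the required
  -- residues: f₀² ≡ 1 mod 8 turns f₀d into d, and i l inverts the cofactor g l of f₀, leaving u l.
  obtain ⟨A, hA⟩ := exists_int_crt (insert 2 P)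
    (fun l hl => (Finset.mem_insert.1 hl).elim (fun h => h ▸ Nat.prime_two) fun h => (hP l h).1)
    (fun l => if l = 2 then 3 else 1) (fun l => if l = 2 then f₀ * d else i l * u l)
  have hA2 : (8 : ℤ) ∣ A - f₀ * d := by
    simpa using hA 2 (Finset.mem_insert_self 2 P)
  have hAl : ∀ l ∈ P, (l : ℤ) ∣ A - i l * u l := fun l hl => by
    simpa [(hP l hl).2] using hA l (Finset.mem_insert_of_mem hl)
  have hcop : IsCoprime A ((8 * ∏ l ∈ P, l : ℕ) : ℤ) := by
    push_cast
    refine IsCoprime.mul_right ?_ (IsCoprime.prod_right fun l hl => ?_)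
    · have : ¬ (2 : ℤ) ∣ A := by
        have h1 : ¬ (2 : ℤ) ∣ (f₀ * d : ℕ) := by
          rw [show (2 : ℤ) = ((2 : ℕ) : ℤ) from rfl, Int.natCast_dvd_natCast]
          intro h
          rcases (Nat.prime_two.dvd_mul).1 h with h | h
          · exact hf₀2 h
          · exact (Nat.not_even_iff_odd.2 hd) (even_iff_two_dvd.2 h)
        push_cast at h1
        intro h
        omega
      have h3 := (Int.prime_two.coprime_iff_not_dvd.2 this).symm.pow_right (n := 3)
      norm_num at h3; exact h3
    · refine ((Nat.prime_iff_prime_int.1 (hP l hl).1).coprime_iff_not_dvd.2 fun h => ?_).symm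
      have h1 : (l : ℤ) ∣ i l * u l := by simpa using dvd_sub h (hAl l hl)
      rcases (Nat.prime_iff_prime_int.1 (hP l hl).1).dvd_or_dvd h1 with h2 | h2
      · have := dvd_sub (h2.mul_left (g l)) (hi l hl)
        have h3 : (l : ℤ) ∣ 1 := by simpa using this
        exact (hP l hl).1.not_dvd_one (by exact_mod_cast h3)
      · exact hu l hl h2
  obtain ⟨r, hr, hrp, hrA⟩ := Nat.forall_exists_prime_gt_and_zmodEq (P.sup id + 2)
    (mul_ne_zero (by norm_num) (Finset.prod_ne_zero_iff.2 fun l hl => (hP l hl).1.ne_zero)) hcop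
  have hrP : r ∉ P := fun h => by
    have : r ≤ P.sup id := Finset.le_sup (f := id) h
    omega
  have hrd := hrA.dvd
  push_cast at hrd
  have hr8 : (8 : ℤ) ∣ A - r := (dvd_mul_right _ _).trans hrd
  have hrl : ∀ l ∈ P, (l : ℤ) ∣ A - r := fun l hl =>
    ((Finset.dvd_prod_of_mem (fun l : ℕ => (l : ℤ)) hl).mul_left _).trans hrd
  refine ⟨f₀ * r, r, hrp, by omega, hrP, mul_ne_zero hf₀0 hrp.ne_zero, fun l hl h => ?_, ?_,
    fun l hl => ?_⟩
  · rcases (Nat.Prime.dvd_mul hl).1 h with h | h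
    · exact Finset.mem_insert_of_mem (hf₀P l hl h)
    · rw [(Nat.prime_dvd_prime_iff_eq hl hrp).1 h]; exact Finset.mem_insert_self _ _
  · have h1 : (8 : ℤ) ∣ (f₀ : ℤ) * f₀ - 1 := by
      have : f₀ % 8 = 1 ∨ f₀ % 8 = 3 ∨ f₀ % 8 = 5 ∨ f₀ % 8 = 7 := by omega
      obtain ⟨k, hk⟩ : ∃ k, f₀ = 8 * k + f₀ % 8 := ⟨f₀ / 8, by omega⟩
      have hkZ : (f₀ : ℤ) = 8 * k + (f₀ % 8 : ℕ) := by exact_mod_cast hk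
      rcases this with h | h | h | h <;> rw [hkZ, h] <;> push_cast
      · exact ⟨8 * k * k + 2 * k, by ring⟩
      · exact ⟨8 * k * k + 6 * k + 1, by ring⟩
      · exact ⟨8 * k * k + 10 * k + 3, by ring⟩
      · exact ⟨8 * k * k + 14 * k + 6, by ring⟩
    have h2 : (8 : ℤ) ∣ (f₀ : ℤ) * r - d := by
      have : (f₀ : ℤ) * r - d = f₀ * (A - f₀ * d) - f₀ * (A - r) + d * (f₀ * f₀ - 1) := by ring
      rw [this]
      exact dvd_add (dvd_sub (hA2.mul_left _) (hr8.mul_left _)) (h1.mul_left _)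
    have h3 : (f₀ * r) ≡ d [MOD 8] := by
      have : ((f₀ * r : ℕ) : ℤ) ≡ d [ZMOD (8 : ℕ)] :=
        (Int.modEq_iff_dvd.2 (by push_cast; exact_mod_cast h2)).symm
      exact Int.natCast_modEq_iff.1 this
    exact h3
  · have hlp := (hP l hl).1
    have hlr : ¬ (l : ℤ) ∣ (r : ℤ) := by
      rw [Int.natCast_dvd_natCast]
      intro h
      rw [(Nat.prime_dvd_prime_iff_eq hlp hrp).1 h] at hl
      exact hrP hl
    have hu' : ¬ (l : ℤ) ∣ g l * r := fun h =>
      ((Nat.prime_iff_prime_int.1 hlp).dvd_or_dvd h).elim (hg l hl) hlr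
    have e1 : ((f₀ * r : ℕ) : ℤ) = (l : ℤ) ^ e l * (g l * r) := by
      push_cast; rw [hfg l hl]; ring
    rw [e1, padicValInt_pow_mul hlp _ hu', chi_pow_mul hlp _ hu']
    refine ⟨rfl, ?_⟩
    rw [← hJ l hl]
    apply jacobiSym_congr
    have : g l * r - u l = g l * (A - i l * u l) - g l * (A - r) + u l * (g l * i l - 1) := by
      ring
    rw [this]
    exact dvd_add (dvd_sub ((hAl l hl).mul_left _) ((hrl l hl).mul_left _)) ((hi l hl).mul_left _)

/-! ### A local-global principle for ⟨c, q, -cq⟩ -/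

/-- Nondegeneracy of the Hilbert pairing on square classes, reduced to parities and signs and
checked exhaustively. Prescribing (f, c) = (q, c) and (f, cd) = (d, -c) could only fail when c, d or
cd is a square. For c and cd the prescribed values are consistent automatically; for d a square they
require (q, c) = 1, which is the hypothesis. -/
theorem exists_signs : ∀ (vc vq vd : Fin 2) (xm xc xq xd : ℤˣ),
    (xm ^ (vq.val * vc.val) * xq ^ vc.val * xc ^ vq.val = -1 → vd = 1 ∨ xd = -1) →
    ∃ (e : Fin 2) (ε : ℤˣ),
      xm ^ (e.val * vc.val) * ε ^ vc.val * xc ^ e.val =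
        xm ^ (vq.val * vc.val) * xq ^ vc.val * xc ^ vq.val ∧
      xm ^ (e.val * (vc + vd).val) * ε ^ (vc + vd).val * (xc * xd) ^ e.val =
        xm ^ (vd.val * vc.val) * xd ^ vc.val * (xm * xc) ^ vd.val := by
  decide

theorem hilb_eq_units {l : ℕ} {m n : ℤ} {x y z : ℤˣ} (hx : chi l m = x) (hy : chi l n = y)
    (hz : chi l (-1) = z) {i j : Fin 2} (hi : padicValInt l m % 2 = i)
    (hj : padicValInt l n % 2 = j) :
    hilb l m n = ((z ^ (i.val * j.val) * x ^ j.val * y ^ i.val : ℤˣ) : ℤ) := by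
  rw [hilb, hx, hy, hz]
  norm_cast
  rw [Int.units_pow_eq_pow_mod_two z, Int.units_pow_eq_pow_mod_two x,
    Int.units_pow_eq_pow_mod_two y, Nat.mul_mod, hi, hj, ← Int.units_pow_eq_pow_mod_two z]

/-- Local solvability at an odd prime of the conditions on the auxiliary integer `f`. -/
theorem exists_local_signs {l : ℕ} (hl : l.Prime) {c q d : ℤ} (hc : c ≠ 0) (hq : q ≠ 0)
    (hd : d ≠ 0) (h : hilb l q c = -1 → Odd (padicValInt l d) ∨ chi l d = -1) :
    ∃ (e : ℕ) (ε : ℤ), (ε = 1 ∨ ε = -1) ∧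
      ∀ f : ℤ, f ≠ 0 → padicValInt l f = e → chi l f = ε →
        hilb l f c = hilb l q c ∧ hilb l f (c * d) = hilb l d (-c) := by
  have := Fact.mk hl
  have units : ∀ n : ℤ, n ≠ 0 → ∃ x : ℤˣ, chi l n = x := fun n hn =>
    (Int.isUnit_iff.2 (chi_eq_one_or hl hn)).imp fun _ h => h.symm
  obtain ⟨xc, hxc⟩ := units c hc
  obtain ⟨xq, hxq⟩ := units q hq
  obtain ⟨xd, hxd⟩ := units d hd
  obtain ⟨xm, hxm⟩ := units (-1) (by norm_num)
  have par : ∀ n : ℤ, ∃ i : Fin 2, padicValInt l n % 2 = i := fun n =>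
    ⟨⟨padicValInt l n % 2, Nat.mod_lt _ two_pos⟩, rfl⟩
  obtain ⟨vc, hvc⟩ := par c
  obtain ⟨vq, hvq⟩ := par q
  obtain ⟨vd, hvd⟩ := par d
  have hxnc : chi l (-c) = ((xm * xc : ℤˣ) : ℤ) := by
    rw [← neg_one_mul, chi_mul hl (by norm_num) hc, hxm, hxc]; rfl
  have hxcd : chi l (c * d) = ((xc * xd : ℤˣ) : ℤ) := by
    rw [chi_mul hl hc hd, hxc, hxd]; rfl
  have hvnc : padicValInt l (-c) % 2 = vc := by rw [← hvc]; simp [padicValInt]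
  have hvcd : padicValInt l (c * d) % 2 = (vc + vd : Fin 2) := by
    rw [padicValInt.mul hc hd, Nat.add_mod, hvc, hvd, Fin.val_add]
  obtain ⟨e, ε, h1, h2⟩ := exists_signs vc vq vd xm xc xq xd (by
    intro h3
    rw [hilb_eq_units hxq hxc hxm hvq hvc, h3] at h
    rcases h rfl with h | h
    · left
      have := Nat.odd_iff.1 h
      exact Fin.ext (hvd.symm.trans this)
    · right
      exact Units.ext (hxd.symm.trans h))
  refine ⟨e, ε, Int.isUnit_iff.1 ε.isUnit, fun f hf hfe hfε => ?_⟩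
  have hfe' : padicValInt l f % 2 = e := by rw [hfe]; exact Nat.mod_eq_of_lt e.isLt
  rw [hilb_eq_units hfε hxc hxm hfe' hvc, hilb_eq_units hxq hxc hxm hvq hvc,
    hilb_eq_units hfε hxcd hxm hfe' hvcd, hilb_eq_units hxd hxnc hxm hvd hvnc, h1, h2]
  exact ⟨rfl, rfl⟩

theorem eq_zero_of_sq_eq_mul_sq {l : ℕ} (hl : l.Prime) {c x z : ℤ} (hc : c ≠ 0)
    (hv : Odd (padicValInt l c)) (h : x ^ 2 = c * z ^ 2) : z = 0 := by
  have := Fact.mk hl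
  by_contra hz
  have hx : x ≠ 0 := by
    rintro rfl
    exact mul_ne_zero hc (pow_ne_zero 2 hz) (by rw [← h]; ring)
  have h1 := congrArg (padicValInt l) h
  rw [padicValInt.mul hc (pow_ne_zero 2 hz), sq, sq, padicValInt.mul hx hx,
    padicValInt.mul hz hz] at h1
  obtain ⟨k, hk⟩ := hv
  omega

theorem χ₈_mul_self {d : ℕ} (hd : Odd d) : (ZMod.χ₈ d : ℤ) * ZMod.χ₈ d = 1 := by
  rw [ZMod.χ₈_nat_eq_if_mod_eight]
  have := Nat.odd_iff.1 hd
  split_ifs <;> omega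

/-- A local-global principle for representing `d` by the ternary form `⟨c, q, -cq⟩`. -/
theorem exists_repr_of_local {P : Finset ℕ} (hP : ∀ l ∈ P, l.Prime ∧ l ≠ 2) {c q : ℤ} {d : ℕ}
    (hc : c ≠ 0) (hc2 : Odd (padicValInt 2 c)) (hq : 0 < q) (hd : d % 4 = 1)
    (hcP : ∀ l : ℕ, l.Prime → l ≠ 2 → (l : ℤ) ∣ c → l ∈ P)
    (hqP : ∀ l : ℕ, l.Prime → l ≠ 2 → (l : ℤ) ∣ q → l ∈ P)
    (hdP : ∀ l : ℕ, l.Prime → l ∣ d → l ∈ P)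
    (hprod : ∏ l ∈ P, hilb l q c = ZMod.χ₈ d)
    (hloc : ∀ l ∈ P, hilb l q c = -1 → Odd (padicValInt l d) ∨ chi l d = -1) :
    ∃ x y z w : ℚ, w ≠ 0 ∧ d * w ^ 2 = c * x ^ 2 + q * y ^ 2 - c * q * z ^ 2 := by
  have hq0 : q ≠ 0 := hq.ne'
  have hd0 : d ≠ 0 := by omega
  have hdZ : (d : ℤ) ≠ 0 := by exact_mod_cast hd0
  have hdodd : Odd d := Nat.odd_iff.2 (by omega)
  have h2 := Fact.mk Nat.prime_two
  choose! e ε hε hfe using fun l (hl : l ∈ P) =>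
    exists_local_signs (hP l hl).1 hc hq0 hdZ (hloc l hl)
  obtain ⟨f, r, hr, hr2, hrP, hf0, hfP, hf8, hfl⟩ := exists_prescribed hP e ε hε hdodd
  have hfZ : (f : ℤ) ≠ 0 := by exact_mod_cast hf0
  have hodd : ¬ (2 : ℤ) ∣ f := by omega
  have hf4 : f % 4 = 1 := by omega
  have hP' : ∀ l ∈ insert r P, l.Prime ∧ l ≠ 2 := fun l hl =>
    (Finset.mem_insert.1 hl).elim (fun h => h ▸ ⟨hr, hr2⟩) (hP l)
  have hχ : ZMod.χ₈ f = ZMod.χ₈ d := by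
    rw [ZMod.χ₈_nat_mod_eight, hf8, ← ZMod.χ₈_nat_mod_eight]
  have hpow : ∀ n : ℕ, Odd n → (ZMod.χ₈ d : ℤ) ^ n = ZMod.χ₈ d := fun n hn => by
    rw [pow_of_mul_self_eq_one (χ₈_mul_self hdodd), Nat.odd_iff.1 hn, pow_one]
  have hcd0 : c * d ≠ 0 := mul_ne_zero hc hdZ
  have hd2 : padicValInt 2 (d : ℤ) = 0 := padicValInt.eq_zero_of_not_dvd (by push_cast; omega)
  have hcd2 : Odd (padicValInt 2 (c * d)) := by rwa [padicValInt.mul hc hdZ, hd2]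
  have hrc : ¬ (r : ℤ) ∣ c := fun h => hrP (hcP r hr hr2 h)
  have hrq : ¬ (r : ℤ) ∣ q := fun h => hrP (hqP r hr hr2 h)
  have hrd : ¬ (r : ℤ) ∣ d := fun h => hrP (hdP r hr (by exact_mod_cast h))
  have hdvdcd : ∀ l : ℕ, l.Prime → l ≠ 2 → (l : ℤ) ∣ c * d → l ∈ P := fun l hl hl2 h =>
    ((Nat.prime_iff_prime_int.1 hl).dvd_or_dvd h).elim (hcP l hl hl2)
      fun h => hdP l hl (by exact_mod_cast h)
  have hfl' : ∀ l ∈ P, hilb l f c = hilb l q c ∧ hilb l f (c * d) = hilb l d (-c) :=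
    fun l hl => hfe l hl f hfZ (hfl l hl).1 (hfl l hl).2
  -- The symbol at the uncontrolled prime r is forced. The symbols over P multiply to χ₈(d), and so
  -- does the whole product, because f ≡ d mod 8 and c has odd valuation at 2.
  have hrf : hilb r f c = 1 := by
    have h := prod_hilb hP' hf4 hfP hc fun l hl hl2 h =>
      Finset.mem_insert_of_mem (hcP l hl hl2 h)
    rw [Finset.prod_insert hrP, Finset.prod_congr rfl fun l hl => (hfl' l hl).1, hprod, hχ,
      hpow _ hc2] at h
    calc hilb r f c = hilb r f c * ZMod.χ₈ d * ZMod.χ₈ d := by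
          rw [mul_assoc, χ₈_mul_self hdodd, mul_one]
      _ = 1 := by rw [h, χ₈_mul_self hdodd]
  have hrfd : hilb r f (c * d) = 1 := by
    have h := prod_hilb hP' hf4 hfP hcd0 fun l hl hl2 h =>
      Finset.mem_insert_of_mem (hdvdcd l hl hl2 h)
    have h' := prod_hilb hP hd hdP (m := -c) (neg_ne_zero.2 hc) fun l hl hl2 h =>
      hcP l hl hl2 (dvd_neg.1 h)
    have hv : padicValInt 2 (-c) = padicValInt 2 c := by simp [padicValInt]
    rw [Finset.prod_insert hrP, Finset.prod_congr rfl fun l hl => (hfl' l hl).2, h', hv, hχ,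
      hpow _ hc2, hpow _ hcd2] at h
    calc hilb r f (c * d) = hilb r f (c * d) * ZMod.χ₈ d * ZMod.χ₈ d := by
          rw [mul_assoc, χ₈_mul_self hdodd, mul_one]
      _ = 1 := by rw [h, χ₈_mul_self hdodd]
  have hnf : ∀ l : ℕ, l.Prime → l ≠ r → l ∉ P → ¬ (l : ℤ) ∣ f := fun l hl hlr hlP h => by
    rcases Finset.mem_insert.1 (hfP l hl (by exact_mod_cast h)) with h | h
    · exact hlr h
    · exact hlP h
  -- This conic makes f a value of ⟨q, -cq⟩ and the next one makes it a value of ⟨d, -c⟩; equating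
  -- the two values represents d times a square.
  obtain ⟨x₁, y₁, z₁, e₁, hn₁⟩ := legendre (a := q * f) (b := c) (mul_ne_zero hq0 hfZ) hc
    (Or.inl (mul_pos hq (by omega))) fun l hl hl2 => by
      rw [hilb_mul_left hl hq0 hfZ]
      by_cases hlP : l ∈ P
      · rw [(hfl' l hlP).1, hilb_mul_self hl hq0 hc]
      by_cases hlr : l = r
      · rw [hlr, hrf, hilb_of_not_dvd hrq hrc, one_mul]
      · rw [hilb_of_not_dvd (fun h => hlP (hqP l hl hl2 h)) fun h => hlP (hcP l hl hl2 h),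
          hilb_of_not_dvd (hnf l hl hlr hlP) fun h => hlP (hcP l hl hl2 h), one_mul]
  obtain ⟨x₂, y₂, z₂, e₂, hn₂⟩ := legendre (a := f * d) (b := c * d) (mul_ne_zero hfZ hdZ) hcd0
    (Or.inl (mul_pos (by omega) (by omega))) fun l hl hl2 => by
      have h1 : hilb l d (c * d) = hilb l d (-c) := by
        have : c * (d : ℤ) = -c * -d := by ring
        rw [this, hilb_mul_right hl (neg_ne_zero.2 hc) (neg_ne_zero.2 hdZ),
          hilb_self_neg hl hdZ, mul_one]
      rw [hilb_mul_left hl hfZ hdZ, h1]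
      by_cases hlP : l ∈ P
      · rw [(hfl' l hlP).2, hilb_mul_self hl hdZ (neg_ne_zero.2 hc)]
      by_cases hlr : l = r
      · rw [hlr, hrfd, hilb_of_not_dvd hrd (by rwa [dvd_neg]), one_mul]
      · rw [hilb_of_not_dvd (hnf l hl hlr hlP) fun h => hlP (hdvdcd l hl hl2 h),
          hilb_of_not_dvd (fun h => hlP (hdP l hl (by exact_mod_cast h)))
            fun h => hlP (hcP l hl hl2 (dvd_neg.1 h)), one_mul]
  have hy₁ : y₁ ≠ 0 := by
    rintro rfl
    have := eq_zero_of_sq_eq_mul_sq Nat.prime_two hc hc2 (by rw [e₁]; ring : x₁ ^ 2 = c * z₁ ^ 2)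
    simp [this] at hn₁
  have hy₂ : y₂ ≠ 0 := by
    rintro rfl
    have := eq_zero_of_sq_eq_mul_sq Nat.prime_two hcd0 hcd2
      (by rw [e₂]; ring : x₂ ^ 2 = (c * d) * z₂ ^ 2)
    simp [this] at hn₂
  -- x₂ is the numerator of w. If it vanished, -cf times a square would be a square, against its odd
  -- valuation at 2.
  have hx₂ : x₂ ≠ 0 := by
    rintro rfl
    have hcf : Odd (padicValInt 2 (-c * f)) := by
      have hf2 : padicValInt 2 (f : ℤ) = 0 := padicValInt.eq_zero_of_not_dvd hodd
      rw [padicValInt.mul (neg_ne_zero.2 hc) hfZ, hf2, add_zero]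
      simpa [padicValInt] using hc2
    have h1 : (f * y₂) ^ 2 = (-c * f) * z₂ ^ 2 := by
      refine mul_left_cancel₀ hdZ ?_
      linear_combination (-f : ℤ) * e₂
    have hz := eq_zero_of_sq_eq_mul_sq Nat.prime_two (mul_ne_zero (neg_ne_zero.2 hc) hfZ) hcf h1
    rw [hz] at h1
    have : f * y₂ = 0 := by simpa using h1
    exact mul_ne_zero hfZ hy₂ this
  have hqQ : (q : ℚ) ≠ 0 := by exact_mod_cast hq0
  have hdQ : (d : ℚ) ≠ 0 := by exact_mod_cast hd0
  have hy₁Q : (y₁ : ℚ) ≠ 0 := by exact_mod_cast hy₁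
  have hy₂Q : (y₂ : ℚ) ≠ 0 := by exact_mod_cast hy₂
  have hx₂Q : (x₂ : ℚ) ≠ 0 := by exact_mod_cast hx₂
  have e₁' : (x₁ : ℚ) ^ 2 = q * f * y₁ ^ 2 + c * z₁ ^ 2 := by exact_mod_cast e₁
  have e₂' : (x₂ : ℚ) ^ 2 = f * d * y₂ ^ 2 + c * d * z₂ ^ 2 := by exact_mod_cast e₂
  refine ⟨z₂ / y₂, x₁ / (q * y₁), z₁ / (q * y₁), x₂ / (d * y₂),
    div_ne_zero hx₂Q (mul_ne_zero hdQ hy₂Q), ?_⟩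
  have f₁ : (f : ℚ) = q * (x₁ / (q * y₁)) ^ 2 - c * q * (z₁ / (q * y₁)) ^ 2 := by
    field_simp
    linear_combination -e₁'
  have f₂ : (f : ℚ) = d * (x₂ / (d * y₂)) ^ 2 - c * (z₂ / y₂) ^ 2 := by
    field_simp
    linear_combination -e₂'
  linear_combination f₁ - f₂

/-! ### Sums of two nonsplit traces at an odd prime -/

/-- Fewer than half of the residues `s` modulo `l` make `s ^ 2 - 4` a nonzero square. -/
theorem two_mul_card_sq_sub_four_lt {l : ℕ} [Fact l.Prime] (h2 : l ≠ 2) :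
    2 * (Finset.univ.filter fun s : ZMod l => ∃ y : ZMod l, y ≠ 0 ∧ s ^ 2 - 4 = y ^ 2).card < l := by
  classical
  have hl : l.Prime := Fact.out
  have two : (2 : ZMod l) ≠ 0 := fun h => by
    have : ((2 : ℕ) : ZMod l) = 0 := by exact_mod_cast h
    rw [ZMod.natCast_eq_zero_iff] at this
    exact h2 ((Nat.prime_dvd_prime_iff_eq hl Nat.prime_two).1 this)
  set W := Finset.univ.filter fun s : ZMod l => ∃ y : ZMod l, y ≠ 0 ∧ s ^ 2 - 4 = y ^ 2
  set U := Finset.univ.filter fun u : ZMod l => u ≠ 0 ∧ u + u⁻¹ ∈ W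
  have h := Finset.mul_card_image_le_card_of_maps_to (s := U) (t := W) (f := fun u => u + u⁻¹)
    (fun u hu => (Finset.mem_filter.1 hu).2.2) 2 ?_
  · refine h.trans_lt ?_
    have : U ⊆ Finset.univ.erase 0 := fun u hu =>
      Finset.mem_erase.2 ⟨(Finset.mem_filter.1 hu).2.1, Finset.mem_univ _⟩
    have h1 := Finset.card_le_card this
    rw [Finset.card_erase_of_mem (Finset.mem_univ _), Finset.card_univ, ZMod.card] at h1
    have := hl.pos
    omega
  · intro s hs
    obtain ⟨y, hy, e⟩ := (Finset.mem_filter.1 hs).2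
    -- (s ± y)/2 are the roots of X² - sX + 1, distinct since y ≠ 0. So every s in W has at least
    -- two preimages u under u ↦ u + u⁻¹, among the l - 1 nonzero residues.
    have hprod : (s + y) / 2 * ((s - y) / 2) = 1 := by
      field_simp
      linear_combination e
    have hu : (s + y) / 2 ≠ 0 := left_ne_zero_of_mul_eq_one hprod
    have hv : (s - y) / 2 ≠ 0 := right_ne_zero_of_mul_eq_one hprod
    have hui : ((s + y) / 2)⁻¹ = (s - y) / 2 := inv_eq_of_mul_eq_one_right hprod
    have hvi : ((s - y) / 2)⁻¹ = (s + y) / 2 := by rw [← hui, inv_inv]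
    have hsum : (s + y) / 2 + (s - y) / 2 = s := by field_simp; ring
    rw [Nat.succ_le_iff, Finset.one_lt_card]
    refine ⟨(s + y) / 2, ?_, (s - y) / 2, ?_, fun h => hy ?_⟩
    · simp only [U, Finset.mem_filter, Finset.mem_univ, true_and]
      exact ⟨⟨hu, by rwa [hui, hsum]⟩, by rw [hui, hsum]⟩
    · simp only [U, Finset.mem_filter, Finset.mem_univ, true_and]
      exact ⟨⟨hv, by rwa [hvi, add_comm, hsum]⟩, by rw [hvi, add_comm, hsum]⟩
    · have : (2 : ZMod l) * y = 0 := by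
        have := congrArg (fun x => 2 * x) h
        field_simp at this
        linear_combination this
      exact (mul_eq_zero.1 this).resolve_left two

/-- Pigeonhole: the bad residues W and their reflection t - W together have fewer than l elements.
-/
theorem exists_zmod_add {l : ℕ} [Fact l.Prime] (h2 : l ≠ 2) (t : ZMod l) :
    ∃ s : ZMod l, (¬ ∃ y : ZMod l, y ≠ 0 ∧ s ^ 2 - 4 = y ^ 2) ∧
      ¬ ∃ y : ZMod l, y ≠ 0 ∧ (t - s) ^ 2 - 4 = y ^ 2 := by
  classical
  set W := Finset.univ.filter fun s : ZMod l => ∃ y : ZMod l, y ≠ 0 ∧ s ^ 2 - 4 = y ^ 2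
  by_contra! hcon
  have hW : 2 * W.card < l := two_mul_card_sq_sub_four_lt h2
  have hsub : (Finset.univ : Finset (ZMod l)) ⊆ W ∪ W.image fun s => t - s := by
    intro s _
    rw [Finset.mem_union, Finset.mem_image]
    by_cases h : s ∈ W
    · exact Or.inl h
    · right
      refine ⟨t - s, ?_, by ring⟩
      simp only [W, Finset.mem_filter, Finset.mem_univ, true_and] at h ⊢
      push Not at h
      exact hcon s h
  have h1 := (Finset.card_le_card hsub).trans (Finset.card_union_le _ _)
  have h3 := Finset.card_image_le (s := W) (f := fun s => t - s)
  rw [Finset.card_univ, ZMod.card] at h1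
  omega

/-- The polynomial `X ^ 2 - s X + 1` has a discriminant that is visibly not an `l`-adic square. -/
def Nonsplit (l : ℕ) (s : ℤ) : Prop :=
  jacobiSym (s ^ 2 - 4) l = -1 ∨ ((l : ℤ) ∣ s ^ 2 - 4 ∧ ¬ (l : ℤ) ^ 2 ∣ s ^ 2 - 4)

/-- A nonsquare discriminant modulo l is unaffected by the choice of lift. If l divides s² - 4,
changing s by l·k moves (s² - 4)/l by 2sk modulo l, and 2s is a unit there, so divisibility by l²
can hold for only one class of k. -/
theorem nonsplit_add_mul {l : ℕ} (hl : l.Prime) (h2 : l ≠ 2) {s : ℤ}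
    (hs : ¬ ∃ y : ZMod l, y ≠ 0 ∧ (s : ZMod l) ^ 2 - 4 = y ^ 2) {j k : ℤ}
    (hjk : ¬ (l : ℤ) ∣ j - k) : Nonsplit l (s + l * j) ∨ Nonsplit l (s + l * k) := by
  have := Fact.mk hl
  have hl' := Nat.prime_iff_prime_int.1 hl
  have h2' := not_dvd_two hl h2
  by_cases hd : (l : ℤ) ∣ s ^ 2 - 4
  · have hdvd : ∀ k : ℤ, (l : ℤ) ∣ (s + l * k) ^ 2 - 4 := fun k => by
      have : (s + l * k) ^ 2 - 4 = (s ^ 2 - 4) + l * (2 * s * k + l * k ^ 2) := by ring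
      rw [this]; exact dvd_add hd (dvd_mul_right _ _)
    by_contra! hcon
    unfold Nonsplit at hcon
    push Not at hcon
    have hj := hcon.1.2 (hdvd j)
    have hk := hcon.2.2 (hdvd k)
    have h3 : (l : ℤ) * l ∣ l * (2 * (s * (j - k))) := by
      obtain ⟨a, ha⟩ := hj
      obtain ⟨b, hb⟩ := hk
      exact ⟨a - b - j ^ 2 + k ^ 2, by linear_combination ha - hb⟩
    have h4 := Int.dvd_of_mul_dvd_mul_left (by exact_mod_cast hl.ne_zero) h3
    rcases hl'.dvd_or_dvd h4 with h | h
    · exact h2' h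
    rcases hl'.dvd_or_dvd h with h | h
    · have h5 : (l : ℤ) ∣ 2 * 2 := by
        have := dvd_sub (h.mul_left s) hd
        have e : s * s - (s ^ 2 - 4) = 2 * 2 := by ring
        rwa [e] at this
      exact (hl'.dvd_or_dvd h5).elim h2' h2'
    · exact hjk h
  · left
    left
    have e : (l : ℤ) ∣ ((s + l * j) ^ 2 - 4) - (s ^ 2 - 4) := ⟨2 * s * j + l * j ^ 2, by ring⟩
    rw [jacobiSym_congr e]
    refine ZMod.nonsquare_iff_jacobiSym_eq_neg_one.2 fun ⟨y, hy⟩ => hs ⟨y, ?_, ?_⟩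
    · rintro rfl
      rw [mul_zero, ZMod.intCast_zmod_eq_zero_iff_dvd] at hy
      exact hd hy
    · push_cast at hy
      rw [hy, sq]

/-- Every integer is a sum of two integers whose associated quadratic polynomials are visibly not
split over the `l`-adic numbers. -/
theorem exists_nonsplit_add {l : ℕ} (hl : l.Prime) (h2 : l ≠ 2) (t : ℤ) :
    ∃ s : ℤ, Nonsplit l s ∧ Nonsplit l (t - s) := by
  have := Fact.mk hl
  obtain ⟨x, hx, hy⟩ := exists_zmod_add h2 (t : ZMod l)
  have e1 : (((x.val : ℤ) : ℤ) : ZMod l) = x := by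
    rw [Int.cast_natCast, ZMod.natCast_zmod_val]
  have e2 : ((t - (x.val : ℤ) : ℤ) : ZMod l) = t - x := by rw [Int.cast_sub, e1]
  have A := fun {j k : ℤ} => nonsplit_add_mul hl h2 (s := x.val) (j := j) (k := k) (by rwa [e1])
  have B := fun {j k : ℤ} => nonsplit_add_mul hl h2 (s := t - x.val) (j := j) (k := k)
    (by rwa [e2])
  have d1 : ¬ (l : ℤ) ∣ 1 := fun h => hl.not_dvd_one (by exact_mod_cast h)
  have d2 := not_dvd_two hl h2
  -- Of the three lifts k = 0, 1, 2, at most one is bad for each summand, so some lift serves both;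
  -- the differences ±1, ±2 are units because l is odd.
  have a01 := A (j := 1) (k := 0) (by simpa using d1)
  have a02 := A (j := 2) (k := 0) (by simpa using d2)
  have a12 := A (j := 2) (k := 1) (by norm_num; exact d1)
  have b01 := B (j := -1) (k := 0) (by simpa using d1)
  have b02 := B (j := -2) (k := 0) (by simpa using d2)
  have b12 := B (j := -1) (k := -2) (by norm_num; exact d1)
  have C : ∀ k : ℤ, Nonsplit l (x.val + l * k) → Nonsplit l (t - x.val + l * -k) →
      ∃ s : ℤ, Nonsplit l s ∧ Nonsplit l (t - s) := fun k h h' =>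
    ⟨_, h, by rwa [show t - (x.val + l * k) = t - x.val + l * -k by ring]⟩
  by_contra hcon
  have C' : ∀ k : ℤ, Nonsplit l (x.val + l * k) → ¬ Nonsplit l (t - x.val + l * -k) :=
    fun k h h' => hcon (C k h h')
  have c0 := C' 0
  have c1 := C' 1
  have c2 := C' 2
  rw [neg_zero] at c0
  clear C C' hcon A B
  generalize Nonsplit l (x.val + l * 0) = A₀ at *
  generalize Nonsplit l (x.val + l * 1) = A₁ at *
  generalize Nonsplit l (x.val + l * 2) = A₂ at *
  generalize Nonsplit l (t - x.val + l * 0) = B₀ at *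
  generalize Nonsplit l (t - x.val + l * -1) = B₁ at *
  generalize Nonsplit l (t - x.val + l * -2) = B₂ at *
  clear hx hy e1 e2
  grind

/-- A² - 4m² ≡ m²(s² - 4) mod l², and precision l² suffices to see either a nonresidue or exact
divisibility by l. -/
theorem odd_or_chi_eq_neg_one_of_nonsplit {l : ℕ} (hl : l.Prime) {A m s : ℤ}
    (hs : Nonsplit l s) (hm : ¬ (l : ℤ) ∣ m) (hA : (l : ℤ) ^ 2 ∣ A - s * m) :
    Odd (padicValInt l (A ^ 2 - 4 * m ^ 2)) ∨ chi l (A ^ 2 - 4 * m ^ 2) = -1 := by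
  have hl' := Nat.prime_iff_prime_int.1 hl
  obtain ⟨k, hk⟩ := hA
  have e : A ^ 2 - 4 * m ^ 2 = m ^ 2 * (s ^ 2 - 4) + (l : ℤ) ^ 2 * (k * (A + s * m)) := by
    linear_combination (A + s * m) * hk
  rcases hs with h | ⟨h1, h2⟩
  · right
    have hd : (l : ℤ) ∣ (A ^ 2 - 4 * m ^ 2) - m ^ 2 * (s ^ 2 - 4) :=
      ⟨l * (k * (A + s * m)), by rw [e]; ring⟩
    have hJ : jacobiSym (A ^ 2 - 4 * m ^ 2) l = -1 := by
      rw [jacobiSym_congr hd, jacobiSym.mul_left, jacobiSym_sq hl hm, h, one_mul]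
    rw [chi_of_not_dvd, hJ]
    intro h0
    have h0' : (l : ℤ) ∣ (A ^ 2 - 4 * m ^ 2) - 0 := by simpa using h0
    rw [jacobiSym_congr h0', jacobiSym.zero_left hl.one_lt] at hJ
    norm_num at hJ
  · left
    obtain ⟨c, hc⟩ := h1
    have hlc : ¬ (l : ℤ) ∣ c := by
      rintro ⟨b, rfl⟩
      exact h2 ⟨b, by rw [hc]; ring⟩
    have e' : A ^ 2 - 4 * m ^ 2 = (l : ℤ) ^ 1 * (m ^ 2 * c + l * (k * (A + s * m))) := by
      rw [e, hc]; ring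
    rw [e', padicValInt_pow_mul hl 1]
    · exact odd_one
    · intro h
      have := (dvd_add_left (dvd_mul_right _ _)).1 h
      rcases hl'.dvd_or_dvd this with h | h
      · exact hm (hl'.dvd_of_dvd_pow h)
      · exact hlc h

theorem odd_or_chi_of_mul_sq {l : ℕ} (hl : l.Prime) {d k : ℤ} (hd : d ≠ 0) (hk : k ≠ 0)
    (h : Odd (padicValInt l (d * k ^ 2)) ∨ chi l (d * k ^ 2) = -1) :
    Odd (padicValInt l d) ∨ chi l d = -1 := by
  have := Fact.mk hl
  have hkk := mul_ne_zero hk hk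
  rw [sq, padicValInt.mul hd hkk, padicValInt.mul hk hk, chi_mul hl hd hkk, chi_mul hl hk hk,
    chi_mul_self hl hk, mul_one] at h
  refine h.imp (fun h => ?_) id
  rw [← two_mul] at h
  exact (Nat.odd_add.1 h).2 (even_two_mul _)

/-! ### From local conditions to membership in S and T -/

/-- The odd primes dividing an integer. -/
def oddPrimeFactors (n : ℤ) : Finset ℕ := n.natAbs.primeFactors.erase 2

theorem mem_oddPrimeFactors {n : ℤ} (hn : n ≠ 0) {l : ℕ} :
    l ∈ oddPrimeFactors n ↔ l ≠ 2 ∧ l.Prime ∧ (l : ℤ) ∣ n := by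
  rw [oddPrimeFactors, Finset.mem_erase, Nat.mem_primeFactors, Int.natCast_dvd]
  simp [hn]

/-- A trace 2x₁ is attained exactly when x₁² - 1 is a value of ⟨c, q, -cq⟩. Here x₁ = A/(2m), so x₁²
- 1 = dk²/(2m)² and it suffices to represent d. Nonsplitness at a ramified prime says that d is not
a local square, the one local obstruction there. -/
theorem mem_S_of_local {c q : ℤ} (hc : c ≠ 0) (hc2 : Odd (padicValInt 2 c)) (hq : 0 < q)
    {A m k : ℤ} {d : ℕ} (hm : m ≠ 0) (hk : k ≠ 0) (hd : d % 4 = 1)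
    (hAm : A ^ 2 - 4 * m ^ 2 = d * k ^ 2)
    (hprod : ∏ l ∈ oddPrimeFactors (q * c), hilb l q c = ZMod.χ₈ d)
    (hloc : ∀ l ∈ oddPrimeFactors (q * c), hilb l q c = -1 →
      ∃ s : ℤ, Nonsplit l s ∧ ¬ (l : ℤ) ∣ m ∧ (l : ℤ) ^ 2 ∣ A - s * m) :
    (A / m : ℚ) ∈ S c q := by
  have hq0 : q ≠ 0 := hq.ne'
  have hqc := mul_ne_zero hq0 hc
  have hdZ : (d : ℤ) ≠ 0 := by omega
  have hmem := @mem_oddPrimeFactors (q * c * d) (mul_ne_zero hqc hdZ)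
  have hsub : oddPrimeFactors (q * c) ⊆ oddPrimeFactors (q * c * d) := fun l hl => by
    have h := (mem_oddPrimeFactors hqc).1 hl
    exact hmem.2 ⟨h.1, h.2.1, h.2.2.mul_right _⟩
  have hone : ∀ l ∈ oddPrimeFactors (q * c * d), l ∉ oddPrimeFactors (q * c) →
      hilb l q c = 1 := fun l hl hl' => by
    have h := hmem.1 hl
    have hnd : ¬ (l : ℤ) ∣ q * c := fun hd => hl' ((mem_oddPrimeFactors hqc).2 ⟨h.1, h.2.1, hd⟩)
    exact hilb_of_not_dvd (fun h => hnd (h.mul_right _)) fun h => hnd (h.mul_left _)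
  obtain ⟨x, y, z, w, hw, e⟩ := exists_repr_of_local (P := oddPrimeFactors (q * c * d))
    (fun l hl => ⟨(hmem.1 hl).2.1, (hmem.1 hl).1⟩) hc hc2 hq hd
    (fun l hl h2 h => hmem.2 ⟨h2, hl, (h.mul_left q).mul_right _⟩)
    (fun l hl h2 h => hmem.2 ⟨h2, hl, (h.mul_right c).mul_right _⟩)
    (fun l hl h => hmem.2 ⟨by rintro rfl; omega, hl,
      (Int.natCast_dvd_natCast.2 h).mul_left _⟩)
    (by rw [← hprod, Finset.prod_subset hsub hone])
    (fun l hl h => by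
      have hlp := (hmem.1 hl).2.1
      have hl' : l ∈ oddPrimeFactors (q * c) := by
        by_contra hn
        rw [hone l hl hn] at h
        norm_num at h
      obtain ⟨s, hs, hlm, hA⟩ := hloc l hl' h
      have := odd_or_chi_eq_neg_one_of_nonsplit hlp hs hlm hA
      rw [hAm] at this
      exact odd_or_chi_of_mul_sq hlp hdZ hk this)
  have hmQ : (m : ℚ) ≠ 0 := by exact_mod_cast hm
  have hAmQ : (A : ℚ) ^ 2 - 4 * m ^ 2 = d * k ^ 2 := by exact_mod_cast hAm
  refine ⟨A / (2 * m), k / (2 * m * w) * x, k / (2 * m * w) * y, k / (2 * m * w) * z, ?_, ?_⟩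
  · field_simp
    linear_combination w ^ 2 * hAmQ + k ^ 2 * e
  · field_simp

theorem exists_int_crt_gt (P : Finset ℕ) (hP : ∀ l ∈ P, l.Prime) (n : ℕ → ℕ) (a : ℕ → ℤ)
    (B : ℤ) : ∃ A : ℤ, B < A ∧ ∀ l ∈ P, (l : ℤ) ^ n l ∣ A - a l := by
  obtain ⟨A, hA⟩ := exists_int_crt P hP n a
  have hM : (0 : ℤ) < ∏ l ∈ P, (l : ℤ) ^ n l :=
    Finset.prod_pos fun l hl => pow_pos (by exact_mod_cast (hP l hl).pos) _
  refine ⟨A + (∏ l ∈ P, (l : ℤ) ^ n l) * (|A| + |B| + 1), ?_, fun l hl => ?_⟩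
  · have h1 : |A| + |B| + 1 ≤ (∏ l ∈ P, (l : ℤ) ^ n l) * (|A| + |B| + 1) :=
      le_mul_of_one_le_left (by positivity) hM
    have h2 := neg_abs_le A
    have h3 := le_abs_self B
    linarith
  · rw [add_sub_right_comm]
    exact dvd_add (hA l hl)
      ((Finset.dvd_prod_of_mem (fun k : ℕ => (k : ℤ) ^ n k) hl).mul_right _)

/-- The local decompositions n/m = s + (t - s) are glued by the Chinese remainder theorem, with room
left for a class modulo 128. The lower bounds make both discriminants positive. -/
theorem exists_global_split (P : Finset ℕ) (hP : ∀ l ∈ P, l.Prime ∧ l ≠ 2) (n m a : ℤ)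
    (hm : ∀ l ∈ P, ¬ (l : ℤ) ∣ m) :
    ∃ A : ℤ, 2 * |m| < A ∧ 2 * |m| < A - n ∧ (128 : ℤ) ∣ A - a ∧
      ∀ l ∈ P, (∃ s : ℤ, Nonsplit l s ∧ ¬ (l : ℤ) ∣ m ∧ (l : ℤ) ^ 2 ∣ A - s * m) ∧
        ∃ s : ℤ, Nonsplit l s ∧ ¬ (l : ℤ) ∣ m ∧ (l : ℤ) ^ 2 ∣ (n - A) - s * m := by
  have key : ∀ l ∈ P, ∃ s t : ℤ, Nonsplit l s ∧ Nonsplit l (t - s) ∧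
      (l : ℤ) ^ 2 ∣ n - t * m := fun l hl => by
    obtain ⟨u, v, huv⟩ := ((Nat.prime_iff_prime_int.1 (hP l hl).1).coprime_iff_not_dvd.2
      (hm l hl)).pow_left (m := 2)
    obtain ⟨s, hs, hs'⟩ := exists_nonsplit_add (hP l hl).1 (hP l hl).2 (n * v)
    exact ⟨s, n * v, hs, hs', n * u, by linear_combination -n * huv⟩
  choose! s t hs hts htn using key
  obtain ⟨A, hAB, hA⟩ := exists_int_crt_gt (insert 2 P)
    (fun l hl => (Finset.mem_insert.1 hl).elim (fun h => h ▸ Nat.prime_two) fun h => (hP l h).1)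
    -- Exponent 7 gives the modulus 128 at 2; exponent 2 gives the precision l² that nonsplitness
    -- requires.
    (fun l => if l = 2 then 7 else 2) (fun l => if l = 2 then a else s l * m) (2 * |m| + |n|)
  have hA2 : (128 : ℤ) ∣ A - a := by simpa using hA 2 (Finset.mem_insert_self 2 P)
  have hAl : ∀ l ∈ P, (l : ℤ) ^ 2 ∣ A - s l * m := fun l hl => by
    simpa [(hP l hl).2] using hA l (Finset.mem_insert_of_mem hl)
  have h1 := abs_nonneg n
  have h2 := le_abs_self n
  refine ⟨A, by linarith, by linarith, hA2, fun l hl =>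
    ⟨⟨s l, hs l hl, hm l hl, hAl l hl⟩, t l - s l, hts l hl, hm l hl, ?_⟩⟩
  have : (n - A) - (t l - s l) * m = (n - t l * m) - (A - s l * m) := by ring
  rw [this]
  exact dvd_sub (htn l hl) (hAl l hl)

theorem mem_T_of_split {c q : ℤ} (hc : c ≠ 0) (hc2 : Odd (padicValInt 2 c)) (hq : 0 < q)
    {n m a : ℤ} (hm : m ≠ 0)
    (hloc : ∀ l ∈ oddPrimeFactors (q * c), hilb l q c = -1 → ¬ (l : ℤ) ∣ m)
    (hd : ∀ A : ℤ, (128 : ℤ) ∣ A - a → 2 * |m| < A → 2 * |m| < A - n →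
      ∀ B, B = A ∨ B = n - A →
      ∃ (k : ℤ) (d : ℕ), k ≠ 0 ∧ d % 4 = 1 ∧ B ^ 2 - 4 * m ^ 2 = d * k ^ 2 ∧
        ∏ l ∈ oddPrimeFactors (q * c), hilb l q c = ZMod.χ₈ d) :
    (n / m : ℚ) ∈ T c q := by
  have hqc := mul_ne_zero hq.ne' hc
  obtain ⟨A, hA1, hA2, hA3, hA⟩ := exists_global_split
    ((oddPrimeFactors (q * c)).filter fun l => hilb l q c = -1)
    (fun l hl => by
      have := (mem_oddPrimeFactors hqc).1 (Finset.mem_filter.1 hl).1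
      exact ⟨this.2.1, this.1⟩) n m a
    fun l hl => hloc l (Finset.mem_filter.1 hl).1 (Finset.mem_filter.1 hl).2
  have hmQ : (m : ℚ) ≠ 0 := by exact_mod_cast hm
  refine Set.mem_add.2 ⟨A / m, ?_, (n - A : ℤ) / m, ?_, by push_cast; field_simp; ring⟩
  · obtain ⟨k, d, hk, hd4, e, hp⟩ := hd A hA3 hA1 hA2 A (Or.inl rfl)
    exact mem_S_of_local hc hc2 hq hm hk hd4 e hp fun l hl h =>
      (hA l (Finset.mem_filter.2 ⟨hl, h⟩)).1
  · obtain ⟨k, d, hk, hd4, e, hp⟩ := hd A hA3 hA1 hA2 (n - A) (Or.inr rfl)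
    exact mem_S_of_local hc hc2 hq hm hk hd4 e hp fun l hl h =>
      (hA l (Finset.mem_filter.2 ⟨hl, h⟩)).2

theorem sq_sub_pos {m A n B : ℤ} (h1 : 2 * |m| < A) (h2 : 2 * |m| < A - n)
    (hB : B = A ∨ B = n - A) : 0 < B ^ 2 - 4 * m ^ 2 := by
  have h : 2 * |m| < |B| := by
    rcases hB with rfl | rfl
    · exact h1.trans_le (le_abs_self _)
    · rw [abs_sub_comm]; exact h2.trans_le (le_abs_self _)
  have h3 : |2 * m| < |B| := by rwa [abs_mul, abs_two]
  have := sq_lt_sq.2 h3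
  linarith

theorem mul_self_emod_eight {x : ℤ} (hx : x % 2 = 1) : x ^ 2 % 8 = 1 := by
  have : x % 8 = 1 ∨ x % 8 = 3 ∨ x % 8 = 5 ∨ x % 8 = 7 := by omega
  rcases this with h | h | h | h <;> simp [sq, Int.mul_emod, h]

theorem χ₈_of_mod_eq_one {d : ℕ} (h : d % 8 = 1) : ZMod.χ₈ d = 1 := by
  rw [ZMod.χ₈_nat_mod_eight, h]; decide

theorem χ₈_of_mod_eq_five {d : ℕ} (h : d % 8 = 5) : ZMod.χ₈ d = -1 := by
  rw [ZMod.χ₈_nat_mod_eight, h]; decide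

/-- Odd symbols of product 1 correspond to an algebra unramified at 2, so denominators may be even;
the auxiliary d must then be 1 mod 8. -/
theorem mem_T_of_prod_eq_one {c q : ℤ} (hc : c ≠ 0) (hc2 : Odd (padicValInt 2 c)) (hq : 0 < q)
    (hprod : ∏ l ∈ oddPrimeFactors (q * c), hilb l q c = 1) {t : ℚ}
    (ht : ∀ l ∈ oddPrimeFactors (q * c), hilb l q c = -1 → ¬ l ∣ t.den) : t ∈ T c q := by
  have hqc := mul_ne_zero hq.ne' hc
  -- Doubling numerator and denominator makes n and m even, so both summands have odd numerator B
  -- and B² - 4m² ≡ 1 mod 8.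
  have e : t = ((2 * t.num : ℤ) : ℚ) / ((2 * t.den : ℤ) : ℚ) := by
    push_cast
    rw [mul_div_mul_left _ _ two_ne_zero, Rat.num_div_den]
  rw [e]
  refine mem_T_of_split hc hc2 hq (a := 1)
    (mul_ne_zero two_ne_zero (by exact_mod_cast t.den_nz)) (fun l hl h hd => ?_) ?_
  · have hl' := (mem_oddPrimeFactors hqc).1 hl
    rcases (Nat.prime_iff_prime_int.1 hl'.2.1).dvd_or_dvd hd with h' | h'
    · exact not_dvd_two hl'.2.1 hl'.1 h'
    · exact ht l hl h (by exact_mod_cast h')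
  · intro A hA h1 h2 B hB
    have hpos := sq_sub_pos h1 h2 hB
    have hB2 : B % 2 = 1 := by omega
    have := mul_self_emod_eight hB2
    have h8 : (B ^ 2 - 4 * (2 * (t.den : ℤ)) ^ 2) % 8 = 1 := by
      have : 4 * (2 * (t.den : ℤ)) ^ 2 = 8 * (2 * (t.den : ℤ) ^ 2) := by ring
      omega
    refine ⟨1, (B ^ 2 - 4 * (2 * (t.den : ℤ)) ^ 2).toNat, one_ne_zero, by omega, ?_, ?_⟩
    · rw [Int.toNat_of_nonneg hpos.le]; ring
    · rw [hprod, χ₈_of_mod_eq_one (by omega)]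

/-- Here 2 is a ramified prime, the denominator m is odd, and the discriminants must be 5 mod 8 up
to squares. An odd B gives this at once, as 1 - 4 ≡ 5 mod 8. -/
theorem mem_T_of_prod_eq_neg_one {c q : ℤ} (hc : c ≠ 0) (hc2 : Odd (padicValInt 2 c))
    (hq : 0 < q) (hprod : ∏ l ∈ oddPrimeFactors (q * c), hilb l q c = -1) {t : ℚ}
    (ht2 : ¬ 2 ∣ t.den)
    (ht : ∀ l ∈ oddPrimeFactors (q * c), hilb l q c = -1 → ¬ l ∣ t.den) : t ∈ T c q := by
  have e : t = (t.num : ℚ) / ((t.den : ℤ) : ℚ) := by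
    rw [Int.cast_natCast, Rat.num_div_den]
  have hm2 : (t.den : ℤ) % 2 = 1 := by omega
  have hm8 := mul_self_emod_eight hm2
  rw [e]
  -- If n is odd, one of A and n - A is even. It is taken to be A ≡ 18m mod 128: since 18² - 4 =
  -- 64·5, A² - 4m² is then 64 times an integer ≡ 5 mod 8.
  refine mem_T_of_split hc hc2 hq (a := if t.num % 2 = 0 then 1 else 18 * t.den)
    (by exact_mod_cast t.den_nz) (fun l hl h hd => ht l hl h (by exact_mod_cast hd)) ?_
  intro A hA h1 h2 B hB
  have hpos := sq_sub_pos h1 h2 hB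
  by_cases hB2 : B % 2 = 1
  · have := mul_self_emod_eight hB2
    have h8 : (B ^ 2 - 4 * (t.den : ℤ) ^ 2) % 8 = 5 := by omega
    refine ⟨1, (B ^ 2 - 4 * (t.den : ℤ) ^ 2).toNat, one_ne_zero, by omega, ?_, ?_⟩
    · rw [Int.toNat_of_nonneg hpos.le]; ring
    · rw [hprod, χ₈_of_mod_eq_five (by omega)]
  · split_ifs at hA with hn
    · omega
    · have hBA : B = A := by omega
      subst hBA
      obtain ⟨j, hj⟩ := hA
      clear e
      generalize (t.den : ℤ) = m at *
      have hB' : B = 18 * m + 128 * j := by linarith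
      have e1 : B ^ 2 - 4 * m ^ 2 = (5 * m ^ 2 + 72 * m * j + 256 * j ^ 2) * 8 ^ 2 := by
        rw [hB']; ring
      have hpos' : 0 < 5 * m ^ 2 + 72 * m * j + 256 * j ^ 2 := by omega
      have h8 : (5 * m ^ 2 + 72 * m * j + 256 * j ^ 2) % 8 = 5 := by
        have : 5 * m ^ 2 + 72 * m * j + 256 * j ^ 2 =
          5 * m ^ 2 + 8 * (9 * m * j + 32 * j ^ 2) := by ring
        omega
      refine ⟨8, (5 * m ^ 2 + 72 * m * j + 256 * j ^ 2).toNat, by norm_num, by omega, ?_, ?_⟩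
      · rw [Int.toNat_of_nonneg hpos'.le, e1]
      · rw [hprod, χ₈_of_mod_eq_five (by omega)]

/-! ### Integrality of norm-one elements at a ramified odd prime -/

/-- Leading terms can cancel only if X and Y have equal norm, and then u would be a square modulo l.
-/
theorem padicNorm_sq_sub {l : ℕ} [Fact l.Prime] {u : ℤ} (hu : jacobiSym u l = -1) (X Y : ℚ) :
    padicNorm l (X ^ 2 - u * Y ^ 2) = max (padicNorm l X) (padicNorm l Y) ^ 2 := by
  have hl : l.Prime := Fact.out
  have hlu : ¬ (l : ℤ) ∣ u := fun h => by
    have h0 : (l : ℤ) ∣ u - 0 := by simpa using h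
    rw [jacobiSym_congr h0, jacobiSym.zero_left hl.one_lt] at hu
    norm_num at hu
  have hnu : padicNorm l u = 1 := (padicNorm.int_eq_one_iff u).2 hlu
  have hX2 : padicNorm l (X ^ 2) = padicNorm l X ^ 2 := by rw [sq, padicNorm.mul, sq]
  have hY2 : padicNorm l (-(u * Y ^ 2)) = padicNorm l Y ^ 2 := by
    rw [padicNorm.neg, padicNorm.mul, hnu, sq, padicNorm.mul]; ring
  by_cases h : padicNorm l X = padicNorm l Y
  · by_cases hY : Y = 0
    · have hX : X = 0 := by
        rw [hY, padicNorm.zero] at h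
        exact padicNorm.zero_of_padicNorm_eq_zero h
      simp [hX, hY]
    have hY' := padicNorm.nonzero (p := l) hY
    obtain ⟨r, hr⟩ : ∃ r, r = X / Y := ⟨_, rfl⟩
    have hrn : padicNorm l r = 1 := by rw [hr, padicNorm.div, h, div_self hY']
    have hX : X = r * Y := by rw [hr]; field_simp
    have hden : ¬ l ∣ r.den := fun hd => by
      have hnum : ¬ (l : ℤ) ∣ r.num := fun hn => by
        have := Nat.dvd_gcd (Int.natCast_dvd.1 hn) hd
        rw [r.reduced] at this
        exact hl.not_dvd_one this
      have h1 : padicNorm l (r.num / r.den) = 1 := by rwa [Rat.num_div_den]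
      rw [padicNorm.div, (padicNorm.int_eq_one_iff _).2 hnum, div_eq_one_iff_eq
        (padicNorm.nonzero (by exact_mod_cast r.den_nz))] at h1
      exact (padicNorm.nat_eq_one_iff _).1 h1.symm hd
    have hsub : ¬ (l : ℤ) ∣ r.num ^ 2 - u * r.den ^ 2 := fun hd => by
      have := (jacobiSym.prime_dvd_of_eq_neg_one hu hd).2
      exact hden (by exact_mod_cast this)
    have e : X ^ 2 - u * Y ^ 2 = (r.num ^ 2 - u * r.den ^ 2 : ℤ) * (Y / r.den) ^ 2 := by
      have hd0 : (r.den : ℚ) ≠ 0 := by exact_mod_cast r.den_nz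
      have h2 : r * r.den = r.num := by rw [Rat.mul_den_eq_num]
      rw [hX]; push_cast; rw [← h2]; field_simp
    rw [h, max_self, e, padicNorm.mul, (padicNorm.int_eq_one_iff _).2 hsub, one_mul, sq,
      padicNorm.mul, padicNorm.div, (padicNorm.nat_eq_one_iff _).2 hden, div_one, sq]
  · have hne : padicNorm l X ^ 2 ≠ padicNorm l Y ^ 2 := fun h' =>
      h ((sq_eq_sq₀ (padicNorm.nonneg _) (padicNorm.nonneg _)).1 h')
    rw [sub_eq_add_neg, padicNorm.add_eq_max_of_ne (by rwa [hX2, hY2]), hX2, hY2]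
    rcases le_total (padicNorm l X) (padicNorm l Y) with hle | hle
    · rw [max_eq_right hle, max_eq_right (pow_le_pow_left₀ (padicNorm.nonneg _) hle 2)]
    · rw [max_eq_left hle, max_eq_left (pow_le_pow_left₀ (padicNorm.nonneg _) hle 2)]

theorem not_dvd_den_of_padicNorm_le {l : ℕ} [Fact l.Prime] {x : ℚ} (h : padicNorm l x ≤ 1) :
    ¬ l ∣ x.den := fun hd => by
  have hl : l.Prime := Fact.out
  have hnum : ¬ (l : ℤ) ∣ x.num := fun hn => by
    have := Nat.dvd_gcd (Int.natCast_dvd.1 hn) hd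
    rw [x.reduced] at this
    exact hl.not_dvd_one this
  have h1 : padicNorm l (x.num / x.den) ≤ 1 := by rwa [Rat.num_div_den]
  have h2 : padicNorm l x.den < 1 := (padicNorm.nat_lt_one_iff _).2 hd
  have h3 : 0 < padicNorm l x.den := lt_of_le_of_ne (padicNorm.nonneg _)
    (padicNorm.nonzero (by exact_mod_cast x.den_nz)).symm
  rw [padicNorm.div, (padicNorm.int_eq_one_iff _).2 hnum, div_le_one h3] at h1
  linarith

/-- The norm form of a quaternion algebra ramified at `l` takes the value one only at `l`-integral
points. -/
theorem not_dvd_den_of_norm_eq_one {l : ℕ} (hl : l.Prime) {u : ℤ} (hu : jacobiSym u l = -1)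
    {k : ℚ} (hk0 : k ≠ 0) (hk : Odd (padicValRat l k)) {X Y Z W : ℚ}
    (h : X ^ 2 - u * Y ^ 2 + k * (Z ^ 2 - u * W ^ 2) = 1) : ¬ l ∣ X.den := by
  have := Fact.mk hl
  apply not_dvd_den_of_padicNorm_le
  by_contra! hX
  obtain ⟨x, hx0, hx, hXx⟩ : ∃ x : ℚ, x ≠ 0 ∧ padicNorm l (X ^ 2 - u * Y ^ 2) = padicNorm l (x ^ 2) ∧
      padicNorm l X ≤ padicNorm l x := by
    rw [padicNorm_sq_sub hu]
    rcases le_total (padicNorm l X) (padicNorm l Y) with hle | hle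
    · refine ⟨Y, ?_, by rw [max_eq_right hle, sq, sq, padicNorm.mul], hle⟩
      rintro rfl; rw [padicNorm.zero] at hle; linarith
    · refine ⟨X, ?_, by rw [max_eq_left hle, sq, sq, padicNorm.mul], le_rfl⟩
      rintro rfl; rw [padicNorm.zero] at hX; linarith
  obtain ⟨z, hz⟩ : ∃ z : ℚ, padicNorm l (Z ^ 2 - u * W ^ 2) = padicNorm l (z ^ 2) := by
    rw [padicNorm_sq_sub hu]
    rcases le_total (padicNorm l Z) (padicNorm l W) with hle | hle
    · exact ⟨W, by rw [max_eq_right hle, sq, sq, padicNorm.mul]⟩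
    · exact ⟨Z, by rw [max_eq_left hle, sq, sq, padicNorm.mul]⟩
  have hx1 : 1 < padicNorm l (x ^ 2) := by
    rw [sq, padicNorm.mul]; nlinarith
  -- The two halves of the norm form must cancel; otherwise their sum would have norm greater than
  -- 1.
  have heq : padicNorm l (x ^ 2) = padicNorm l (k * z ^ 2) := by
    rw [padicNorm.mul, ← hz, ← padicNorm.mul, ← hx]
    by_contra hne
    have h1 := padicNorm.add_eq_max_of_ne hne
    rw [h, padicNorm.one, hx] at h1
    have := le_max_left (padicNorm l (x ^ 2)) (padicNorm l (k * (Z ^ 2 - u * W ^ 2)))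
    linarith
  have hz0 : z ≠ 0 := by
    rintro rfl
    rw [zero_pow two_ne_zero, mul_zero, padicNorm.zero] at heq
    linarith
  have hl1 : (1 : ℚ) < l := by exact_mod_cast hl.one_lt
  rw [padicNorm.eq_zpow_of_nonzero (pow_ne_zero 2 hx0),
    padicNorm.eq_zpow_of_nonzero (mul_ne_zero hk0 (pow_ne_zero 2 hz0))] at heq
  have h2 := zpow_right_injective₀ (by linarith) hl1.ne' heq
  -- But the two valuations have opposite parity, since that of k is odd.
  rw [padicValRat.mul hk0 (pow_ne_zero 2 hz0), padicValRat.pow, padicValRat.pow] at h2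
  obtain ⟨j, hj⟩ := hk
  push_cast at h2
  omega

/-! ### Semilocal subrings of ℚ and their Jacobson radicals -/

/-- Rationals of `l`-adic valuation at least `k` for all `l ∈ Δ`. -/
def adicBall (Δ : Finset ℕ) (k : ℤ) : Set ℚ :=
  {x | ∀ l ∈ Δ, padicNorm l x ≤ (l : ℚ) ^ (-k)}

theorem padicNorm_le_zpow_iff {l : ℕ} (hl : l.Prime) {k : ℤ} {x : ℚ} :
    padicNorm l x ≤ (l : ℚ) ^ (-k) ↔ x = 0 ∨ k ≤ padicValRat l x := by
  have hl1 : (1 : ℚ) < l := by exact_mod_cast hl.one_lt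
  by_cases hx : x = 0
  · simp only [hx, padicNorm.zero, true_or, iff_true]
    positivity
  · rw [padicNorm.eq_zpow_of_nonzero hx, zpow_le_zpow_iff_right₀ hl1]
    simp [hx]

theorem padicNorm_le_one_iff {l : ℕ} (hl : l.Prime) {x : ℚ} :
    padicNorm l x ≤ 1 ↔ ¬ l ∣ x.den := by
  have := Fact.mk hl
  refine ⟨not_dvd_den_of_padicNorm_le, fun h => ?_⟩
  rw [← Rat.num_div_den x, padicNorm.div, (padicNorm.nat_eq_one_iff _).2 h, div_one]
  exact padicNorm.of_int _

theorem mem_adicBall_zero_iff {Δ : Finset ℕ} (hΔ : ∀ l ∈ Δ, l.Prime) {x : ℚ} :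
    x ∈ adicBall Δ 0 ↔ ∀ l ∈ Δ, ¬ l ∣ x.den :=
  forall₂_congr fun l hl => by rw [neg_zero, zpow_zero, padicNorm_le_one_iff (hΔ l hl)]

theorem padicNorm_add_le {l : ℕ} (hl : l.Prime) {x y B : ℚ} (hx : padicNorm l x ≤ B)
    (hy : padicNorm l y ≤ B) : padicNorm l (x + y) ≤ B := by
  have := Fact.mk hl
  exact padicNorm.nonarchimedean.trans (max_le hx hy)

theorem exists_pow_mul_mem {l : ℕ} (hl : l.Prime) (k : ℤ) (x : ℚ) :
    ∃ N : ℕ, ∀ n : ℤ, (l : ℤ) ^ N ∣ n → padicNorm l (n * x) ≤ (l : ℚ) ^ (-k) := by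
  have := Fact.mk hl
  have hl1 : (1 : ℚ) < l := by exact_mod_cast hl.one_lt
  by_cases hx : x = 0
  · refine ⟨0, fun n _ => ?_⟩
    rw [hx, mul_zero, padicNorm.zero]; positivity
  refine ⟨(k - padicValRat l x).toNat, fun n hn => ?_⟩
  have h1 := padicNorm.dvd_iff_norm_le.1 (by exact_mod_cast hn)
  rw [padicNorm.mul, padicNorm.eq_zpow_of_nonzero hx]
  calc _ ≤ (l : ℚ) ^ (-((k - padicValRat l x).toNat : ℤ)) * (l : ℚ) ^ (-padicValRat l x) :=
        mul_le_mul_of_nonneg_right h1 (by positivity)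
    _ = (l : ℚ) ^ (-((k - padicValRat l x).toNat : ℤ) + -padicValRat l x) :=
        (zpow_add₀ (by linarith) _ _).symm
    _ ≤ _ := zpow_le_zpow_right₀ hl1.le (by omega)

theorem padicNorm_int_mul_le {l : ℕ} (hl : l.Prime) (n : ℤ) {x B : ℚ} (hx : padicNorm l x ≤ B) :
    padicNorm l (n * x) ≤ B := by
  have := Fact.mk hl
  rw [padicNorm.mul]
  exact (mul_le_of_le_one_left (padicNorm.nonneg _) (padicNorm.of_int n)).trans hx

/-- For the harder inclusion, take coprime integers divisible by high powers of the primes of Δ₁ \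
Δ₂ and Δ₂ \ Δ₁ respectively. A Bézout relation splits x into two multiples, each with its bad
denominators cleared. -/
theorem adicBall_add {Δ₁ Δ₂ : Finset ℕ} (h₁ : ∀ l ∈ Δ₁, l.Prime) (h₂ : ∀ l ∈ Δ₂, l.Prime)
    (k : ℤ) : adicBall Δ₁ k + adicBall Δ₂ k = adicBall (Δ₁ ∩ Δ₂) k := by
  ext x
  rw [Set.mem_add]
  constructor
  · rintro ⟨y, hy, z, hz, rfl⟩ l hl
    rw [Finset.mem_inter] at hl
    exact padicNorm_add_le (h₁ l hl.1) (hy l hl.1) (hz l hl.2)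
  · intro hx
    choose! N hN using fun l (hl : l ∈ Δ₁ ∪ Δ₂) =>
      exists_pow_mul_mem ((Finset.mem_union.1 hl).elim (h₁ l) (h₂ l)) k x
    have hcop : IsCoprime (∏ l ∈ Δ₁ \ Δ₂, (l : ℤ) ^ N l) (∏ l ∈ Δ₂ \ Δ₁, (l : ℤ) ^ N l) := by
      refine IsCoprime.prod_left fun i hi => IsCoprime.prod_right fun j hj => ?_
      rw [Finset.mem_sdiff] at hi hj
      refine (Nat.isCoprime_iff_coprime.2
        ((Nat.coprime_primes (h₁ i hi.1) (h₂ j hj.1)).2 ?_)).pow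
      rintro rfl; exact hi.2 hj.1
    obtain ⟨u, v, huv⟩ := hcop
    refine ⟨(u * ∏ l ∈ Δ₁ \ Δ₂, (l : ℤ) ^ N l : ℤ) * x, fun l hl => ?_,
      (v * ∏ l ∈ Δ₂ \ Δ₁, (l : ℤ) ^ N l : ℤ) * x, fun l hl => ?_, ?_⟩
    · by_cases h : l ∈ Δ₂
      · exact padicNorm_int_mul_le (h₁ l hl) _ (hx l (Finset.mem_inter.2 ⟨hl, h⟩))
      · exact hN l (Finset.mem_union_left _ hl) _ ((Finset.dvd_prod_of_mem
          (fun l : ℕ => (l : ℤ) ^ N l) (Finset.mem_sdiff.2 ⟨hl, h⟩)).mul_left _)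
    · by_cases h : l ∈ Δ₁
      · exact padicNorm_int_mul_le (h₂ l hl) _ (hx l (Finset.mem_inter.2 ⟨h, hl⟩))
      · exact hN l (Finset.mem_union_right _ hl) _ ((Finset.dvd_prod_of_mem
          (fun l : ℕ => (l : ℤ) ^ N l) (Finset.mem_sdiff.2 ⟨hl, h⟩)).mul_left _)
    · rw [← add_mul, ← Int.cast_add, huv, Int.cast_one, one_mul]

/-- The semilocal ring of rationals that are integral at all primes in `Δ`. -/
def semilocalRing (Δ : Finset ℕ) (hΔ : ∀ l ∈ Δ, l.Prime) : Subring ℚ where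
  carrier := adicBall Δ 0
  mul_mem' {x y} hx hy l hl := by
    have := Fact.mk (hΔ l hl)
    have hx := hx l hl
    have hy := hy l hl
    rw [neg_zero, zpow_zero] at *
    rw [padicNorm.mul]
    exact mul_le_one₀ hx (padicNorm.nonneg _) hy
  one_mem' l hl := by simp
  add_mem' {x y} hx hy l hl := padicNorm_add_le (hΔ l hl) (hx l hl) (hy l hl)
  zero_mem' l hl := by simp
  neg_mem' {x} hx l hl := by rw [padicNorm.neg]; exact hx l hl

theorem adicBall_zero_ne_univ {Δ : Finset ℕ} (hΔ : ∀ l ∈ Δ, l.Prime) (hne : Δ.Nonempty) :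
    adicBall Δ 0 ≠ Set.univ := by
  obtain ⟨l, hl⟩ := hne
  have hlp := hΔ l hl
  intro h
  have h1 : ((l : ℚ)⁻¹) ∈ adicBall Δ 0 := h ▸ Set.mem_univ _
  have h2 := (mem_adicBall_zero_iff hΔ).1 h1 l hl
  rw [Rat.inv_natCast_den_of_pos hlp.pos] at h2
  exact h2 dvd_rfl

/-- If l did not divide the numerator, Bézout would make some 1 - v·den·j equal to a multiple u·l.
Membership in the radical makes it a unit of A, yet its norm is below 1 and that of its inverse is
at most 1. -/
theorem dvd_num_of_mem_jacobson {A : Subring ℚ} {l : ℕ} (hl : l.Prime)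
    (hA : ∀ x ∈ A, ¬ l ∣ x.den) {j : A} (hj : j ∈ Ring.jacobson A) :
    (l : ℤ) ∣ (j : ℚ).num := by
  have := Fact.mk hl
  by_contra hd
  obtain ⟨u, v, huv⟩ := (Nat.prime_iff_prime_int.1 hl).coprime_iff_not_dvd.2 hd
  rw [← Ideal.jacobson_bot, Ideal.mem_jacobson_bot] at hj
  obtain ⟨w, hw⟩ := hj (-v * (j : ℚ).den)
  have h1 : ((w : A) : ℚ) = u * l := by
    rw [hw]
    push_cast
    have h2 : (j : ℚ) * (j : ℚ).den = (j : ℚ).num := Rat.mul_den_eq_num _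
    have h3 : (u * l + v * (j : ℚ).num : ℚ) = 1 := by exact_mod_cast huv
    linear_combination -(v : ℚ) * h2 - h3
  have h2 : ((w : A) : ℚ) * ((w⁻¹ : Aˣ) : A) = 1 := by
    have := w.mul_inv
    exact_mod_cast congrArg Subtype.val this
  have h3 : padicNorm l ((w⁻¹ : Aˣ) : A) ≤ 1 :=
    (padicNorm_le_one_iff hl).2 (hA _ ((w⁻¹ : Aˣ) : A).2)
  have h4 := congrArg (padicNorm l) h2
  rw [padicNorm.mul, padicNorm.one, h1, padicNorm.mul] at h4
  have h5 := padicNorm.of_int (p := l) u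
  have h6 : padicNorm l (l : ℚ) < 1 := padicNorm.padicNorm_p_lt_one_of_prime
  have h7 : padicNorm l u * padicNorm l (l : ℚ) < 1 :=
    (mul_le_of_le_one_left (padicNorm.nonneg _) h5).trans_lt h6
  have h8 : padicNorm l u * padicNorm l (l : ℚ) * padicNorm l ((w⁻¹ : Aˣ) : A) < 1 :=
    (mul_le_of_le_one_right (mul_nonneg (padicNorm.nonneg _) (padicNorm.nonneg _)) h3).trans_lt h7
  linarith

theorem padicNorm_le_inv_of_dvd_num {l : ℕ} (hl : l.Prime) {x : ℚ} (h : (l : ℤ) ∣ x.num)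
    (hd : ¬ l ∣ x.den) : padicNorm l x ≤ (l : ℚ) ^ (-1 : ℤ) := by
  have := Fact.mk hl
  rw [← Rat.num_div_den x, padicNorm.div, (padicNorm.nat_eq_one_iff _).2 hd, div_one]
  have := (padicNorm.dvd_iff_norm_le (p := l) (n := 1) (z := x.num)).1 (by simpa using h)
  exact_mod_cast this

/-- For x of positive valuation at each prime of Δ, xy + 1 is a unit at all of them. Nonemptiness
matters: for empty Δ the ring is the field ℚ, with radical 0. -/
theorem jacobsonRadical_adicBall {Δ : Finset ℕ} (hΔ : ∀ l ∈ Δ, l.Prime) (hne : Δ.Nonempty) :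
    jacobsonRadical (adicBall Δ 0) = adicBall Δ 1 := by
  have h := jacobsonRadical_coe (semilocalRing Δ hΔ)
  change jacobsonRadical (adicBall Δ 0) = _ at h
  rw [h]
  ext x
  constructor
  · rintro ⟨j, hj, rfl⟩ l hl
    have hA : ∀ x ∈ semilocalRing Δ hΔ, ¬ l ∣ x.den := fun x hx =>
      (mem_adicBall_zero_iff hΔ).1 hx l hl
    exact padicNorm_le_inv_of_dvd_num (hΔ l hl) (dvd_num_of_mem_jacobson (hΔ l hl) hA hj)
      (hA _ j.2)
  · intro hx
    have hlt : ∀ l ∈ Δ, padicNorm l x < 1 := fun l hl =>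
      (hx l hl).trans_lt (zpow_lt_one_of_neg₀ (by exact_mod_cast (hΔ l hl).one_lt) (by norm_num))
    have hx0 : x ∈ semilocalRing Δ hΔ := fun l hl => by
      rw [neg_zero, zpow_zero]; exact (hlt l hl).le
    refine ⟨⟨x, hx0⟩, ?_, rfl⟩
    rw [SetLike.mem_coe, ← Ideal.jacobson_bot, Ideal.mem_jacobson_bot]
    intro y
    have hn : ∀ l ∈ Δ, padicNorm l (x * y + 1) = 1 := fun l hl => by
      have := Fact.mk (hΔ l hl)
      have h1 : padicNorm l (x * y) < 1 := by
        rw [padicNorm.mul]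
        have := y.2 l hl
        rw [neg_zero, zpow_zero] at this
        exact (mul_le_of_le_one_right (padicNorm.nonneg _) this).trans_lt (hlt l hl)
      rw [padicNorm.add_eq_max_of_ne (by rw [padicNorm.one]; exact h1.ne), padicNorm.one,
        max_eq_right h1.le]
    have h0 : x * y + 1 ≠ 0 := fun h0 => by
      obtain ⟨l, hl⟩ := hne
      have := hn l hl
      rw [h0, padicNorm.zero] at this
      norm_num at this
    have hinv : (x * y + 1)⁻¹ ∈ semilocalRing Δ hΔ := fun l hl => by
      have := Fact.mk (hΔ l hl)
      rw [inv_eq_one_div, padicNorm.div, hn l hl, padicNorm.one, neg_zero, zpow_zero, div_one]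
    exact IsUnit.of_mul_eq_one (⟨_, hinv⟩ : semilocalRing Δ hΔ)
      (Subtype.ext (mul_inv_cancel₀ h0))

/-! ### The sets J_{a,b} through parity of valuations -/

theorem exists_padicValRat_eq {Δ : Finset ℕ} (hΔ : ∀ l ∈ Δ, l.Prime) (e : ℕ → ℤ) :
    ∃ w : ℚ, w ≠ 0 ∧ ∀ l ∈ Δ, padicValRat l w = e l := by
  induction Δ using Finset.induction_on with
  | empty => exact ⟨1, one_ne_zero, by simp⟩
  | insert k Δ hk ih =>
    obtain ⟨w, hw, h⟩ := ih fun l hl => hΔ l (Finset.mem_insert_of_mem hl)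
    have hkp := hΔ k (Finset.mem_insert_self k Δ)
    have hk0 : (k : ℚ) ≠ 0 := by exact_mod_cast hkp.ne_zero
    have hz := zpow_ne_zero (e k - padicValRat k w) hk0
    refine ⟨w * (k : ℚ) ^ (e k - padicValRat k w), mul_ne_zero hw hz, fun l hl => ?_⟩
    have := Fact.mk (hΔ l hl)
    have := Fact.mk hkp
    rw [padicValRat.mul hw hz, padicValRat.zpow]
    rcases Finset.mem_insert.1 hl with rfl | hl'
    · rw [padicValRat.self hkp.one_lt]; ring
    · have hlk : l ≠ k := by rintro rfl; exact hk hl'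
      rw [h l hl', padicValRat.of_nat, padicValNat_primes hlk]
      simp

theorem padicValRat_add_eq {l : ℕ} (hl : l.Prime) {x y : ℚ} (hx : x ≠ 0)
    (h : y = 0 ∨ padicValRat l x < padicValRat l y) :
    padicValRat l (x + y) = padicValRat l x := by
  have := Fact.mk hl
  by_cases hy : y = 0
  · rw [hy, add_zero]
  · have hlt := h.resolve_left hy
    refine padicValRat.add_eq_of_lt (fun h0 => ?_) hx hy hlt
    rw [eq_neg_of_add_eq_zero_left h0, padicValRat.neg] at hlt
    exact lt_irrefl _ hlt

theorem padicValRat_sub_eq {l : ℕ} (hl : l.Prime) {x y : ℚ} (hx : x ≠ 0)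
    (h : y = 0 ∨ padicValRat l x < padicValRat l y) :
    padicValRat l (x - y) = padicValRat l x := by
  rw [sub_eq_add_neg]
  exact padicValRat_add_eq hl hx (by rwa [neg_eq_zero, padicValRat.neg])

theorem padicValRat_sub_eq' {l : ℕ} (hl : l.Prime) {x y : ℚ} (hy : y ≠ 0)
    (h : x = 0 ∨ padicValRat l y < padicValRat l x) :
    padicValRat l (x - y) = padicValRat l y := by
  rw [← neg_sub, padicValRat.neg, padicValRat_sub_eq hl hy h]

section

variable {a b : ℚ} {Δ : Finset ℕ}

theorem mem_adicBall_iff (hΔ : ∀ l ∈ Δ, l.Prime) {k : ℤ} {x : ℚ} :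
    x ∈ adicBall Δ k ↔ ∀ l ∈ Δ, x = 0 ∨ k ≤ padicValRat l x :=
  forall₂_congr fun l hl => padicNorm_le_zpow_iff (hΔ l hl)

theorem mem_TUnits_iff (hΔ : ∀ l ∈ Δ, l.Prime) (hT : T a b = adicBall Δ 0) {u : ℚ} :
    u ∈ TUnits a b ↔ u ≠ 0 ∧ ∀ l ∈ Δ, padicValRat l u = 0 := by
  unfold TUnits
  rw [Set.mem_ofPred_eq, hT]
  simp only [mem_adicBall_iff hΔ]
  constructor
  · rintro ⟨hu, v, hv, huv⟩
    have hu0 := left_ne_zero_of_mul_eq_one huv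
    have hv0 := right_ne_zero_of_mul_eq_one huv
    refine ⟨hu0, fun l hl => ?_⟩
    have := Fact.mk (hΔ l hl)
    have h1 := congrArg (padicValRat l) huv
    rw [padicValRat.mul hu0 hv0, padicValRat.one] at h1
    have := (hu l hl).resolve_left hu0
    have := (hv l hl).resolve_left hv0
    omega
  · rintro ⟨hu0, h⟩
    refine ⟨fun l hl => Or.inr (h l hl).ge, u⁻¹, fun l hl => Or.inr ?_, mul_inv_cancel₀ hu0⟩
    have := Fact.mk (hΔ l hl)
    rw [padicValRat.inv, h l hl, neg_zero]

/-- Units have valuation 0 on Δ and w may have arbitrary valuations there, so only parities survive.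
-/
theorem mem_sqClass_iff (hΔ : ∀ l ∈ Δ, l.Prime) (hT : T a b = adicBall Δ 0) {c x : ℚ}
    (hc : c ≠ 0) :
    x ∈ sqClass a b c ↔ x = 0 ∨ ∀ l ∈ Δ, Even (padicValRat l x - padicValRat l c) := by
  unfold sqClass
  simp only [Set.mem_ofPred_eq, mem_TUnits_iff hΔ hT]
  constructor
  · rintro ⟨w, u, ⟨hu, hul⟩, rfl⟩
    by_cases hw : w = 0
    · left; rw [hw]; ring
    · refine Or.inr fun l hl => ?_
      have := Fact.mk (hΔ l hl)
      rw [padicValRat.mul (mul_ne_zero hc (pow_ne_zero 2 hw)) hu,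
        padicValRat.mul hc (pow_ne_zero 2 hw), padicValRat.pow, hul l hl]
      exact ⟨padicValRat l w, by push_cast; ring⟩
  · intro h
    by_cases hx : x = 0
    · exact ⟨0, 1, ⟨one_ne_zero, fun l _ => padicValRat.one⟩, by rw [hx]; ring⟩
    obtain ⟨w, hw, hwl⟩ := exists_padicValRat_eq hΔ
      fun l => (padicValRat l x - padicValRat l c) / 2
    have hcw := mul_ne_zero hc (pow_ne_zero 2 hw)
    refine ⟨w, x / (c * w ^ 2), ⟨div_ne_zero hx hcw, fun l hl => ?_⟩, by field_simp⟩
    have := Fact.mk (hΔ l hl)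
    obtain ⟨r, hr⟩ := h.resolve_left hx l hl
    rw [padicValRat.div hx hcw, padicValRat.mul hc (pow_ne_zero 2 hw), padicValRat.pow, hwl l hl]
    push_cast
    omega

theorem mem_K_iff (hΔ : ∀ l ∈ Δ, l.Prime) (hT : T a b = adicBall Δ 0) {c y : ℚ} (hc : c ≠ 0) :
    y ∈ K a b c ↔ (y = 0 ∨ ∀ l ∈ Δ, Even (padicValRat l y - padicValRat l c)) ∧
      (1 - y = 0 ∨ ∀ l ∈ Δ, Even (padicValRat l (1 - y))) := by
  have e : (∃ z ∈ sqClass a b 1, y = 1 - z) ↔ 1 - y ∈ sqClass a b 1 :=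
    ⟨fun ⟨z, hz, h⟩ => by rwa [h, sub_sub_cancel], fun h => ⟨_, h, by ring⟩⟩
  unfold K
  rw [Set.mem_ofPred_eq, e, mem_sqClass_iff hΔ hT hc, mem_sqClass_iff hΔ hT one_ne_zero]
  simp

/-- The valuation of y ≠ 0 is odd. Were it negative, 1 - y would have the same odd valuation,
against the second condition on y. -/
theorem pos_padicValRat_of_mem_K (hΔ : ∀ l ∈ Δ, l.Prime) (hT : T a b = adicBall Δ 0) {c y : ℚ}
    (hc : c ≠ 0) (hy : y ∈ K a b c) {l : ℕ} (hl : l ∈ Δ) (hcl : Odd (padicValRat l c)) :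
    padicNorm l y ≤ (l : ℚ) ^ (-1 : ℤ) := by
  have := Fact.mk (hΔ l hl)
  rw [padicNorm_le_zpow_iff (hΔ l hl)]
  obtain ⟨h1, h2⟩ := (mem_K_iff hΔ hT hc).1 hy
  by_cases hy0 : y = 0
  · exact Or.inl hy0
  right
  have h3 := h1.resolve_left hy0 l hl
  by_contra! hlt
  obtain ⟨r, hr⟩ := hcl
  obtain ⟨s, hs⟩ := h3
  have hneg : padicValRat l y < 0 := by omega
  have h4 : padicValRat l (1 - y) = padicValRat l y :=
    padicValRat_sub_eq' (hΔ l hl) hy0 (Or.inr (by rwa [padicValRat.one]))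
  rcases h2 with h2 | h2
  · rw [h2, padicValRat.zero] at h4
    omega
  · obtain ⟨m, hm⟩ := h2 l hl
    omega

theorem exists_mem_K (hΔ : ∀ l ∈ Δ, l.Prime) (hT : T a b = adicBall Δ 0) {c x : ℚ}
    (hc : c ≠ 0) (hx : x ∈ adicBall Δ 1) : ∃ y, y ∈ K a b c ∧ x - y ∈ K a b c := by
  classical
  rw [mem_adicBall_iff hΔ] at hx
  -- Where c has odd valuation, y and x - y need odd positive valuations: 1 works unless x has
  -- valuation 1, when 3 leaves x - y with valuation 1. Where c has even valuation, -2 dominates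
  -- both x and 1. The default value 0 of the valuation at x = 0 falls harmlessly into these cases.
  obtain ⟨y, hy0, hy⟩ := exists_padicValRat_eq hΔ fun l =>
    if Odd (padicValRat l c) then (if padicValRat l x = 1 then 3 else 1) else -2
  refine ⟨y, ?_⟩
  rw [mem_K_iff hΔ hT hc, mem_K_iff hΔ hT hc]
  have key : ∀ l ∈ Δ, (Even (padicValRat l y - padicValRat l c) ∧
      Even (padicValRat l (1 - y))) ∧ Even (padicValRat l (x - y) - padicValRat l c) ∧
      Even (padicValRat l (1 - (x - y))) := by
    intro l hl
    have := Fact.mk (hΔ l hl)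
    have hyl := hy l hl
    have hv1 : padicValRat l (1 : ℚ) = 0 := padicValRat.one
    split_ifs at hyl with hcl hx1
    · have e1 : padicValRat l (1 - y) = 0 := by
        rw [padicValRat_sub_eq (hΔ l hl) one_ne_zero (Or.inr (by omega)), hv1]
      have hx0 : x ≠ 0 := by rintro rfl; simp at hx1
      have e2 : padicValRat l (x - y) = 1 := by
        rw [padicValRat_sub_eq (hΔ l hl) hx0 (Or.inr (by omega)), hx1]
      have e3 : padicValRat l (1 - (x - y)) = 0 := by
        rw [padicValRat_sub_eq (hΔ l hl) one_ne_zero (Or.inr (by omega)), hv1]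
      rw [hyl, e1, e2, e3]
      exact ⟨⟨(by decide : Odd (3 : ℤ)).sub_odd hcl, Even.zero⟩, odd_one.sub_odd hcl, Even.zero⟩
    · have e1 : padicValRat l (1 - y) = 0 := by
        rw [padicValRat_sub_eq (hΔ l hl) one_ne_zero (Or.inr (by omega)), hv1]
      have e2 : padicValRat l (x - y) = 1 := by
        rw [padicValRat_sub_eq' (hΔ l hl) hy0 ((hx l hl).imp_right (by omega)), hyl]
      have e3 : padicValRat l (1 - (x - y)) = 0 := by
        rw [padicValRat_sub_eq (hΔ l hl) one_ne_zero (Or.inr (by omega)), hv1]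
      rw [hyl, e1, e2, e3]
      exact ⟨⟨odd_one.sub_odd hcl, Even.zero⟩, odd_one.sub_odd hcl, Even.zero⟩
    · have e1 : padicValRat l (1 - y) = -2 := by
        rw [padicValRat_sub_eq' (hΔ l hl) hy0 (Or.inr (by omega)), hyl]
      have e2 : padicValRat l (x - y) = -2 := by
        rw [padicValRat_sub_eq' (hΔ l hl) hy0 ((hx l hl).imp_right (by omega)), hyl]
      have hxy : x - y ≠ 0 := by
        intro h; rw [h, padicValRat.zero] at e2; omega
      have e3 : padicValRat l (1 - (x - y)) = -2 := by
        rw [padicValRat_sub_eq' (hΔ l hl) hxy (Or.inr (by omega)), e2]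
      have hce : Even (padicValRat l c) := Int.not_odd_iff_even.1 hcl
      have h2 : Even (-2 : ℤ) := by decide
      rw [hyl, e1, e2, e3]
      exact ⟨⟨h2.sub hce, h2⟩, h2.sub hce, h2⟩
  exact ⟨⟨Or.inr fun l hl => (key l hl).1.1, Or.inr fun l hl => (key l hl).1.2⟩,
    Or.inr fun l hl => (key l hl).2.1, Or.inr fun l hl => (key l hl).2.2⟩

/-- At each prime of Δ one of the two conditions, for a or for b, forces positive valuation; the
other is always satisfiable and costs nothing. -/
theorem J_eq_adicBall (hΔ : ∀ l ∈ Δ, l.Prime) (hT : T a b = adicBall Δ 0) (ha : a ≠ 0)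
    (hb : b ≠ 0) (hab : ∀ l ∈ Δ, Odd (padicValRat l a) ∨ Odd (padicValRat l b)) :
    J a b = adicBall Δ 1 := by
  ext x
  constructor
  · rintro ⟨y₁, y₂, ⟨h1, h2⟩, h3, h4⟩ l hl
    rcases hab l hl with h | h
    · have := padicNorm_add_le (hΔ l hl) (pos_padicValRat_of_mem_K hΔ hT ha h1 hl h)
        (pos_padicValRat_of_mem_K hΔ hT ha h2 hl h)
      rwa [add_sub_cancel] at this
    · have := padicNorm_add_le (hΔ l hl) (pos_padicValRat_of_mem_K hΔ hT hb h3 hl h)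
        (pos_padicValRat_of_mem_K hΔ hT hb h4 hl h)
      rwa [add_sub_cancel] at this
  · intro hx
    obtain ⟨y₁, h₁⟩ := exists_mem_K hΔ hT ha hx
    obtain ⟨y₂, h₂⟩ := exists_mem_K hΔ hT hb hx
    exact ⟨y₁, y₂, h₁, h₂⟩

end

/-! ### Change of parameters and integrality of S -/

theorem S_mul_sq_left (a b : ℚ) {w : ℚ} (hw : w ≠ 0) : S (a * w ^ 2) b = S a b := by
  ext t
  constructor
  · rintro ⟨x₁, x₂, x₃, x₄, h, rfl⟩
    exact ⟨x₁, w * x₂, x₃, w * x₄, by rw [← h]; ring, rfl⟩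
  · rintro ⟨x₁, x₂, x₃, x₄, h, rfl⟩
    exact ⟨x₁, x₂ / w, x₃, x₄ / w, by rw [← h]; field_simp, rfl⟩

theorem S_comm (a b : ℚ) : S a b = S b a := by
  ext t
  constructor <;>
  · rintro ⟨x₁, x₂, x₃, x₄, h, rfl⟩
    exact ⟨x₁, x₃, x₂, x₄, by rw [← h]; ring, rfl⟩

theorem S_mul_sq_right (a b : ℚ) {w : ℚ} (hw : w ≠ 0) : S a (b * w ^ 2) = S a b := by
  rw [S_comm, S_mul_sq_left _ _ hw, S_comm]

/-- The algebras (-cb, b) and (c, b) are isomorphic; on norm forms this exchanges the coordinates x₂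
and x₄. -/
theorem S_neg_mul (c : ℚ) {b : ℚ} (hb : b ≠ 0) : S (-(c * b)) b = S c b := by
  ext t
  constructor
  · rintro ⟨x₁, x₂, x₃, x₄, h, rfl⟩
    exact ⟨x₁, b * x₄, x₃, x₂, by rw [← h]; ring, rfl⟩
  · rintro ⟨x₁, x₂, x₃, x₄, h, rfl⟩
    exact ⟨x₁, x₄, x₃, x₂ / b, by rw [← h]; field_simp; ring, rfl⟩

theorem not_dvd_den_two_mul {l : ℕ} (hl : l.Prime) {x : ℚ} (h : ¬ l ∣ x.den) :
    ¬ l ∣ (2 * x).den := by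
  rw [← padicNorm_le_one_iff hl] at h ⊢
  exact_mod_cast padicNorm_int_mul_le hl 2 h

theorem padicValInt_eq_one_of_squarefree {l : ℕ} (hl : l.Prime) {n : ℤ} (hn : Squarefree n)
    (h : (l : ℤ) ∣ n) : padicValInt l n = 1 := by
  obtain ⟨c, rfl⟩ := h
  rw [← pow_one (l : ℤ), padicValInt_pow_mul hl 1]
  rintro ⟨d, rfl⟩
  exact (Nat.prime_iff_prime_int.1 hl).not_isUnit (hn l ⟨d, by ring⟩)

theorem jacobiSym_eq_neg_one_of_pow {l : ℕ} {u : ℤ} {n : ℕ} (hl : l.Prime) (hu : ¬ (l : ℤ) ∣ u)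
    (h : jacobiSym u l ^ n = -1) : jacobiSym u l = -1 ∧ Odd n := by
  rcases jacobiSym_eq_one_or hl hu with h1 | h1
  · rw [h1, one_pow] at h; norm_num at h
  · refine ⟨h1, ?_⟩
    by_contra hn
    rw [h1, (Nat.not_odd_iff_even.1 hn).neg_one_pow] at h
    norm_num at h

theorem not_dvd_den_of_mem_S {l : ℕ} (hl : l.Prime) {c q : ℤ} (hc : c ≠ 0) (hq : q ≠ 0)
    (hcs : Squarefree c) (hqs : Squarefree q) (h : hilb l q c = -1) {t : ℚ} (ht : t ∈ S c q) :
    ¬ l ∣ t.den := by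
  obtain ⟨x₁, x₂, x₃, x₄, hx, rfl⟩ := ht
  have hcQ : (c : ℚ) ≠ 0 := by exact_mod_cast hc
  have hqQ : (q : ℚ) ≠ 0 := by exact_mod_cast hq
  apply not_dvd_den_two_mul hl
  by_cases hlc : (l : ℤ) ∣ c
  · by_cases hlq : (l : ℤ) ∣ q
    · have hvc := padicValInt_eq_one_of_squarefree hl hcs hlc
      have hvq := padicValInt_eq_one_of_squarefree hl hqs hlq
      have ec := pow_mul_unitPart l c
      have eq := pow_mul_unitPart l q
      have nc := not_dvd_unitPart hl hc
      have nq := not_dvd_unitPart hl hq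
      have hm1 : ¬ (l : ℤ) ∣ -1 := fun h => hl.not_dvd_one (by exact_mod_cast (dvd_neg.1 h))
      rw [hilb, hvc, hvq, one_mul, pow_one, pow_one, pow_one, chi_of_not_dvd hm1, chi, chi,
        ← jacobiSym.mul_left, ← jacobiSym.mul_left] at h
      rw [hvc, pow_one] at ec
      rw [hvq, pow_one] at eq
      generalize unitPart l c = c' at *
      generalize unitPart l q = q' at *
      have hc' : c' ≠ 0 := by rintro rfl; exact nc (dvd_zero _)
      have hc'Q : (c' : ℚ) ≠ 0 := by exact_mod_cast hc'
      have ecQ : (c : ℚ) = l * c' := by exact_mod_cast ec.symm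
      have eqQ : (q : ℚ) = l * q' := by exact_mod_cast eq.symm
      -- When l divides both entries, cq = l²c'q' contributes a unit: pairing x₁ with x₄ and x₂ with
      -- x₃ gives two copies of the binary form with u = -c'q', which the symbol shows to be a
      -- nonresidue.
      refine not_dvd_den_of_norm_eq_one hl h (k := -c) (neg_ne_zero.2 hcQ) ?_
        (X := x₁) (Y := l * x₄) (Z := x₂) (W := x₃ / c') ?_
      · rw [padicValRat.neg, padicValRat.of_int, hvc]; decide
      · rw [← hx, ecQ, eqQ]; push_cast; field_simp; ring
    · rw [hilb_of_not_dvd_left hlq] at h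
      obtain ⟨h1, h2⟩ := jacobiSym_eq_neg_one_of_pow hl hlq h
      refine not_dvd_den_of_norm_eq_one hl h1 (k := -c) (neg_ne_zero.2 hcQ) ?_
        (X := x₁) (Y := x₃) (Z := x₂) (W := x₄) (by rw [← hx]; ring)
      rw [padicValRat.neg, padicValRat.of_int]
      exact_mod_cast h2
  · rw [hilb_comm, hilb_of_not_dvd_left hlc] at h
    obtain ⟨h1, h2⟩ := jacobiSym_eq_neg_one_of_pow hl hlc h
    refine not_dvd_den_of_norm_eq_one hl h1 (k := -q) (neg_ne_zero.2 hqQ) ?_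
      (X := x₁) (Y := x₂) (Z := x₃) (W := x₄) (by rw [← hx]; ring)
    rw [padicValRat.neg, padicValRat.of_int]
    exact_mod_cast h2

theorem even_or_sq (x : ℤ) : (∃ y z : ℤ, x = 2 * y ∧ x ^ 2 = 4 * y ^ 2 ∧
    (y ^ 2 = 4 * z ∨ y ^ 2 = 4 * z + 1)) ∨ ∃ z : ℤ, x ^ 2 = 8 * z + 1 := by
  rcases Int.even_or_odd' x with ⟨y, rfl | rfl⟩
  · left
    rcases Int.even_or_odd' y with ⟨z, rfl | rfl⟩
    · exact ⟨2 * z, z ^ 2, rfl, by ring, Or.inl (by ring)⟩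
    · exact ⟨2 * z + 1, z ^ 2 + z, rfl, by ring, Or.inr (by ring)⟩
  · right
    have h := mul_self_emod_eight (x := 2 * y + 1) (by omega)
    exact ⟨(2 * y + 1) ^ 2 / 8, by omega⟩

/-- The norm form of (2P, Q) is anisotropic over ℚ₂, and this is already visible modulo 16 by
running through the parities of the coordinates. -/
theorem even_of_two_adic_form {P Q : ℤ} (hP : P % 8 = 1) (hQ : Q % 8 = 3) {x y z w m : ℤ}
    (h : x ^ 2 - 2 * P * y ^ 2 - Q * z ^ 2 + 2 * P * Q * w ^ 2 = 16 * m) :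
    2 ∣ x ∧ 2 ∣ y ∧ 2 ∣ z ∧ 2 ∣ w := by
  obtain ⟨p, rfl⟩ : ∃ p, P = 8 * p + 1 := ⟨P / 8, by omega⟩
  obtain ⟨q, rfl⟩ : ∃ q, Q = 8 * q + 3 := ⟨Q / 8, by omega⟩
  have h' : x ^ 2 - 2 * y ^ 2 - 3 * z ^ 2 - 8 * (q * z ^ 2) + 6 * w ^ 2 =
      16 * (m + p * y ^ 2 - (8 * p * q + q + 3 * p) * w ^ 2) := by linear_combination h
  generalize m + p * y ^ 2 - (8 * p * q + q + 3 * p) * w ^ 2 = N at h'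
  rcases even_or_sq z with ⟨z₁, z₂, rfl, hz, hz'⟩ | ⟨z₂, hz⟩
  · have e : q * (2 * z₁) ^ 2 = 4 * (q * z₁ ^ 2) := by ring
    rw [e] at h'
    generalize q * z₁ ^ 2 = r at h'
    rcases even_or_sq x with ⟨x₁, x₂, rfl, hx, hx'⟩ | ⟨x₂, hx⟩
    · rcases even_or_sq y with ⟨y₁, y₂, rfl, hy, hy'⟩ | ⟨y₂, hy⟩
      · rcases even_or_sq w with ⟨w₁, w₂, rfl, hw, hw'⟩ | ⟨w₂, hw⟩
        · exact ⟨dvd_mul_right _ _, dvd_mul_right _ _, dvd_mul_right _ _, dvd_mul_right _ _⟩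
        · exfalso; omega
      · rcases even_or_sq w with ⟨w₁, w₂, rfl, hw, hw'⟩ | ⟨w₂, hw⟩ <;> exfalso <;> omega
    · exfalso; clear h
      rcases even_or_sq y with ⟨y₁, y₂, rfl, hy, hy'⟩ | ⟨y₂, hy⟩ <;>
      rcases even_or_sq w with ⟨w₁, w₂, rfl, hw, hw'⟩ | ⟨w₂, hw⟩ <;> omega
  · exfalso; clear h
    generalize q * z ^ 2 = r at h'
    rcases even_or_sq x with ⟨x₁, x₂, rfl, hx, hx'⟩ | ⟨x₂, hx⟩ <;>
    rcases even_or_sq y with ⟨y₁, y₂, rfl, hy, hy'⟩ | ⟨y₂, hy⟩ <;>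
    rcases even_or_sq w with ⟨w₁, w₂, rfl, hw, hw'⟩ | ⟨w₂, hw⟩ <;> omega

/-- If 4 divides M then 16 divides M², so all coordinates are even and can be halved along with M. A
single factor 2 may remain, which the trace 2x₁ absorbs. -/
theorem exists_reduced_denominator {P Q : ℤ} (hP : P % 8 = 1) (hQ : Q % 8 = 3) (M : ℕ) :
    ∀ x y z w : ℤ, 0 < M →
      x ^ 2 - 2 * P * y ^ 2 - Q * z ^ 2 + 2 * P * Q * w ^ 2 = (M : ℤ) ^ 2 →
      ∃ (x' : ℤ) (M' : ℕ), (x / M : ℚ) = x' / M' ∧ 0 < M' ∧ ¬ 4 ∣ M' := by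
  induction M using Nat.strong_induction_on with
  | _ M ih =>
    intro x y z w hM h
    by_cases h4 : 4 ∣ M
    · obtain ⟨k, rfl⟩ := h4
      obtain ⟨⟨x₁, rfl⟩, ⟨y₁, rfl⟩, ⟨z₁, rfl⟩, w₁, rfl⟩ :=
        even_of_two_adic_form hP hQ (m := k ^ 2) (by rw [h]; push_cast; ring)
      obtain ⟨x', M', e, h1, h2⟩ := ih (2 * k) (by omega) x₁ y₁ z₁ w₁ (by omega) (by
        push_cast at h ⊢
        linarith)
      refine ⟨x', M', ?_, h1, h2⟩
      rw [← e]
      have : (k : ℚ) ≠ 0 := by exact_mod_cast (by omega : k ≠ 0)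
      push_cast
      field_simp
      ring
    · exact ⟨x, M, rfl, hM, h4⟩

theorem exists_common_denominator (x y z w : ℚ) : ∃ (x' y' z' w' : ℤ) (M : ℕ), 0 < M ∧
    x = x' / M ∧ y = y' / M ∧ z = z' / M ∧ w = w' / M := by
  have hx := x.den_pos
  have hy := y.den_pos
  have hz := z.den_pos
  have hw := w.den_pos
  have ex := Rat.num_div_den x
  have ey := Rat.num_div_den y
  have ez := Rat.num_div_den z
  have ew := Rat.num_div_den w
  have hx' : (x.den : ℚ) ≠ 0 := by exact_mod_cast hx.ne'
  have hy' : (y.den : ℚ) ≠ 0 := by exact_mod_cast hy.ne'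
  have hz' : (z.den : ℚ) ≠ 0 := by exact_mod_cast hz.ne'
  have hw' : (w.den : ℚ) ≠ 0 := by exact_mod_cast hw.ne'
  refine ⟨x.num * y.den * z.den * w.den, y.num * x.den * z.den * w.den,
    z.num * x.den * y.den * w.den, w.num * x.den * y.den * z.den,
    x.den * y.den * z.den * w.den, by positivity, ?_, ?_, ?_, ?_⟩
  · nth_rw 1 [← ex]; push_cast; field_simp
  · nth_rw 1 [← ey]; push_cast; field_simp
  · nth_rw 1 [← ez]; push_cast; field_simp
  · nth_rw 1 [← ew]; push_cast; field_simp

theorem not_two_dvd_den_of_mem_S {P Q : ℤ} (hP : P % 8 = 1) (hQ : Q % 8 = 3) {t : ℚ}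
    (ht : t ∈ S ((2 * P : ℤ) : ℚ) Q) : ¬ 2 ∣ t.den := by
  obtain ⟨x, y, z, w, h, rfl⟩ := ht
  obtain ⟨x', y', z', w', M, hM, rfl, rfl, rfl, rfl⟩ := exists_common_denominator x y z w
  have hMQ : (M : ℚ) ≠ 0 := by exact_mod_cast hM.ne'
  have hZ : x' ^ 2 - 2 * P * y' ^ 2 - Q * z' ^ 2 + 2 * P * Q * w' ^ 2 = (M : ℤ) ^ 2 := by
    push_cast at h
    field_simp at h
    have : (x' ^ 2 - 2 * P * y' ^ 2 - Q * z' ^ 2 + 2 * P * Q * w' ^ 2 : ℚ) = (M : ℚ) ^ 2 := by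
      linear_combination h
    exact_mod_cast this
  obtain ⟨X, N, e, hN, h4⟩ := exists_reduced_denominator hP hQ M x' y' z' w' hM hZ
  rw [e]
  have h2 := Fact.mk Nat.prime_two
  have hint : ∀ n : ℤ, padicNorm 2 n ≤ 1 := fun n => padicNorm.of_int n
  rw [← padicNorm_le_one_iff Nat.prime_two]
  by_cases hN2 : 2 ∣ N
  · obtain ⟨k, rfl⟩ := hN2
    have hk : ¬ 2 ∣ k := fun ⟨j, hj⟩ => h4 ⟨j, by rw [hj]; ring⟩
    have hk0 : (k : ℚ) ≠ 0 := by exact_mod_cast (by omega : k ≠ 0)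
    have : 2 * (X / ((2 * k : ℕ) : ℚ)) = X / k := by push_cast; field_simp
    rw [this, padicNorm.div, (padicNorm.nat_eq_one_iff _).2 hk, div_one]
    exact hint X
  · have := padicNorm_int_mul_le Nat.prime_two 2 (x := X / N) (B := 1) (by
      rw [padicNorm.div, (padicNorm.nat_eq_one_iff _).2 hN2, div_one]
      exact hint X)
    exact_mod_cast this

theorem T_subset_adicBall {a b : ℚ} {Δ : Finset ℕ} (hΔ : ∀ l ∈ Δ, l.Prime)
    (h : ∀ t ∈ S a b, ∀ l ∈ Δ, ¬ l ∣ t.den) : T a b ⊆ adicBall Δ 0 := by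
  intro t ht
  obtain ⟨s, hs, s', hs', rfl⟩ := Set.mem_add.1 ht
  exact (semilocalRing Δ hΔ).add_mem ((mem_adicBall_zero_iff hΔ).2 (h s hs))
    ((mem_adicBall_zero_iff hΔ).2 (h s' hs'))

/-! ### Arithmetic of Φ and Ψ -/

/-- The odd primes at which the quaternion algebra `(q, c)` is ramified. -/
def oddRamified (q c : ℤ) : Finset ℕ :=
  (oddPrimeFactors (q * c)).filter fun l => hilb l q c = -1

theorem prime_of_mem_oddRamified {q c : ℤ} (hqc : q * c ≠ 0) {l : ℕ} (hl : l ∈ oddRamified q c) :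
    l.Prime :=
  ((mem_oddPrimeFactors hqc).1 (Finset.mem_filter.1 hl).1).2.1

theorem odd_padicValInt_two_of_odd {P : ℤ} (hP : P % 2 = 1) (s : ℤ) (hs : s = 1 ∨ s = -1) :
    Odd (padicValInt 2 (s * (2 * P))) := by
  have : s * (2 * P) = ((2 : ℕ) : ℤ) ^ 1 * (s * P) := by push_cast; ring
  rw [this, padicValInt_pow_mul Nat.prime_two 1]
  · exact odd_one
  · rcases hs with rfl | rfl <;> push_cast <;> omega

theorem mod_eight_of_prime_factors {k : ℕ} (hk : k = 1 ∨ k = 3) (n : ℕ) (hn : n ≠ 0)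
    (h : ∀ l : ℕ, l.Prime → l ∣ n → l % 8 = 1 ∨ l % 8 = k) : n % 8 = 1 ∨ n % 8 = k := by
  induction n using induction_on_primes with
  | zero => exact absurd rfl hn
  | one => exact Or.inl rfl
  | prime_mul p n hp ih =>
    have h1 := h p hp (dvd_mul_right p n)
    have h2 := ih (right_ne_zero_of_mul hn) fun l hl hd => h l hl (hd.mul_left p)
    rw [Nat.mul_mod]
    rcases hk with rfl | rfl <;> rcases h1 with h1 | h1 <;> rcases h2 with h2 | h2 <;>
      simp [h1, h2]

/-- Elements of `Φ k` are, up to a square, squarefree positive integers of the expected shape. -/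
theorem exists_squarefree_of_mem_Φ {k : ℕ} (hk : k = 1 ∨ k = 3) {p : ℚ} (hp : p ∈ Φ k) :
    ∃ (P : ℕ) (w : ℚ), w ≠ 0 ∧ p = (P : ℤ) * w ^ 2 ∧ Squarefree P ∧ P % 8 = k ∧
      ∀ l : ℕ, l.Prime → l ∣ P → l % 8 = 1 ∨ l % 8 = k := by
  obtain ⟨hp0, ⟨z, hz, hpz⟩, hodd⟩ := hp
  have hden : (p.den : ℚ) ≠ 0 := by exact_mod_cast p.den_nz
  obtain ⟨m, j, hmj, hsm, hm0, hj0⟩ := exists_sq_mul_squarefree_int (n := p.num * p.den)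
    (mul_ne_zero (Rat.num_ne_zero.2 hp0) (by exact_mod_cast p.den_nz))
  have hpm : p = m * (j / p.den) ^ 2 := by
    have h1 : (p.num : ℚ) * p.den = m * j ^ 2 := by exact_mod_cast hmj
    have h2 : p * p.den = p.num := Rat.mul_den_eq_num _
    field_simp
    rw [← h1, ← h2]; ring
  have hw : (j / p.den : ℚ) ≠ 0 := div_ne_zero (by exact_mod_cast hj0) hden
  generalize (j / p.den : ℚ) = w at *
  have hprimes : ∀ l : ℕ, l.Prime → l ∣ m.natAbs → l % 8 = 1 ∨ l % 8 = k := by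
    intro l hl hlm
    have := Fact.mk hl
    have h1 : Odd (padicValRat l p) := by
      rw [hpm, padicValRat.mul (by exact_mod_cast hm0) (pow_ne_zero 2 hw), padicValRat.pow,
        padicValRat.of_int, padicValInt_eq_one_of_squarefree hl hsm (Int.natCast_dvd.2 hlm)]
      exact ⟨padicValRat l w, by push_cast; ring⟩
    have h2 := hodd l ⟨hl, h1⟩
    have hk8 : k % 8 = k := by omega
    unfold Nat.ModEq at h2
    rwa [hk8] at h2
  have hm8 := mod_eight_of_prime_factors hk m.natAbs (Int.natAbs_ne_zero.2 hm0) hprimes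
  have hmk : m % 8 = k := by
    have h1 : m * w.num ^ 2 * z.den = (k * z.den + 8 * z.num) * w.den ^ 2 := by
      have hzd : (z.den : ℚ) ≠ 0 := by exact_mod_cast z.den_nz
      have hwd : (w.den : ℚ) ≠ 0 := by exact_mod_cast w.den_nz
      have e1 : w * w.den = w.num := Rat.mul_den_eq_num _
      have e2 : z * z.den = z.num := Rat.mul_den_eq_num _
      have : (m * w.num ^ 2 * z.den : ℚ) = (k * z.den + 8 * z.num) * w.den ^ 2 := by
        rw [← e1, ← e2]
        linear_combination (w.den ^ 2 * z.den : ℚ) * (hpz - hpm)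
      exact_mod_cast this
    have hzd : (z.den : ℤ) % 2 = 1 := by
      have : ¬ 2 ∣ z.den := hz
      omega
    have hm2 : m % 2 = 1 := by omega
    have hred := w.reduced
    have hnd : ¬ (2 ∣ w.num ∧ (2 : ℤ) ∣ w.den) := fun ⟨ha, hb⟩ => by
      have := Nat.dvd_gcd (Int.natCast_dvd.1 (by exact_mod_cast ha : ((2 : ℕ) : ℤ) ∣ w.num))
        (by exact_mod_cast hb : 2 ∣ w.den)
      rw [hred] at this
      omega
    have hpar := congrArg (· % 2) h1
    have hk2 : (k : ℤ) % 2 = 1 := by omega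
    have hwn : w.num % 2 = 1 := by
      by_contra hcon
      have hn0 : w.num % 2 = 0 := by omega
      have hd1 : (w.den : ℤ) % 2 = 1 := by omega
      have e1 : (k * (z.den : ℤ) + 8 * z.num) % 2 = 1 := by
        have : (k * (z.den : ℤ)) % 2 = 1 := by rw [Int.mul_emod, hk2, hzd]; rfl
        omega
      simp [Int.mul_emod, sq, hn0, hd1, e1] at hpar
    have hwd : (w.den : ℤ) % 2 = 1 := by
      by_contra hcon
      have hd0 : (w.den : ℤ) % 2 = 0 := by omega
      simp [Int.mul_emod, sq, hwn, hd0, hzd, hm2] at hpar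
    have h8n := mul_self_emod_eight hwn
    have h8d := mul_self_emod_eight hwd
    obtain ⟨a, ha⟩ : ∃ a, w.num ^ 2 = 8 * a + 1 := ⟨w.num ^ 2 / 8, by omega⟩
    obtain ⟨b, hb⟩ : ∃ b, (w.den : ℤ) ^ 2 = 8 * b + 1 := ⟨(w.den : ℤ) ^ 2 / 8, by omega⟩
    rw [ha, hb] at h1
    have h2 : (8 : ℤ) ∣ z.den * (m - k) :=
      ⟨k * z.den * b + z.num * (8 * b + 1) - m * a * z.den, by linear_combination h1⟩
    have hc : IsCoprime (8 : ℤ) z.den := by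
      have := (Int.prime_two.coprime_iff_not_dvd.2
        (by omega : ¬ (2 : ℤ) ∣ z.den)).pow_left (m := 3)
      norm_num at this; exact this
    have h3 := hc.dvd_of_dvd_mul_left h2
    omega
  -- The sign is forced: |m| is 1 or k mod 8, whereas -k is 7 or 5.
  have hpos : m = m.natAbs := by omega
  refine ⟨m.natAbs, w, hw, by rw [← hpos]; exact hpm, Int.squarefree_natAbs.2 hsm, by omega,
    hprimes⟩

/-- Only the inclusion of R in ℤ_(l) matters, so R_q^{[3]} need not be determined exactly, nor even
be known to be a ring. -/
theorem jacobsonRadical_dvd_num {R : Set ℚ} {l : ℕ} (hl : l.Prime) (hR : R ⊆ adicBall {l} 0)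
    {j : ℚ} (hj : j ∈ jacobsonRadical R) : (l : ℤ) ∣ j.num ∧ ¬ l ∣ j.den := by
  have hΔ : ∀ k ∈ ({l} : Finset ℕ), k.Prime := fun k hk => Finset.mem_singleton.1 hk ▸ hl
  have hle : Subring.closure R ≤ semilocalRing {l} hΔ := Subring.closure_le.2 hR
  have hA : ∀ x ∈ Subring.closure R, ¬ l ∣ x.den := fun x hx =>
    (mem_adicBall_zero_iff hΔ).1 (hle hx) l (Finset.mem_singleton_self l)
  obtain ⟨x, hx, rfl⟩ := hj
  exact ⟨dvd_num_of_mem_jacobson hl hA hx, hA _ x.2⟩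

/-- For l ≡ 3 mod 8 both -1 and 2 are nonresidues, so (-q, -q) and (2q, -q) both ramify at l. -/
theorem R3_subset_adicBall {l : ℕ} (hl : l.Prime) (hl8 : l % 8 = 3) {q : ℚ} (hq : q ≠ 0)
    (hv : Odd (padicValRat l q)) : R3 q ⊆ adicBall {l} 0 := by
  have hΔ : ∀ k ∈ ({l} : Finset ℕ), k.Prime := fun k hk => Finset.mem_singleton.1 hk ▸ hl
  have hlo : Odd l := Nat.odd_iff.2 (by omega)
  have h1 : jacobiSym (-1) l = -1 := by
    rw [jacobiSym.at_neg_one hlo, ZMod.χ₄_nat_three_mod_four (by omega)]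
  have h2 : jacobiSym 2 l = -1 := by
    rw [jacobiSym.at_two hlo, ZMod.χ₈_nat_mod_eight, hl8]; decide
  intro t ht
  obtain ⟨s, hs, s', hs', rfl⟩ := Set.mem_add.1 ht
  refine (semilocalRing {l} hΔ).add_mem (T_subset_adicBall hΔ ?_ hs)
    (T_subset_adicBall hΔ ?_ hs')
  · rintro t ⟨x₁, x₂, x₃, x₄, h, rfl⟩ k hk
    rw [Finset.mem_singleton.1 hk]
    exact not_dvd_den_two_mul hl (not_dvd_den_of_norm_eq_one hl h1 hq hv
      (X := x₁) (Y := q * x₄) (Z := x₂) (W := x₃) (by rw [← h]; push_cast; ring))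
  · rintro t ⟨x₁, x₂, x₃, x₄, h, rfl⟩ k hk
    rw [Finset.mem_singleton.1 hk]
    exact not_dvd_den_two_mul hl (not_dvd_den_of_norm_eq_one hl h2 hq hv
      (X := x₁) (Y := q * x₄) (Z := x₃) (W := x₂) (by rw [← h]; push_cast; ring))

/-- 1 + j ≡ 1 mod l, so n is a nonzero square modulo l once denominators are cleared. -/
theorem jacobiSym_eq_one_of_eq_sq_mul {l : ℕ} (hl : l.Prime) {n : ℤ} (hn : ¬ (l : ℤ) ∣ n)
    {r j : ℚ} (hj : (l : ℤ) ∣ j.num) (hjd : ¬ l ∣ j.den) (h : (n : ℚ) = r ^ 2 * (1 + j)) :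
    jacobiSym n l = 1 := by
  have hl' := Nat.prime_iff_prime_int.1 hl
  have hjdZ : ¬ (l : ℤ) ∣ j.den := by exact_mod_cast hjd
  have h1 : n * r.den ^ 2 * j.den = r.num ^ 2 * (j.den + j.num) := by
    have e1 : r * r.den = r.num := Rat.mul_den_eq_num _
    have e2 : j * j.den = j.num := Rat.mul_den_eq_num _
    have : (n * r.den ^ 2 * j.den : ℚ) = r.num ^ 2 * (j.den + j.num) := by
      rw [h, ← e1, ← e2]; ring
    exact_mod_cast this
  have hs : ¬ (l : ℤ) ∣ j.den + j.num := fun h => hjdZ ((dvd_add_left hj).1 h)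
  have hrd : ¬ (l : ℤ) ∣ r.den := fun hd => by
    have h2 : (l : ℤ) ∣ r.num ^ 2 * (j.den + j.num) := by
      rw [← h1]
      exact ((dvd_pow hd two_ne_zero).mul_left n).mul_right _
    have h3 := hl'.dvd_of_dvd_pow ((hl'.dvd_or_dvd h2).resolve_right hs)
    have := Nat.dvd_gcd (Int.natCast_dvd.1 h3) (by exact_mod_cast hd : l ∣ r.den)
    rw [r.reduced] at this
    exact hl.not_dvd_one this
  have hrn : ¬ (l : ℤ) ∣ r.num := fun hd => by
    have h2 : (l : ℤ) ∣ n * r.den ^ 2 * j.den := by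
      rw [h1]; exact (dvd_pow hd two_ne_zero).mul_right _
    rcases hl'.dvd_or_dvd h2 with h | h
    · rcases hl'.dvd_or_dvd h with h | h
      · exact hn h
      · exact hrd (hl'.dvd_of_dvd_pow h)
    · exact hjdZ h
  have h2 := congrArg (fun x => jacobiSym x l) h1
  simp only [jacobiSym.mul_left] at h2
  have h3 : jacobiSym (j.den + j.num) l = jacobiSym j.den l :=
    jacobiSym_congr (by simpa using hj)
  rw [jacobiSym_sq hl hrd, jacobiSym_sq hl hrn, h3, mul_one, one_mul] at h2
  rcases jacobiSym_eq_one_or hl hjdZ with h | h <;> rw [h] at h2 <;> linarith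

/-! ### The two rings T_{±2pq,q} and their sum -/

section Main

variable {P Q : ℕ}

/-- The factors (Q, s), (Q, 2) and (P, Q) have products s, χ₈(3) = -1 and 1. Hence 2 ramifies in
(2P, Q) but not in (-2P, Q). -/
theorem prod_hilb_two_mul (hP8 : P % 8 = 1) (hQ8 : Q % 8 = 3) (s : ℤ) (hs : s = 1 ∨ s = -1) :
    ∏ l ∈ oddPrimeFactors (Q * (s * (2 * P))), hilb l Q (s * (2 * P)) = -s := by
  have hP0 : (P : ℤ) ≠ 0 := by omega
  have hQ0 : (Q : ℤ) ≠ 0 := by omega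
  have hs0 : s ≠ 0 := by rcases hs with rfl | rfl <;> norm_num
  have hne : (Q : ℤ) * (s * (2 * P)) ≠ 0 :=
    mul_ne_zero hQ0 (mul_ne_zero hs0 (mul_ne_zero two_ne_zero hP0))
  have hmem := @mem_oddPrimeFactors _ hne
  have hF : ∀ l ∈ oddPrimeFactors (Q * (s * (2 * P))), l.Prime ∧ l ≠ 2 := fun l hl =>
    ⟨(hmem.1 hl).2.1, (hmem.1 hl).1⟩
  have hFQ : ∀ l : ℕ, l.Prime → l ∣ Q → l ∈ oddPrimeFactors (Q * (s * (2 * P))) :=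
    fun l hl h => hmem.2 ⟨by rintro rfl; omega, hl, (Int.natCast_dvd_natCast.2 h).mul_right _⟩
  have hFP : ∀ l : ℕ, l.Prime → l ∣ P → l ∈ oddPrimeFactors (Q * (s * (2 * P))) :=
    fun l hl h => hmem.2 ⟨by rintro rfl; omega, hl,
      (((Int.natCast_dvd_natCast.2 h).mul_left 2).mul_left s).mul_left _⟩
  have hQodd : Odd Q := Nat.odd_iff.2 (by omega)
  have e : ∀ l ∈ oddPrimeFactors (Q * (s * (2 * P))), hilb l Q (s * (2 * P)) =
      hilb l Q s * (hilb l Q 2 * hilb l P Q) := fun l hl => by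
    have hlp := (hF l hl).1
    rw [hilb_mul_right hlp hs0 (mul_ne_zero two_ne_zero hP0),
      hilb_mul_right hlp two_ne_zero hP0, hilb_comm l P]
  have h1 : ∏ l ∈ oddPrimeFactors (Q * (s * (2 * P))), hilb l P Q = 1 := by
    rw [prod_hilb hF (by omega) hFP hQ0 fun l hl h2 h => hFQ l hl (by exact_mod_cast h),
      χ₈_of_mod_eq_one hP8, one_pow]
  have h2 : ∏ l ∈ oddPrimeFactors (Q * (s * (2 * P))), hilb l Q 2 = -1 := by
    rw [prod_hilb_two hF hQodd hFQ, ZMod.χ₈_nat_mod_eight, hQ8]; decide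
  have h3 : ∏ l ∈ oddPrimeFactors (Q * (s * (2 * P))), hilb l Q s = s := by
    rcases hs with rfl | rfl
    · exact Finset.prod_eq_one fun l hl => by
        rw [hilb_comm, hilb_of_not_dvd_left, jacobiSym.one_left, one_pow]
        exact fun h => (hF l hl).1.not_dvd_one (by exact_mod_cast h)
    · rw [prod_hilb_neg_one hF hQodd hFQ, ZMod.χ₄_nat_three_mod_four (by omega)]
  rw [Finset.prod_congr rfl e, Finset.prod_mul_distrib, Finset.prod_mul_distrib, h1, h2, h3]
  ring

theorem not_dvd_den_of_mem_S_of_oddRamified (hP8 : P % 8 = 1) (hQ8 : Q % 8 = 3)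
    (hPs : Squarefree P) (hQs : Squarefree Q) (s : ℤ) (hs : s = 1 ∨ s = -1) :
    ∀ t ∈ S ((s * (2 * P) : ℤ) : ℚ) (Q : ℤ), ∀ l ∈ oddRamified Q (s * (2 * P)), ¬ l ∣ t.den := by
  intro t ht l hl
  have hP0 : (P : ℤ) ≠ 0 := by omega
  have hQ0 : (Q : ℤ) ≠ 0 := by omega
  have hs0 : s ≠ 0 := by rcases hs with rfl | rfl <;> norm_num
  have hc := mul_ne_zero hs0 (mul_ne_zero (two_ne_zero (α := ℤ)) hP0)
  refine not_dvd_den_of_mem_S (prime_of_mem_oddRamified (mul_ne_zero hQ0 hc) hl) hc hQ0 ?_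
    (Int.squarefree_natCast.2 hQs) (Finset.mem_filter.1 hl).2 ht
  have h2P : Squarefree (2 * P) := by
    rw [Nat.squarefree_mul_iff]
    refine ⟨(Nat.coprime_two_left (n := P)).2 (Nat.odd_iff.2 (by omega)), Nat.prime_two.squarefree, hPs⟩
  rcases hs with rfl | rfl
  · rw [one_mul]; exact_mod_cast Int.squarefree_natCast.2 h2P
  · rw [neg_one_mul, ← Int.squarefree_natAbs, Int.natAbs_neg]
    exact_mod_cast h2P

end Main

section Main

variable {P Q : ℕ}

theorem T_neg_two_mul (hP8 : P % 8 = 1) (hQ8 : Q % 8 = 3) (hPs : Squarefree P)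
    (hQs : Squarefree Q) :
    T ((-1 * (2 * P) : ℤ) : ℚ) (Q : ℤ) = adicBall (oddRamified Q (-1 * (2 * P))) 0 := by
  have hP0 : (P : ℤ) ≠ 0 := by omega
  have hQ0 : (Q : ℤ) ≠ 0 := by omega
  have hc := mul_ne_zero (by norm_num : (-1 : ℤ) ≠ 0) (mul_ne_zero (two_ne_zero (α := ℤ)) hP0)
  have hΔ := fun l => prime_of_mem_oddRamified (mul_ne_zero hQ0 hc) (l := l)
  refine subset_antisymm (T_subset_adicBall hΔ
    (not_dvd_den_of_mem_S_of_oddRamified hP8 hQ8 hPs hQs (-1) (Or.inr rfl))) fun t ht => ?_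
  rw [mem_adicBall_zero_iff hΔ] at ht
  exact mem_T_of_prod_eq_one hc (odd_padicValInt_two_of_odd (by omega) (-1) (Or.inr rfl))
    (by omega) (by rw [prod_hilb_two_mul hP8 hQ8 (-1) (Or.inr rfl), neg_neg])
    fun l hl h => ht l (Finset.mem_filter.2 ⟨hl, h⟩)

theorem T_two_mul (hP8 : P % 8 = 1) (hQ8 : Q % 8 = 3) (hPs : Squarefree P)
    (hQs : Squarefree Q) :
    T ((1 * (2 * P) : ℤ) : ℚ) (Q : ℤ) = adicBall (insert 2 (oddRamified Q (1 * (2 * P)))) 0 := by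
  have hP0 : (P : ℤ) ≠ 0 := by omega
  have hQ0 : (Q : ℤ) ≠ 0 := by omega
  have hc := mul_ne_zero (one_ne_zero (α := ℤ)) (mul_ne_zero (two_ne_zero (α := ℤ)) hP0)
  have hΔ : ∀ l ∈ insert 2 (oddRamified Q (1 * (2 * P))), l.Prime := fun l hl =>
    (Finset.mem_insert.1 hl).elim (fun h => h ▸ Nat.prime_two)
      (prime_of_mem_oddRamified (mul_ne_zero hQ0 hc))
  refine subset_antisymm (T_subset_adicBall hΔ fun t ht l hl => ?_) fun t ht => ?_
  · rcases Finset.mem_insert.1 hl with rfl | hl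
    · exact not_two_dvd_den_of_mem_S (P := P) (Q := Q) (by omega) (by omega)
        (by rwa [one_mul] at ht)
    · exact not_dvd_den_of_mem_S_of_oddRamified hP8 hQ8 hPs hQs 1 (Or.inl rfl) t ht l hl
  · rw [mem_adicBall_zero_iff hΔ] at ht
    exact mem_T_of_prod_eq_neg_one hc (odd_padicValInt_two_of_odd (by omega) 1 (Or.inl rfl))
      (by omega) (prod_hilb_two_mul hP8 hQ8 1 (Or.inl rfl)) (ht 2 (Finset.mem_insert_self _ _))
      fun l hl h => ht l (Finset.mem_insert_of_mem (Finset.mem_filter.2 ⟨hl, h⟩))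

theorem T_eq_of_eq_mul_sq {p q w v : ℚ} (hQ0 : Q ≠ 0) (hw : w ≠ 0) (hv : v ≠ 0)
    (hp : p = (P : ℤ) * w ^ 2) (hq : q = (Q : ℤ) * v ^ 2) (s : ℤ) :
    T (-s * (2 * p * q)) q = T ((s * (2 * P) : ℤ) : ℚ) (Q : ℤ) := by
  have hQQ : ((Q : ℤ) : ℚ) ≠ 0 := by exact_mod_cast hQ0
  have e : -s * (2 * p * q) = -(((s * (2 * P) : ℤ) : ℚ) * (Q : ℤ)) * (w * v) ^ 2 := by
    rw [hp, hq]; push_cast; ring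
  unfold T
  rw [e, S_mul_sq_left _ _ (mul_ne_zero hw hv), hq, S_mul_sq_right _ _ hv, S_neg_mul _ hQQ]

theorem odd_padicValRat_mul_sq {l : ℕ} (hl : l.Prime) {n w : ℚ} (hn : n ≠ 0) (hw : w ≠ 0)
    (h : Odd (padicValRat l n)) : Odd (padicValRat l (n * w ^ 2)) := by
  have := Fact.mk hl
  rw [padicValRat.mul hn (pow_ne_zero 2 hw), padicValRat.pow]
  exact h.add_even ⟨padicValRat l w, by push_cast; ring⟩

theorem odd_padicValRat_of_dvd {l : ℕ} (hl : l.Prime) {p q w v : ℚ} (hPs : Squarefree P)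
    (hQs : Squarefree Q) (hw : w ≠ 0) (hv : v ≠ 0) (hp : p = (P : ℤ) * w ^ 2)
    (hq : q = (Q : ℤ) * v ^ 2) (hQodd : Q % 2 = 1) (hPodd : P % 2 = 1)
    (h : l = 2 ∨ l ∣ P ∨ l ∣ Q) (s : ℚ) (hs : s = 1 ∨ s = -1) :
    Odd (padicValRat l (s * (2 * p * q))) ∨ Odd (padicValRat l q) := by
  have hf := Fact.mk hl
  have hs' : padicValRat l (s * (2 * p * q)) = padicValRat l (2 * p * q) := by
    rcases hs with rfl | rfl
    · rw [one_mul]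
    · rw [neg_one_mul, padicValRat.neg]
  have hP0 : P ≠ 0 := by omega
  have hQ0 : Q ≠ 0 := by omega
  rw [hs']
  by_cases hlQ : l ∣ Q
  · right
    rw [hq]
    refine odd_padicValRat_mul_sq hl (by exact_mod_cast hQ0) hv ?_
    rw [padicValRat.of_int, padicValInt_eq_one_of_squarefree hl (Int.squarefree_natCast.2 hQs)
      (Int.natCast_dvd_natCast.2 hlQ)]
    decide
  · left
    have e : 2 * p * q = ((2 * P * Q : ℤ) : ℚ) * (w * v) ^ 2 := by
      rw [hp, hq]; push_cast; ring
    rw [e]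
    refine odd_padicValRat_mul_sq hl
      (by exact_mod_cast mul_ne_zero (mul_ne_zero two_ne_zero hP0) hQ0) (mul_ne_zero hw hv) ?_
    rw [padicValRat.of_int]
    have hv : padicValInt l (2 * P * Q) = 1 := by
      rw [padicValInt.mul (by omega) (by omega), padicValInt.mul (by omega) (by omega),
        padicValInt.eq_zero_of_not_dvd (by exact_mod_cast hlQ : ¬ (l : ℤ) ∣ Q)]
      by_cases hlP : l ∣ P
      · have h2 : l ≠ 2 := by rintro rfl; omega
        rw [padicValInt_eq_one_of_squarefree hl (Int.squarefree_natCast.2 hPs)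
          (Int.natCast_dvd_natCast.2 hlP), padicValInt.eq_zero_of_not_dvd (not_dvd_two hl h2)]
      · have h2 : l = 2 := by tauto
        subst h2
        rw [padicValInt.eq_zero_of_not_dvd (by exact_mod_cast hlP : ¬ ((2 : ℕ) : ℤ) ∣ P)]
        have := padicValInt_self (p := 2)
        push_cast at this
        omega
    rw [hv]; decide

theorem mem_oddRamified_dvd {s : ℤ} (hs : s = 1 ∨ s = -1) (hP0 : P ≠ 0) (hQ0 : Q ≠ 0) {l : ℕ}
    (hl : l ∈ oddRamified Q (s * (2 * P))) : l.Prime ∧ l ≠ 2 ∧ (l ∣ P ∨ l ∣ Q) := by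
  have hs0 : s ≠ 0 := by rcases hs with rfl | rfl <;> norm_num
  have h := (mem_oddPrimeFactors (mul_ne_zero (Int.natCast_ne_zero.2 hQ0) (mul_ne_zero hs0
    (mul_ne_zero two_ne_zero (Int.natCast_ne_zero.2 hP0))))).1 (Finset.mem_filter.1 hl).1
  have hl' := Nat.prime_iff_prime_int.1 h.2.1
  refine ⟨h.2.1, h.1, ?_⟩
  rcases hl'.dvd_or_dvd h.2.2 with h1 | h1
  · exact Or.inr (by exact_mod_cast h1)
  rcases hl'.dvd_or_dvd h1 with h1 | h1
  · exfalso
    rcases hs with rfl | rfl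
    · exact h.2.1.not_dvd_one (by exact_mod_cast h1)
    · exact h.2.1.not_dvd_one (by exact_mod_cast (dvd_neg.1 h1))
  rcases hl'.dvd_or_dvd h1 with h1 | h1
  · exact absurd h1 (not_dvd_two h.2.1 h.1)
  · exact Or.inl (by exact_mod_cast h1)

end Main

/-- The structure of `R1 p q` for `(p, q) ∈ Ψ`. -/
theorem exists_adicBall_of_mem_Ψ {p q : ℚ} (h : (p, q) ∈ Ψ) :
    ∃ Δ : Finset ℕ, (∀ l ∈ Δ, l.Prime) ∧ Δ.Nonempty ∧ R1 p q = adicBall Δ 0 ∧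
      J (2 * p * q) q + J (-2 * p * q) q = adicBall Δ 1 := by
  obtain ⟨hpΦ, hqΦ, u, hu, j, hj, hpj⟩ := h
  dsimp only at hpΦ hqΦ hj hpj
  obtain ⟨P, w, hw, hp, hPs, hP8, hPl⟩ := exists_squarefree_of_mem_Φ (Or.inl rfl) hpΦ
  obtain ⟨Q, v, hv, hq, hQs, hQ8, hQl⟩ := exists_squarefree_of_mem_Φ (Or.inr rfl) hqΦ
  have hP0 : P ≠ 0 := by omega
  have hQ0 : Q ≠ 0 := by omega
  have hPZ : (P : ℤ) ≠ 0 := by omega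
  have hQZ : (Q : ℤ) ≠ 0 := by omega
  have hpq : 2 * p * q ≠ 0 := mul_ne_zero (mul_ne_zero two_ne_zero hpΦ.1) hqΦ.1
  have hT₁ : T (2 * p * q) q = adicBall (oddRamified Q (-1 * (2 * P))) 0 := by
    rw [← T_neg_two_mul hP8 hQ8 hPs hQs, ← T_eq_of_eq_mul_sq hQ0 hw hv hp hq]
    congr 1; push_cast; ring
  have hT₂ : T (-2 * p * q) q = adicBall (insert 2 (oddRamified Q (1 * (2 * P)))) 0 := by
    rw [← T_two_mul hP8 hQ8 hPs hQs, ← T_eq_of_eq_mul_sq hQ0 hw hv hp hq]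
    congr 1; push_cast; ring
  have hd₁ := fun {l : ℕ} => mem_oddRamified_dvd (s := -1) (Or.inr rfl) hP0 hQ0 (l := l)
  have hd₂ := fun {l : ℕ} => mem_oddRamified_dvd (s := 1) (Or.inl rfl) hP0 hQ0 (l := l)
  have hΔ₁ : ∀ l ∈ oddRamified Q (-1 * (2 * P)), l.Prime := fun l hl => (hd₁ hl).1
  have hΔ₂ : ∀ l ∈ insert 2 (oddRamified Q (1 * (2 * P))), l.Prime := fun l hl =>
    (Finset.mem_insert.1 hl).elim (fun h => h ▸ Nat.prime_two) fun h => (hd₂ h).1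
  have hJ₁ : J (2 * p * q) q = adicBall (oddRamified Q (-1 * (2 * P))) 1 := by
    refine J_eq_adicBall hΔ₁ hT₁ hpq hqΦ.1 fun l hl => ?_
    have := odd_padicValRat_of_dvd (hΔ₁ l hl) hPs hQs hw hv hp hq (by omega) (by omega)
      (Or.inr (hd₁ hl).2.2) 1 (Or.inl rfl)
    rwa [one_mul] at this
  have hJ₂ : J (-2 * p * q) q = adicBall (insert 2 (oddRamified Q (1 * (2 * P)))) 1 := by
    have e : -2 * p * q = -1 * (2 * p * q) := by ring
    refine J_eq_adicBall hΔ₂ hT₂ (by rw [e]; exact mul_ne_zero (by norm_num) hpq) hqΦ.1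
      fun l hl => ?_
    rw [e]
    exact odd_padicValRat_of_dvd (hΔ₂ l hl) hPs hQs hw hv hp hq (by omega) (by omega)
      ((Finset.mem_insert.1 hl).imp id fun h => (hd₂ h).2.2) (-1) (Or.inr rfl)
  refine ⟨oddRamified Q (-1 * (2 * P)) ∩ insert 2 (oddRamified Q (1 * (2 * P))),
    fun l hl => hΔ₁ l (Finset.mem_inter.1 hl).1, ?_, ?_, ?_⟩
  -- The odd symbols of (Q, 2P) multiply to -1, so one of them is not 1.
  · obtain ⟨l, hl, hne⟩ : ∃ l ∈ oddPrimeFactors (Q * (1 * (2 * P))),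
        hilb l Q (1 * (2 * P)) ≠ 1 := by
      by_contra! hcon
      have := prod_hilb_two_mul hP8 hQ8 1 (Or.inl rfl)
      rw [Finset.prod_eq_one hcon] at this
      norm_num at this
    have h2P : (1 * (2 * P) : ℤ) ≠ 0 := by omega
    have hlp := ((mem_oddPrimeFactors (mul_ne_zero hQZ h2P)).1 hl).2.1
    have hneg := (hilb_eq_one_or hlp hQZ h2P).resolve_left hne
    have hlmem : l ∈ oddRamified Q (1 * (2 * P)) := Finset.mem_filter.2 ⟨hl, hneg⟩
    obtain ⟨-, hl2, hdvd⟩ := hd₂ hlmem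
    -- Primes dividing P are 1 mod 8. If l divided only Q and were 3 mod 8, the condition defining Ψ
    -- would make 2P a square modulo l, and the symbol at l would be 1.
    have hl8 : l % 8 = 1 := by
      by_cases hlP : l ∣ P
      · simpa using hPl l hlp hlP
      have hlQ := hdvd.resolve_left hlP
      refine (hQl l hlp hlQ).resolve_right fun hl3 => ?_
      have hl2P : ¬ (l : ℤ) ∣ 1 * (2 * P) := fun h => by
        rw [one_mul] at h
        rcases (Nat.prime_iff_prime_int.1 hlp).dvd_or_dvd h with h | h
        · exact not_dvd_two hlp hl2 h
        · exact hlP (by exact_mod_cast h)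
      have hvq : Odd (padicValRat l q) := by
        rw [hq]
        refine odd_padicValRat_mul_sq hlp (by exact_mod_cast hQ0) hv ?_
        rw [padicValRat.of_int, padicValInt_eq_one_of_squarefree hlp
          (Int.squarefree_natCast.2 hQs) (Int.natCast_dvd_natCast.2 hlQ)]
        decide
      obtain ⟨hjn, hjd⟩ := jacobsonRadical_dvd_num hlp (R3_subset_adicBall hlp hl3 hqΦ.1 hvq) hj
      have hJ : jacobiSym (1 * (2 * P)) l = 1 := by
        refine jacobiSym_eq_one_of_eq_sq_mul hlp hl2P (r := 2 * u / w) hjn hjd ?_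
        rw [hp] at hpj
        push_cast at hpj ⊢
        field_simp
        linear_combination hpj
      rw [hilb_comm, hilb_of_not_dvd_left hl2P, hJ, one_pow] at hne
      exact hne rfl
    -- As l ≡ 1 mod 8, -1 is a square modulo l, so changing the sign of 2P does not change the
    -- symbol.
    refine ⟨l, Finset.mem_inter.2 ⟨Finset.mem_filter.2 ⟨?_, ?_⟩, Finset.mem_insert_of_mem hlmem⟩⟩
    · refine (mem_oddPrimeFactors (mul_ne_zero hQZ (by omega))).2 ⟨hl2, hlp, ?_⟩
      have := ((mem_oddPrimeFactors (mul_ne_zero hQZ h2P)).1 hl).2.2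
      have e : (Q : ℤ) * (-1 * (2 * P)) = -(Q * (1 * (2 * P))) := by ring
      rwa [e, dvd_neg]
    · have hm1 : ¬ (l : ℤ) ∣ -1 := fun h => hlp.not_dvd_one (by exact_mod_cast (dvd_neg.1 h))
      rw [hilb_mul_right hlp (by norm_num) (by omega), hilb_comm, hilb_of_not_dvd_left hm1,
        jacobiSym.at_neg_one (Nat.odd_iff.2 (by omega)), ZMod.χ₄_nat_one_mod_four (by omega),
        one_pow, one_mul, ← hneg, one_mul]
  · rw [R1, hT₁, hT₂, adicBall_add hΔ₁ hΔ₂]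
  · rw [hJ₁, hJ₂, adicBall_add hΔ₁ hΔ₂]

theorem jacobsonRadical_R1_eq {p q : ℚ} (h : (p, q) ∈ Ψ) :
    jacobsonRadical (R1 p q) = J (2 * p * q) q + J (-2 * p * q) q := by
  obtain ⟨Δ, hΔ, hne, hR, hJ⟩ := exists_adicBall_of_mem_Ψ h
  rw [hR, hJ, jacobsonRadical_adicBall hΔ hne]

/-! ### Diophantine definability -/

open MvPolynomial

/-- Diophantine predicates on rational points, with arbitrary index types. -/
def DiophPred {α : Type} (p : (α → ℚ) → Prop) : Prop :=
  ∃ (β : Type) (_ : Fintype β) (f : MvPolynomial (α ⊕ β) ℤ),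
    ∀ t : α → ℚ, p t ↔ ∃ x : β → ℚ, aeval (Sum.elim t x) f = 0

namespace DiophPred

variable {α : Type}

theorem congr {p p' : (α → ℚ) → Prop} (hp : DiophPred p) (h : ∀ t, p t ↔ p' t) : DiophPred p' := by
  have : p = p' := funext fun t => propext (h t)
  rwa [← this]

theorem eq (f g : MvPolynomial α ℤ) : DiophPred fun t : α → ℚ => aeval t f = aeval t g := by
  refine ⟨Empty, inferInstance, rename Sum.inl (f - g), fun t => ?_⟩
  simp [aeval_rename, Sum.elim_comp_inl, sub_eq_zero]

/-- Over ℚ a sum of two squares vanishes only if both terms do. -/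
theorem and {p p' : (α → ℚ) → Prop} (hp : DiophPred p) (hp' : DiophPred p') :
    DiophPred fun t => p t ∧ p' t := by
  obtain ⟨β, _, f, hf⟩ := hp
  obtain ⟨β', _, g, hg⟩ := hp'
  refine ⟨β ⊕ β', inferInstance, rename (Sum.map id Sum.inl) f ^ 2 +
    rename (Sum.map id Sum.inr) g ^ 2, fun t => ?_⟩
  have e₁ : ∀ x : β ⊕ β' → ℚ, Sum.elim t x ∘ Sum.map id Sum.inl = Sum.elim t (x ∘ Sum.inl) :=
    fun x => by ext (_ | _) <;> rfl
  have e₂ : ∀ x : β ⊕ β' → ℚ, Sum.elim t x ∘ Sum.map id Sum.inr = Sum.elim t (x ∘ Sum.inr) :=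
    fun x => by ext (_ | _) <;> rfl
  have key : ∀ x : β ⊕ β' → ℚ, aeval (Sum.elim t x) (rename (Sum.map id Sum.inl) f ^ 2 +
      rename (Sum.map id Sum.inr) g ^ 2) = 0 ↔
      aeval (Sum.elim t (x ∘ Sum.inl)) f = 0 ∧ aeval (Sum.elim t (x ∘ Sum.inr)) g = 0 := fun x => by
    rw [map_add, map_pow, map_pow, aeval_rename, aeval_rename, e₁, e₂,
      add_eq_zero_iff_of_nonneg (sq_nonneg _) (sq_nonneg _), sq_eq_zero_iff, sq_eq_zero_iff]
  simp only [key, hf, hg]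
  constructor
  · rintro ⟨⟨x, hx⟩, y, hy⟩
    exact ⟨Sum.elim x y, by simpa using ⟨hx, hy⟩⟩
  · rintro ⟨x, hx, hy⟩
    exact ⟨⟨_, hx⟩, _, hy⟩

theorem ex {γ : Type} [Fintype γ] {p : (α ⊕ γ → ℚ) → Prop} (hp : DiophPred p) :
    DiophPred fun t => ∃ x : γ → ℚ, p (Sum.elim t x) := by
  obtain ⟨β, _, f, hf⟩ := hp
  refine ⟨γ ⊕ β, inferInstance, rename (Equiv.sumAssoc α γ β) f, fun t => ?_⟩
  have e : ∀ (x : γ → ℚ) (y : β → ℚ), Sum.elim t (Sum.elim x y) ∘ Equiv.sumAssoc α γ β =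
      Sum.elim (Sum.elim t x) y := fun x y => by ext ((_ | _) | _) <;> rfl
  simp only [hf, aeval_rename]
  constructor
  · rintro ⟨x, y, h⟩
    exact ⟨Sum.elim x y, by rwa [e]⟩
  · rintro ⟨x, h⟩
    refine ⟨x ∘ Sum.inl, x ∘ Sum.inr, ?_⟩
    rwa [← e, Sum.elim_comp_inl_inr]

theorem isDiophantine {k : ℕ} {p : (Fin k → ℚ) → Prop} (hp : DiophPred p) :
    IsDiophantine {t | p t} := by
  obtain ⟨β, _, f, hf⟩ := hp
  have eqv := Fintype.equivFin β
  refine ⟨Fintype.card β, rename (Sum.map id eqv) f, fun t => ?_⟩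
  have e : ∀ x : Fin (Fintype.card β) → ℚ, Sum.elim t x ∘ Sum.map id eqv = Sum.elim t (x ∘ eqv) :=
    fun x => by ext (_ | _) <;> rfl
  simp only [Set.mem_ofPred_eq, hf, aeval_rename, e]
  constructor
  · rintro ⟨x, h⟩
    exact ⟨x ∘ eqv.symm, by rwa [Function.comp_assoc, Equiv.symm_comp_self, Function.comp_id]⟩
  · rintro ⟨x, h⟩
    exact ⟨_, h⟩

theorem mem_S (a b t : MvPolynomial α ℤ) :
    DiophPred fun v : α → ℚ => aeval v t ∈ S (aeval v a) (aeval v b) := by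
  have h := ((eq (α := α ⊕ Fin 4)
    (X (Sum.inr 0) ^ 2 - rename Sum.inl a * X (Sum.inr 1) ^ 2 -
      rename Sum.inl b * X (Sum.inr 2) ^ 2 +
      rename Sum.inl a * rename Sum.inl b * X (Sum.inr 3) ^ 2) 1).and
    (eq (rename Sum.inl t) (2 * X (Sum.inr 0)))).ex
  refine h.congr fun v => ?_
  simp only [map_sub, map_add, map_mul, map_pow, aeval_X, aeval_rename, Sum.elim_comp_inl,
    Sum.elim_inr, map_one, map_ofNat]
  constructor
  · rintro ⟨x, h₁, h₂⟩
    exact ⟨_, _, _, _, h₁, h₂⟩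
  · rintro ⟨x₁, x₂, x₃, x₄, h₁, h₂⟩
    exact ⟨![x₁, x₂, x₃, x₄], by simpa using h₁, by simpa using h₂⟩

theorem mem_T (a b t : MvPolynomial α ℤ) :
    DiophPred fun v : α → ℚ => aeval v t ∈ T (aeval v a) (aeval v b) := by
  have h := (((mem_S (α := α ⊕ Fin 2) (rename Sum.inl a) (rename Sum.inl b) (X (Sum.inr 0))).and
    (mem_S (rename Sum.inl a) (rename Sum.inl b) (X (Sum.inr 1)))).and
    (eq (X (Sum.inr 0) + X (Sum.inr 1)) (rename Sum.inl t))).ex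
  refine h.congr fun v => ?_
  simp only [map_add, aeval_X, aeval_rename, Sum.elim_comp_inl, Sum.elim_inr]
  unfold T
  rw [Set.mem_add]
  constructor
  · rintro ⟨x, ⟨h₁, h₂⟩, h₃⟩
    exact ⟨_, h₁, _, h₂, h₃⟩
  · rintro ⟨x, h₁, y, h₂, h₃⟩
    exact ⟨![x, y], ⟨h₁, h₂⟩, h₃⟩

theorem mem_TUnits (a b t : MvPolynomial α ℤ) :
    DiophPred fun v : α → ℚ => aeval v t ∈ TUnits (aeval v a) (aeval v b) := by
  have h := (mem_T a b t).and (((mem_T (α := α ⊕ Fin 1) (rename Sum.inl a) (rename Sum.inl b)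
    (X (Sum.inr 0))).and (eq (rename Sum.inl t * X (Sum.inr 0)) 1)).ex)
  refine h.congr fun v => ?_
  simp only [map_mul, aeval_X, aeval_rename, Sum.elim_comp_inl, Sum.elim_inr, map_one]
  refine and_congr_right fun _ => ?_
  constructor
  · rintro ⟨x, h₁, h₂⟩
    exact ⟨_, h₁, h₂⟩
  · rintro ⟨x, h₁, h₂⟩
    exact ⟨![x], h₁, h₂⟩

theorem mem_sqClass (a b c t : MvPolynomial α ℤ) :
    DiophPred fun v : α → ℚ => aeval v t ∈ sqClass (aeval v a) (aeval v b) (aeval v c) := by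
  have h := ((mem_TUnits (α := α ⊕ Fin 2) (rename Sum.inl a) (rename Sum.inl b)
    (X (Sum.inr 1))).and (eq (rename Sum.inl t)
      (rename Sum.inl c * X (Sum.inr 0) ^ 2 * X (Sum.inr 1)))).ex
  refine h.congr fun v => ?_
  simp only [map_mul, map_pow, aeval_X, aeval_rename, Sum.elim_comp_inl, Sum.elim_inr]
  constructor
  · rintro ⟨x, h₁, h₂⟩
    exact ⟨_, _, h₁, h₂⟩
  · rintro ⟨w, u, h₁, h₂⟩
    exact ⟨![w, u], h₁, h₂⟩

theorem mem_K (a b c t : MvPolynomial α ℤ) :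
    DiophPred fun v : α → ℚ => aeval v t ∈ K (aeval v a) (aeval v b) (aeval v c) := by
  have h := (mem_sqClass a b c t).and (((mem_sqClass (α := α ⊕ Fin 1) (rename Sum.inl a)
    (rename Sum.inl b) 1 (X (Sum.inr 0))).and
      (eq (rename Sum.inl t) (1 - X (Sum.inr 0)))).ex)
  refine h.congr fun v => ?_
  simp only [map_sub, aeval_X, aeval_rename, Sum.elim_comp_inl, Sum.elim_inr, map_one]
  refine and_congr_right fun _ => ?_
  constructor
  · rintro ⟨x, h₁, h₂⟩
    exact ⟨_, h₁, h₂⟩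
  · rintro ⟨x, h₁, h₂⟩
    exact ⟨![x], h₁, h₂⟩

theorem mem_J (a b t : MvPolynomial α ℤ) :
    DiophPred fun v : α → ℚ => aeval v t ∈ J (aeval v a) (aeval v b) := by
  have m := fun c y : MvPolynomial (α ⊕ Fin 2) ℤ =>
    mem_K (rename Sum.inl a) (rename Sum.inl b) c y
  have h := (((m (rename Sum.inl a) (X (Sum.inr 0))).and
    (m (rename Sum.inl a) (rename Sum.inl t - X (Sum.inr 0)))).and
    ((m (rename Sum.inl b) (X (Sum.inr 1))).and
    (m (rename Sum.inl b) (rename Sum.inl t - X (Sum.inr 1))))).ex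
  refine h.congr fun v => ?_
  simp only [map_sub, aeval_X, aeval_rename, Sum.elim_comp_inl, Sum.elim_inr]
  constructor
  · rintro ⟨x, h⟩
    exact ⟨_, _, h⟩
  · rintro ⟨x, y, h⟩
    exact ⟨![x, y], h⟩

theorem mem_J_add_J (p q t : MvPolynomial α ℤ) :
    DiophPred fun v : α → ℚ => aeval v t ∈ J (2 * aeval v p * aeval v q) (aeval v q) +
      J (-2 * aeval v p * aeval v q) (aeval v q) := by
  have h := (((mem_J (α := α ⊕ Fin 2) (2 * rename Sum.inl p * rename Sum.inl q)
    (rename Sum.inl q) (X (Sum.inr 0))).and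
    (mem_J (-2 * rename Sum.inl p * rename Sum.inl q) (rename Sum.inl q) (X (Sum.inr 1)))).and
    (eq (X (Sum.inr 0) + X (Sum.inr 1)) (rename Sum.inl t))).ex
  refine h.congr fun v => ?_
  simp only [map_add, map_mul, map_neg, map_ofNat, aeval_X, aeval_rename, Sum.elim_comp_inl,
    Sum.elim_inr]
  rw [Set.mem_add]
  constructor
  · rintro ⟨x, ⟨h₁, h₂⟩, h₃⟩
    exact ⟨_, h₁, _, h₂, h₃⟩
  · rintro ⟨x, h₁, y, h₂, h₃⟩
    exact ⟨![x, y], ⟨h₁, h₂⟩, h₃⟩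

/-- Coefficients must be integers, so the rational constants p and q become variables pinned down by
linear equations with their numerators and denominators. -/
theorem mem_J_add_J_const (p q : ℚ) (t : MvPolynomial α ℤ) :
    DiophPred fun v : α → ℚ => aeval v t ∈ J (2 * p * q) q + J (-2 * p * q) q := by
  have h := ((mem_J_add_J (α := α ⊕ Fin 2) (X (Sum.inr 0)) (X (Sum.inr 1))
    (rename Sum.inl t)).and ((eq (X (Sum.inr 0) * C (p.den : ℤ)) (C p.num)).and
      (eq (X (Sum.inr 1) * C (q.den : ℤ)) (C q.num)))).ex
  refine h.congr fun v => ?_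
  simp only [map_mul, aeval_X, aeval_rename, Sum.elim_comp_inl, Sum.elim_inr,
    eq_intCast, map_intCast, map_natCast]
  have hp := Rat.mul_den_eq_num p
  have hq := Rat.mul_den_eq_num q
  have hp0 : (p.den : ℚ) ≠ 0 := by exact_mod_cast p.den_nz
  have hq0 : (q.den : ℚ) ≠ 0 := by exact_mod_cast q.den_nz
  constructor
  · rintro ⟨x, h, h₁, h₂⟩
    rw [← hp] at h₁
    rw [← hq] at h₂
    rwa [mul_right_cancel₀ hp0 h₁, mul_right_cancel₀ hq0 h₂] at h
  · exact fun h => ⟨![p, q], h, hp, hq⟩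

end DiophPred

end RatDioph

theorem mainTheorem9 :
    (∀ p q : ℚ, (p, q) ∈ RatDioph.Ψ →
      (∃ A : Subring ℚ, (A : Set ℚ) = RatDioph.R1 p q) ∧
      RatDioph.R1 p q ≠ Set.univ ∧
      RatDioph.jacobsonRadical (RatDioph.R1 p q) =
        RatDioph.J (2 * p * q) q + RatDioph.J (-2 * p * q) q ∧
      RatDioph.IsDiophantine
        {t : Fin 1 → ℚ | t 0 ∈ RatDioph.jacobsonRadical (RatDioph.R1 p q)}) ∧
    (∃ D : Set (Fin 3 → ℚ), RatDioph.IsDiophantine D ∧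
      ∀ p q : ℚ, (p, q) ∈ RatDioph.Ψ → ∀ t : ℚ,
        t ∈ RatDioph.jacobsonRadical (RatDioph.R1 p q) ↔ ![t, p, q] ∈ D) := by
  have key := fun (p q : ℚ) (h : (p, q) ∈ RatDioph.Ψ) =>
    RatDioph.jacobsonRadical_R1_eq h
  refine ⟨fun p q h => ?_, ?_⟩
  · refine ⟨?_, ?_, key p q h, ?_⟩
    · obtain ⟨Δ, hΔ, hne, hR, hJ⟩ := RatDioph.exists_adicBall_of_mem_Ψ h
      exact ⟨RatDioph.semilocalRing Δ hΔ, hR.symm⟩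
    · obtain ⟨Δ, hΔ, hne, hR, hJ⟩ := RatDioph.exists_adicBall_of_mem_Ψ h
      rw [hR]
      exact RatDioph.adicBall_zero_ne_univ hΔ hne
    · rw [key p q h]
      simpa using (RatDioph.DiophPred.mem_J_add_J_const p q
        (MvPolynomial.X (0 : Fin 1))).isDiophantine
  · refine ⟨_, (RatDioph.DiophPred.mem_J_add_J (MvPolynomial.X (1 : Fin 3)) (MvPolynomial.X 2)
      (MvPolynomial.X 0)).isDiophantine, fun p q h t => ?_⟩
    rw [key p q h]
    simp
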